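/- **Proposition (global Morse lemma).** Let $\nu\ge 1$ and let $\alpha_\nu>0$ be a number with $34\,\nu^{5/2}\alpha_\nu<\tfrac12$. Let $\mu$ be a complex measure on $\mathbb R^\nu$ with a differentiable density, $d\mu(\xi)=\rho(\xi)\,d\xi$, such that $\int e^{R|\xi|}\,d|\mu|(\xi)<\infty$ for every $R>0$. Put $$M_\mu=\int e^{5|\xi|}\,d|\mu|(\xi),\qquad M'_\mu=\int\max\bigl(|\rho|,|\partial_{\xi_1}\rho|,\dots,|\partial_{\xi_\nu}\rho|\bigr)e^{5|\xi|}\,d\xi ,$$ and assume $M'_\mu<\infty$, $\overline{\rho(\xi)}=\rho(-\xi)$ for all $\xi$, $\int\xi_j\,d\mu(\xi)=0$ for $j=1,\dots,\nu$, and $\int d\mu=0$. Let $\omega_1,\dots,\omega_\nu,T>0$, $\omega_\flat=\min_\upsilon\omega_\upsilon$, $\omega_\sharp=\max_\upsilon\omega_\upsilon$, and assume $$4T^2M_\mu<1,\qquad \cosh\Bigl(\frac{\omega_\sharp T}{2}\Bigr)\,\frac{\omega_\sharp(1+\omega_\flat T)\,M'_\mu}{\omega_\flat^3\,(1-4T^2M_\mu)}<\alpha_\nu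 .$$ For $t\in\,]0,T[$ and $x,y\in\mathbb C^\nu$ let $q_{t,\upsilon}(s)=\dfrac{\sinh(\omega_\upsilon ts)\,x_\upsilon+\sinh(\omega_\upsilon t(1-s))\,y_\upsilon}{\sinh(\omega_\upsilon t)}$, $q_t(s)=(q_{t,1}(s),\dots,q_{t,\nu}(s))$, let $\mathcal T_m$ be the set of trees with vertex set $\{1,\dots,m\}$, and for $m\ge1$ $$Q_m(t,x,y)=(-2)^{m-1}\sum_{g\in\mathcal T_m}\int_{0<s_1<\dots<s_m<1}\int_{\mathbb R^{\nu m}}\ \prod_{\substack{[j,k]\in g\\ j<k}}\Bigl(\sum_{\upsilon=1}^\nu\frac{\sinh(\omega_\upsilon ts_j)\sinh(\omega_\upsilon t(1-s_k))}{\omega_\upsilon t\,\sinh(\omega_\upsilon t)}\,\xi_{j,\upsilon}\xi_{k,\upsilon}\Bigr)\,e^{i\sum_{j}q_t(s_j)\cdot\xi_j}\ d\mu(\xi_m)\cdots d\mu(\xi_1)\,d^ms$$ (an empty product is $1$). Let $$\varphi=\sum_{m\ge1}t^{2m-2}Q_m,\qquad \phi(t,x,y)=\frac14\sum_{\upsilon=1}^\nu\frac{\omega_\upsilon}{\sinh(\omega_\upsilon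 t)}\Bigl(\cosh(\omega_\upsilon t)(x_\upsilon^2+y_\upsilon^2)-2x_\upsilon y_\upsilon\Bigr)-t\,\varphi(t,x,y).$$ Let $D_{\mathbb R^\nu,1}=\{a+ib:\ a,b\in\mathbb R^\nu,\ |b|<1\}$ and let $D_\omega=D_\omega(t)$ be the diagonal matrix with entries $\tfrac1{\sqrt2}\,\omega_\upsilon^{1/2}\tanh^{1/2}(\omega_\upsilon t/2)$. Then the series defining $\varphi(t,x,x)$ converges absolutely for $(t,x)\in\,]0,T[\,\times D_{\mathbb R^\nu,1}$, and there is a function $\Lambda:\,]0,T[\,\times D_{\mathbb R^\nu,1}\to\mathbb C^\nu$ such that $\Lambda(t,\cdot)$ is analytic on $D_{\mathbb R^\nu,1}$ for every $t$, the map $t\mapsto\Lambda(t,\cdot)$ is continuous on $]0,T[$ for the topology of uniform convergence on compact subsets of $D_{\mathbb R^\nu,1}$, and 1. $\Lambda(t,x)\in\mathbb R^\nu$ for all $(t,x)\in\,]0,T[\,\times\mathbb R^\nu$, and $\displaystyle\sup_{(t,x)\in]0,T[\times D_{\mathbb R^\nu,1}}|\partial_x\Lambda(t,x)|\le\tfrac12$,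 where $|A|=\sup_{|z|=1}|Az|$ for a matrix $A$; 2. for all $(t,x)\in\,]0,T[\,\times D_{\mathbb R^\nu,1}$, $\ \phi(t,x,x)=\theta(t,x)\cdot\theta(t,x)$ with $\theta(t,x)=D_\omega\bigl(x+\Lambda(t,x)\bigr)$ and $z\cdot z=z_1^2+\dots+z_\nu^2$. -/

import Mathlib

open scoped BigOperators

namespace SemiclassicalPhase

noncomputable section

/-- Real `ν`-space with its Euclidean norm. -/
abbrev RSpace (ν : ℕ) := EuclideanSpace ℝ (Fin ν)

/-- Complex `ν`-space with its Hermitian norm `|z| = (z · z̄)^{1/2}`. -/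
abbrev CSpace (ν : ℕ) := EuclideanSpace ℂ (Fin ν)

/-- The tube `D_{ℝ^ν, R} = {a + i b | a, b ∈ ℝ^ν, |b| < R}`. -/
def tube (ν : ℕ) (R : ℝ) : Set (CSpace ν) :=
  {z | ‖(WithLp.toLp 2 (fun j => (z j).im) : RSpace ν)‖ < R}

/-- The smallest frequency `ω_♭ = min_υ ω_υ`. -/
def omegaFlat {ν : ℕ} (ω : Fin ν → ℝ) : ℝ := ⨅ υ, ω υ

/-- The largest frequency `ω_♯ = max_υ ω_υ`. -/
def omegaSharp {ν : ℕ} (ω : Fin ν → ℝ) : ℝ := ⨆ υ, ω υ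

/-! Throughout, the complex measure `μ` on `ℝ^ν` is given by its density: `dμ(ξ) = ρ(ξ) dξ`,
so that `d|μ|(ξ) = |ρ(ξ)| dξ`. -/

/-- `M_μ = ∫ e^{5|ξ|} d|μ|(ξ)`. -/
def normM {ν : ℕ} (ρ : RSpace ν → ℂ) : ℝ :=
  ∫ ξ : RSpace ν, Real.exp (5 * ‖ξ‖) * ‖ρ ξ‖

/-- The function `max(|ρ|, |∂_{ξ_1} ρ|, …, |∂_{ξ_ν} ρ|) e^{5|ξ|}`. -/
def weightM' {ν : ℕ} (ρ : RSpace ν → ℂ) (ξ : RSpace ν) : ℝ :=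
  max ‖ρ ξ‖ (⨆ j : Fin ν, ‖fderiv ℝ ρ ξ (EuclideanSpace.single j 1)‖) * Real.exp (5 * ‖ξ‖)

/-- `M'_μ = ∫ max(|ρ|, |∂_{ξ_1} ρ|, …, |∂_{ξ_ν} ρ|) e^{5|ξ|} dξ`. -/
def normM' {ν : ℕ} (ρ : RSpace ν → ℂ) : ℝ :=
  ∫ ξ : RSpace ν, weightM' ρ ξ

/-- The open simplex `0 < s_1 < ⋯ < s_m < 1`. -/
def openSimplex (m : ℕ) : Set (Fin m → ℝ) :=
  {s | StrictMono s ∧ ∀ j, s j ∈ Set.Ioo (0 : ℝ) 1}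

open Classical in
/-- The set of trees with vertex set `{1, …, m}`. -/
def trees (m : ℕ) : Finset (SimpleGraph (Fin m)) :=
  Finset.univ.filter (fun g => g.IsTree)

open Classical in
/-- The edges `[j, k]` of a graph on `{1, …, m}`, each listed once with `j < k`. -/
def edges {m : ℕ} (g : SimpleGraph (Fin m)) : Finset (Fin m × Fin m) :=
  Finset.univ.filter (fun p => p.1 < p.2 ∧ g.Adj p.1 p.2)

/-- The coordinate `q_{t,υ}(s)` of the path
`q_{t,υ}(s) = (sh(ω_υ t s) x_υ + sh(ω_υ t (1-s)) y_υ) / sh(ω_υ t)`. -/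
def path {ν : ℕ} (ω : Fin ν → ℝ) (t : ℝ) (x y : CSpace ν) (s : ℝ) (υ : Fin ν) : ℂ :=
  ((Real.sinh (ω υ * t * s) : ℂ) * x υ + (Real.sinh (ω υ * t * (1 - s)) : ℂ) * y υ) /
    (Real.sinh (ω υ * t) : ℂ)

/-- The tree weight
`Υ_t^{g,ξ} = ∏_{[j,k] ∈ g} ∑_υ sh(ω_υ t s_j) sh(ω_υ t (1-s_k)) / (ω_υ t sh(ω_υ t)) ξ_{j,υ} ξ_{k,υ}`.
-/
def treeWeight {ν m : ℕ} (ω : Fin ν → ℝ) (t : ℝ) (g : SimpleGraph (Fin m))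
    (s : Fin m → ℝ) (ξ : Fin m → RSpace ν) : ℝ :=
  ∏ p ∈ edges g, ∑ υ : Fin ν,
    Real.sinh (ω υ * t * s p.1) * Real.sinh (ω υ * t * (1 - s p.2)) /
      (ω υ * t * Real.sinh (ω υ * t)) * ξ p.1 υ * ξ p.2 υ

/-- The functions
`Q_m(t,x,y) = (-2)^{m-1} ∑_{g tree} ∫_{0<s_1<⋯<s_m<1} ∫_{ℝ^{νm}} Υ_t^{g,ξ} e^{i ∑_j q_t(s_j)·ξ_j}
dμ(ξ_m) ⋯ dμ(ξ_1) ds_1 ⋯ ds_m`, for `m ≥ 1`.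
For `m = 1` there is one tree, it has no edge, and its weight is `1`. -/
def Q {ν : ℕ} (ω : Fin ν → ℝ) (ρ : RSpace ν → ℂ) (m : ℕ) (t : ℝ) (x y : CSpace ν) : ℂ :=
  (-2) ^ (m - 1) * ∑ g ∈ trees m,
    ∫ s in openSimplex m, ∫ ξ : Fin m → RSpace ν,
      (treeWeight ω t g s ξ : ℂ) *
        Complex.exp (Complex.I * ∑ j, ∑ υ, path ω t x y (s j) υ * (ξ j υ : ℂ)) *
        ∏ j, ρ (ξ j)

/-- The term of index `m + 1` of the series `φ = ∑_{m ≥ 1} t^{2m-2} Q_m`. -/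
def varphiTerm {ν : ℕ} (ω : Fin ν → ℝ) (ρ : RSpace ν → ℂ) (t : ℝ) (x y : CSpace ν)
    (m : ℕ) : ℂ :=
  (t : ℂ) ^ (2 * m) * Q ω ρ (m + 1) t x y

/-- `φ(t,x,y) = ∑_{m ≥ 1} t^{2m-2} Q_m(t,x,y)`. -/
def varphi {ν : ℕ} (ω : Fin ν → ℝ) (ρ : RSpace ν → ℂ) (t : ℝ) (x y : CSpace ν) : ℂ :=
  ∑' m : ℕ, varphiTerm ω ρ t x y m

/-- The phase
`ϕ(t,x,y) = 1/4 ∑_υ ω_υ / sh(ω_υ t) (ch(ω_υ t) (x_υ² + y_υ²) - 2 x_υ y_υ) - t φ(t,x,y)`. -/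
def phase {ν : ℕ} (ω : Fin ν → ℝ) (ρ : RSpace ν → ℂ) (t : ℝ) (x y : CSpace ν) : ℂ :=
  (1 / 4) * (∑ υ : Fin ν, ((ω υ / Real.sinh (ω υ * t) : ℝ) : ℂ) *
      ((Real.cosh (ω υ * t) : ℂ) * (x υ ^ 2 + y υ ^ 2) - 2 * x υ * y υ))
    - (t : ℂ) * varphi ω ρ t x y

/-- The diagonal matrix `D_ω = 2^{-1/2} diag(ω_υ^{1/2} th^{1/2}(ω_υ t / 2))`. -/
def Dmat {ν : ℕ} (ω : Fin ν → ℝ) (t : ℝ) : Matrix (Fin ν) (Fin ν) ℂ :=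
  Matrix.diagonal fun υ =>
    ((1 / Real.sqrt 2 * (Real.sqrt (ω υ) * Real.sqrt (Real.tanh (ω υ * t / 2))) : ℝ) : ℂ)

/-- `Λ ∈ C⁰(]0,T[, 𝒜_{ℂ^ν}(U))`: every `Λ(t,·)` is analytic on `U`, and `t ↦ Λ(t,·)` is continuous
for the topology of uniform convergence on the compact subsets of `U`. -/
def ContinuousAnalyticFamily {ν : ℕ} (T : ℝ) (U : Set (CSpace ν))
    (Λ : ℝ → CSpace ν → CSpace ν) : Prop :=
  (∀ t ∈ Set.Ioo 0 T, AnalyticOnNhd ℂ (Λ t) U) ∧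
  ∀ t₀ ∈ Set.Ioo 0 T, ∀ K : Set (CSpace ν), K ⊆ U → IsCompact K →
    TendstoUniformlyOn Λ (Λ t₀) (nhds t₀) K

end

end SemiclassicalPhase

/-! On the diagonal the phase is `B_t(x,x) - t Φ_t(x)`. Here `B_t` is the diagonal form with
coefficients `½ ω_υ th(ω_υ t/2)`, the squares of the entries of `D_ω`, and `Φ_t(x) = φ(t,x,x)`. The
task is to take a square root of this perturbed quadratic form globally in `x`, and the root can be
written down explicitly.

Every tree with at least two vertices has a leaf away from any prescribed vertex, and its weight is
linear in the momentum there. The vanishing first moment, together with the vanishing total mass for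
the one-vertex tree, gives `Φ_t(0) = 0` and `Φ_t'(0) = 0`. Taylor's formula then reads `Φ_t(x) =
H(x)(x,x)` with `H(x) = ∫₀¹ (1-s) Φ_t''(sx) ds` symmetric. Let `J_t` be `t` times the inverse of
`B_t` and `K(x) = J_t H(x)`. The phase becomes `B_t((1 - K)x, x)`, and `K` is self-adjoint for
`B_t`. If `W = (1 - K)^{1/2}` is the power series root, then `W` is self-adjoint too, so the phase
is `B_t(Wx, Wx)`. Writing `W = 1 - 2Z(K)`, with `Z` the Catalan series, the choice is `Λ(t,x) = -2
Z(K(x)) x` (`bilin_morseDisplacement`). Reality holds because the Catalan coefficients are real and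
`Φ_t` is real on real vectors.

The bound `1/2` on `∂_x Λ` requires `K` and `|x| |K'(x)|` to be small, since `x` is unbounded.
Cauchy's estimates between the tubes of widths 1 and 3 reduce this to bounds on `|Φ_t|` and `|x|
|Φ_t|` in the larger tube. Summing edge products over trees is controlled by parent maps
(`sum_trees_prod_edges_le`). The resulting factorial is cancelled by the volume of the simplex,
leaving a geometric series of ratio `4 T² M_μ`. The weighted bound follows from integration by parts
in one momentum (`coord_mul_integral_kernel`): a coordinate of `x` is traded for a derivative of the
density, which is why `M'_μ` appears. Finally `J_t` is bounded uniformly in `t`, because `t / th(ω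
t/2)` is bounded on bounded intervals. -/

namespace SemiclassicalPhase

/-! ### Cauchy estimates and holomorphy of the derivative. -/

section ComplexAnalysis

open Metric Set Filter Topology

variable {E F : Type*} [NormedAddCommGroup E] [NormedSpace ℂ E]
  [NormedAddCommGroup F] [NormedSpace ℂ F]

/-- Cauchy's estimate for the Fréchet derivative. -/
theorem norm_fderiv_le_of_closedBall {f : E → F} {c : E} {r C : ℝ} (hr : 0 < r)
    (hd : ∀ z ∈ closedBall c r, DifferentiableAt ℂ f z)
    (hC : ∀ z ∈ closedBall c r, ‖f z‖ ≤ C) : ‖fderiv ℂ f c‖ ≤ C / r := by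
  have hc : c ∈ closedBall c r := mem_closedBall_self hr.le
  have hC0 : 0 ≤ C := (norm_nonneg _).trans (hC c hc)
  refine ContinuousLinearMap.opNorm_le_bound _ (by positivity) fun v => ?_
  rcases eq_or_ne v 0 with rfl | hv
  · simp
  have hv' : 0 < ‖v‖ := norm_pos_iff.2 hv
  have hmem : ∀ z ∈ closedBall (0 : ℂ) (r / ‖v‖), c + z • v ∈ closedBall c r := by
    intro z hz
    rw [mem_closedBall_zero_iff, le_div_iff₀ hv'] at hz
    simpa [norm_smul] using hz
  have hg : ∀ z ∈ closedBall (0 : ℂ) (r / ‖v‖),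
      HasDerivAt (fun z : ℂ => f (c + z • v)) (fderiv ℂ f (c + z • v) v) z := by
    intro z hz
    have h1 : HasDerivAt (fun z : ℂ => c + z • v) v z := by
      simpa using ((hasDerivAt_id z).smul_const v).const_add c
    exact ((hd _ (hmem z hz)).hasFDerivAt).comp_hasDerivAt z h1
  have hR : 0 < r / ‖v‖ := by positivity
  have key := Complex.norm_deriv_le_of_forall_mem_sphere_norm_le (c := 0) (C := C) hR
    (f := fun z : ℂ => f (c + z • v))
    (DifferentiableOn.diffContOnCl fun z hz =>
      (hg z (closure_ball_subset_closedBall hz)).differentiableAt.differentiableWithinAt)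
    (fun z hz => hC _ (hmem z (sphere_subset_closedBall hz)))
  rw [(hg 0 (mem_closedBall_self hR.le)).deriv] at key
  simp only [zero_smul, add_zero] at key
  calc _ ≤ C / (r / ‖v‖) := key
    _ = C / r * ‖v‖ := by field_simp

/-- Cauchy's estimate is applied to the increment `f(z + h) - f(z)`, which the mean value inequality
makes of size `O(‖h‖)`. The derivative is therefore locally Lipschitz. -/
theorem continuousAt_fderiv_of_differentiableOn {f : E → F} {U : Set E} (hU : IsOpen U)
    (hf : DifferentiableOn ℂ f U) {c : E} (hc : c ∈ U) : ContinuousAt (fderiv ℂ f) c := by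
  have hcont : ContinuousAt f c := hf.continuousOn.continuousAt (hU.mem_nhds hc)
  have hev : ∀ᶠ z in 𝓝 c, z ∈ U ∧ ‖f z‖ < ‖f c‖ + 1 :=
    Filter.Eventually.and (hU.mem_nhds hc) (hcont.norm.eventually_lt_const (by linarith))
  obtain ⟨R, hR, hball⟩ := Metric.eventually_nhds_iff_ball.1 hev
  set C := ‖f c‖ + 1
  have hC : 0 < C := by positivity
  set r := R / 4
  have hr : 0 < r := by positivity
  have hb : ∀ y ∈ closedBall c (2 * r), ‖fderiv ℂ f y‖ ≤ C / r := by
    intro y hy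
    have hsub : ∀ z ∈ closedBall y r, z ∈ ball c R := by
      intro z hz
      have := dist_triangle z y c
      rw [mem_closedBall] at hz hy
      rw [mem_ball]; simp only [r] at *; linarith
    exact norm_fderiv_le_of_closedBall hr
      (fun z hz => hf.differentiableAt (hU.mem_nhds (hball z (hsub z hz)).1))
      (fun z hz => (hball z (hsub z hz)).2.le)
  have hlip : ∀ y ∈ closedBall c r, ‖fderiv ℂ f y - fderiv ℂ f c‖ ≤ C / r / r * ‖y - c‖ := by
    intro y hy
    have hy' : ‖y - c‖ ≤ r := by rwa [mem_closedBall, dist_eq_norm] at hy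
    have hm2 : ∀ z ∈ closedBall c r, z + (y - c) ∈ closedBall c (2 * r) := by
      intro z hz
      rw [mem_closedBall, dist_eq_norm] at hz ⊢
      calc ‖z + (y - c) - c‖ = ‖(z - c) + (y - c)‖ := by congr 1; abel
        _ ≤ _ := (norm_add_le _ _).trans (by linarith)
    have hm1 : ∀ z ∈ closedBall c r, z ∈ closedBall c (2 * r) := fun z hz =>
      closedBall_subset_closedBall (by linarith) hz
    have hd : ∀ z ∈ closedBall c (2 * r), DifferentiableAt ℂ f z := by
      intro z hz
      refine hf.differentiableAt (hU.mem_nhds (hball z ?_).1)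
      rw [mem_closedBall] at hz; rw [mem_ball]; simp only [r] at *; linarith
    have hd' : ∀ z ∈ closedBall c r, DifferentiableAt ℂ (fun z => f (z + (y - c))) z := by
      intro z hz
      exact (hd _ (hm2 z hz)).comp z (by fun_prop)
    have key := norm_fderiv_le_of_closedBall (f := fun z => f (z + (y - c)) - f z) (c := c) hr
      (C := C / r * ‖y - c‖)
      (fun z hz => (hd' z hz).sub (hd z (hm1 z hz)))
      (fun z hz => by
        have := (convex_closedBall c (2 * r)).norm_image_sub_le_of_norm_fderiv_le (𝕜 := ℂ) hd hb
          (hm1 z hz) (hm2 z hz)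
        simpa using this)
    have hcc : c ∈ closedBall c r := mem_closedBall_self hr.le
    rw [fderiv_fun_sub (hd' c hcc) (hd c (hm1 c hcc)), fderiv_comp_add_right] at key
    simp only [add_sub_cancel] at key
    calc _ ≤ _ := key
      _ = _ := by ring
  rw [ContinuousAt, tendsto_iff_norm_sub_tendsto_zero]
  refine squeeze_zero' (Eventually.of_forall fun _ => norm_nonneg _)
    (Filter.mem_of_superset (closedBall_mem_nhds c hr) hlip) ?_
  have : Tendsto (fun y : E => C / r / r * ‖y - c‖) (𝓝 c) (𝓝 (C / r / r * ‖c - c‖)) := by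
    apply Continuous.tendsto; fun_prop
  simpa using this

/-- A directional derivative is a Cauchy integral of `f` over a circle in the direction `v`. It can
be differentiated under the integral sign because the derivative of `f` is locally bounded and
continuous. -/
theorem differentiableAt_fderiv_apply_of_differentiableOn [CompleteSpace F] {f : E → F} {U : Set E}
    (hU : IsOpen U) (hf : DifferentiableOn ℂ f U) {c : E} (hc : c ∈ U) (v : E) :
    DifferentiableAt ℂ (fun z => fderiv ℂ f z v) c := by
  have hev : ∀ᶠ z in 𝓝 c, z ∈ U ∧ ‖fderiv ℂ f z‖ < ‖fderiv ℂ f c‖ + 1 :=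
    Filter.Eventually.and (hU.mem_nhds hc)
      ((continuousAt_fderiv_of_differentiableOn hU hf hc).norm.eventually_lt_const (by linarith))
  obtain ⟨R, hR, hball⟩ := Metric.eventually_nhds_iff_ball.1 hev
  set C := ‖fderiv ℂ f c‖ + 1
  obtain ⟨r, hr, hrv⟩ : ∃ r : ℝ, 0 < r ∧ r * ‖v‖ < R / 2 := by
    refine ⟨R / 4 / (‖v‖ + 1), by positivity, ?_⟩
    have : 0 ≤ ‖v‖ := norm_nonneg v
    rw [div_mul_eq_mul_div, div_lt_iff₀ (by positivity)]
    nlinarith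
  have hmem : ∀ z ∈ ball c (R / 2), ∀ w ∈ closedBall (0 : ℂ) r, z + w • v ∈ ball c R := by
    intro z hz w hw
    rw [mem_ball, dist_eq_norm] at hz ⊢
    rw [mem_closedBall_zero_iff] at hw
    have : ‖w • v‖ ≤ r * ‖v‖ := by rw [norm_smul]; gcongr
    calc ‖z + w • v - c‖ = ‖(z - c) + w • v‖ := by congr 1; abel
      _ ≤ ‖z - c‖ + ‖w • v‖ := norm_add_le _ _
      _ < R := by linarith
  have hdiff : ∀ z ∈ ball c R, DifferentiableAt ℂ f z := fun z hz =>
    hf.differentiableAt (hU.mem_nhds (hball z hz).1)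
  have hw : ∀ θ : ℝ, circleMap 0 r θ ∈ closedBall (0 : ℂ) r := fun θ =>
    circleMap_mem_closedBall 0 hr.le θ
  -- The Cauchy kernel of the first derivative, pulled back to the parameter of the circle.
  set k : ℝ → ℂ := fun θ => deriv (circleMap 0 r) θ * ((circleMap 0 r θ - 0) ^ 2)⁻¹ with hk
  have hkc : Continuous k := by
    refine Continuous.mul ?_ (Continuous.inv₀ (by fun_prop) fun θ => ?_)
    · rw [show deriv (circleMap 0 r) = fun θ => circleMap 0 r θ * Complex.I from
        funext fun θ => by simp]
      fun_prop
    · simp [hr.ne']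
  have hformula : ∀ z ∈ ball c (R / 2), fderiv ℂ f z v =
      (2 * Real.pi * Complex.I : ℂ)⁻¹ • ∫ θ in (0 : ℝ)..2 * Real.pi,
        k θ • f (z + circleMap 0 r θ • v) := by
    intro z hz
    have hlin : ∀ w : ℂ, HasDerivAt (fun w : ℂ => z + w • v) v w := fun w => by
      simpa using ((hasDerivAt_id w).smul_const v).const_add z
    have hdO : ∀ w ∈ (fun w : ℂ => z + w • v) ⁻¹' ball c R,
        HasDerivAt (fun w : ℂ => f (z + w • v)) (fderiv ℂ f (z + w • v) v) w := fun w hw =>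
      ((hdiff _ hw).hasFDerivAt).comp_hasDerivAt w (hlin w)
    have h := Complex.two_pi_I_inv_smul_circleIntegral_sub_sq_inv_smul_of_differentiable
      (U := (fun w : ℂ => z + w • v) ⁻¹' ball c R) (c := 0) (w₀ := 0) (R := r)
      (f := fun w : ℂ => f (z + w • v))
      (isOpen_ball.preimage (by fun_prop)) (fun w hw => hmem z hz w hw)
      (fun w hw => (hdO w hw).differentiableAt.differentiableWithinAt) (mem_ball_self hr)
    rw [(hdO 0 (hmem z hz 0 (mem_closedBall_self hr.le))).deriv] at h
    simp only [zero_smul, add_zero] at h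
    rw [← h, circleIntegral]
    simp only [hk, smul_smul]
  have hcontz : ∀ z ∈ ball c (R / 2), Continuous fun θ => k θ • f (z + circleMap 0 r θ • v) := by
    intro z hz
    refine hkc.smul (continuous_iff_continuousAt.2 fun θ => ?_)
    have h1 : ContinuousAt f (z + circleMap 0 r θ • v) :=
      (hdiff _ (hmem z hz _ (hw θ))).continuousAt
    exact ContinuousAt.comp (f := fun θ => z + circleMap 0 r θ • v) h1 (by fun_prop)
  have hcontz' : Continuous fun θ => k θ • fderiv ℂ f (c + circleMap 0 r θ • v) := by
    refine hkc.smul (continuous_iff_continuousAt.2 fun θ => ?_)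
    have h1 : ContinuousAt (fderiv ℂ f) (c + circleMap 0 r θ • v) :=
      continuousAt_fderiv_of_differentiableOn hU hf
        (hball _ (hmem c (mem_ball_self (by positivity)) _ (hw θ))).1
    exact ContinuousAt.comp (f := fun θ => c + circleMap 0 r θ • v) h1 (by fun_prop)
  have hR2 : ball c (R / 2) ∈ 𝓝 c := ball_mem_nhds c (by positivity)
  have hmain := intervalIntegral.hasFDerivAt_integral_of_dominated_of_fderiv_le (𝕜 := ℂ)
    (μ := MeasureTheory.volume) (a := 0) (b := 2 * Real.pi)
    (F := fun z θ => k θ • f (z + circleMap 0 r θ • v))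
    (F' := fun z θ => k θ • fderiv ℂ f (z + circleMap 0 r θ • v)) (x₀ := c)
    (s := ball c (R / 2)) (bound := fun θ => ‖k θ‖ * C) hR2
    (Filter.mem_of_superset hR2 fun z hz => (hcontz z hz).aestronglyMeasurable)
    ((hcontz c (mem_ball_self (by positivity))).intervalIntegrable _ _)
    hcontz'.aestronglyMeasurable
    (Eventually.of_forall fun θ _ z hz => by
      rw [norm_smul]
      exact mul_le_mul_of_nonneg_left (hball _ (hmem z hz _ (hw θ))).2.le (norm_nonneg _))
    ((by fun_prop : Continuous fun θ => ‖k θ‖ * C).intervalIntegrable _ _)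
    (Eventually.of_forall fun θ _ z hz => by
      have h1 := (hdiff _ (hmem z hz _ (hw θ))).hasFDerivAt
      have h2 : HasFDerivAt (fun z : E => z + circleMap 0 r θ • v)
          (ContinuousLinearMap.id ℂ E) z := (hasFDerivAt_id z).add_const _
      exact (h1.comp z h2).const_smul (k θ))
  refine (hmain.differentiableAt.const_smul ((2 * Real.pi * Complex.I : ℂ)⁻¹)).congr_of_eventuallyEq
    (Filter.mem_of_superset hR2 hformula)

/-- Finite dimension enters here: the derivative is a finite combination of directional derivatives
along a basis. -/
theorem differentiableOn_fderiv_of_finiteDimensional [FiniteDimensional ℂ E] [CompleteSpace F]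
    {f : E → F} {U : Set E} (hU : IsOpen U) (hf : DifferentiableOn ℂ f U) :
    DifferentiableOn ℂ (fderiv ℂ f) U := by
  intro c hc
  let b := Module.finBasis ℂ E
  have h : fderiv ℂ f = fun z => ∑ i,
      ((LinearMap.toContinuousLinearMap (b.coord i)).smulRightL ℂ E F) (fderiv ℂ f z (b i)) := by
    funext z
    ext v
    conv_lhs => rw [← b.sum_repr v, map_sum]
    simp
  rw [h]
  refine DifferentiableAt.differentiableWithinAt ?_
  refine DifferentiableAt.fun_sum fun i _ => ?_
  exact (ContinuousLinearMap.differentiableAt _).comp c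
    (differentiableAt_fderiv_apply_of_differentiableOn hU hf hc (b i))

end ComplexAnalysis

/-! ### Holomorphic functions of several variables are analytic. -/

section Osgood

open Metric Set Filter Topology

universe u

variable {E F : Type u} [NormedAddCommGroup E] [NormedSpace ℂ E] [FiniteDimensional ℂ E]
  [NormedAddCommGroup F] [NormedSpace ℂ F]

/-- The induction passes from `f` to its derivative, whose values lie in another space. Hence `F` is
quantified inside the statement and shares its universe with `E`. -/
theorem contDiffOn_nat_of_differentiableOn {U : Set E} (hU : IsOpen U) (n : ℕ) :
    ∀ {F : Type u} [NormedAddCommGroup F] [NormedSpace ℂ F] [CompleteSpace F] {f : E → F},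
      DifferentiableOn ℂ f U → ContDiffOn ℂ n f U := by
  induction n with
  | zero => intro F _ _ _ f hf; exact contDiffOn_zero.2 hf.continuousOn
  | succ n ih =>
    intro F _ _ _ f hf
    rw [Nat.cast_add, Nat.cast_one, contDiffOn_succ_iff_fderiv_of_isOpen hU]
    exact ⟨hf, by simp, ih (differentiableOn_fderiv_of_finiteDimensional hU hf)⟩

/-- Cauchy's estimate for iterated derivatives. -/
theorem norm_iteratedFDeriv_le_of_closedBall {U : Set E} (hU : IsOpen U) {ρ : ℝ} (hρ : 0 < ρ)
    {c : E} (n : ℕ) :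
    ∀ {F : Type u} [NormedAddCommGroup F] [NormedSpace ℂ F] [CompleteSpace F] {f : E → F} {C : ℝ},
      DifferentiableOn ℂ f U → closedBall c (n * ρ) ⊆ U →
      (∀ z ∈ closedBall c (n * ρ), ‖f z‖ ≤ C) → ‖iteratedFDeriv ℂ n f c‖ ≤ C / ρ ^ n := by
  induction n with
  | zero =>
    intro F _ _ _ f C hf hs hb
    simpa using hb c (by simp)
  | succ n ih =>
    intro F _ _ _ f C hf hs hb
    have hsub : ∀ z ∈ closedBall c (n * ρ), closedBall z ρ ⊆ closedBall c ((n + 1 : ℕ) * ρ) := by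
      intro z hz
      refine closedBall_subset_closedBall' ?_
      rw [mem_closedBall] at hz
      push_cast; linarith
    -- One derivative uses up a radius `ρ` and costs a factor `1/ρ`; the rest of the ball serves the
    -- remaining `n` derivatives.
    have h := ih (f := fderiv ℂ f) (C := C / ρ)
      (differentiableOn_fderiv_of_finiteDimensional hU hf)
      (fun z hz => hs (hsub z hz (mem_closedBall_self hρ.le)))
      (fun z hz => norm_fderiv_le_of_closedBall hρ
        (fun w hw => hf.differentiableAt (hU.mem_nhds (hs (hsub z hz hw))))
        (fun w hw => hb w (hsub z hz hw)))
    rw [norm_iteratedFDeriv_fderiv] at h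
    rwa [pow_succ', ← div_div]

theorem iteratedDeriv_comp_add_smul [CompleteSpace F] {U : Set E} (hU : IsOpen U) {f : E → F}
    (hf : DifferentiableOn ℂ f U) (c y : E) (n : ℕ) :
    ∀ z : ℂ, c + z • y ∈ U →
      iteratedDeriv n (fun z : ℂ => f (c + z • y)) z =
        iteratedFDeriv ℂ n f (c + z • y) fun _ => y := by
  induction n with
  | zero => intro z hz; simp
  | succ n ih =>
    intro z hz
    have hlin : HasDerivAt (fun z : ℂ => c + z • y) y z := by
      simpa using ((hasDerivAt_id z).smul_const y).const_add c
    have hnhds : ∀ᶠ w in 𝓝 z, c + w • y ∈ U :=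
      hlin.continuousAt.eventually (hU.mem_nhds hz)
    have hcd : ContDiffAt ℂ (n + 1 : ℕ) f (c + z • y) :=
      (contDiffOn_nat_of_differentiableOn hU (n + 1) hf).contDiffAt (hU.mem_nhds hz)
    have hdiff : DifferentiableAt ℂ (iteratedFDeriv ℂ n f) (c + z • y) :=
      hcd.differentiableAt_iteratedFDeriv (by exact_mod_cast Nat.lt_succ_self n)
    rw [iteratedDeriv_succ, Filter.EventuallyEq.deriv_eq (hnhds.mono ih)]
    have h1 := hdiff.hasFDerivAt.comp_hasDerivAt z hlin
    have h2 := (ContinuousMultilinearMap.apply ℂ (fun _ : Fin n => E) F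
      (fun _ => y)).hasFDerivAt.comp_hasDerivAt z h1
    rw [iteratedFDeriv_succ_apply_left]
    exact h2.deriv

/-- A complex differentiable function on an open set of a finite-dimensional space is analytic. -/
theorem analyticOnNhd_of_differentiableOn [CompleteSpace F] {U : Set E} (hU : IsOpen U) {f : E → F}
    (hf : DifferentiableOn ℂ f U) : AnalyticOnNhd ℂ f U := by
  intro c hc
  have hev : ∀ᶠ z in 𝓝 c, z ∈ U ∧ ‖f z‖ < ‖f c‖ + 1 :=
    Filter.Eventually.and (hU.mem_nhds hc)
      ((hf.continuousOn.continuousAt (hU.mem_nhds hc)).norm.eventually_lt_const (by linarith))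
  obtain ⟨R', hR', hball⟩ := Metric.eventually_nhds_iff_ball.1 hev
  set C := ‖f c‖ + 1 with hCdef
  have hC : 0 < C := by positivity
  set R := R' / 2 with hRdef
  have hR : 0 < R := by positivity
  have hsub : closedBall c R ⊆ ball c R' := closedBall_subset_ball (by linarith)
  let p : FormalMultilinearSeries ℂ E F := fun n => ((n.factorial : ℂ)⁻¹) • iteratedFDeriv ℂ n f c
  have hpn : ∀ n, ‖p n‖ * (R / 3) ^ n ≤ C := by
    intro n
    rcases Nat.eq_zero_or_pos n with rfl | hn
    · simpa [p] using (hball c (hsub (mem_closedBall_self hR.le))).2.le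
    have hn' : (0 : ℝ) < n := by exact_mod_cast hn
    -- Splitting `R` into `n` equal steps loses `n^n / n! ≤ e^n ≤ 3^n`, which is why the series is
    -- only claimed on radius `R / 3`.
    have h1 := norm_iteratedFDeriv_le_of_closedBall hU (ρ := R / n) (by positivity) (c := c) n hf
      (C := C)
      (fun z hz => (hball z (hsub (by rwa [mul_div_cancel₀ _ hn'.ne'] at hz))).1)
      (fun z hz => (hball z (hsub (by rwa [mul_div_cancel₀ _ hn'.ne'] at hz))).2.le)
    have h2 : (n : ℝ) ^ n / n.factorial ≤ 3 ^ n := by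
      refine (Real.pow_div_factorial_le_exp n hn'.le n).trans ?_
      rw [show (n : ℝ) = n * 1 by ring, Real.exp_nat_mul]
      gcongr
      exact Real.exp_one_lt_three.le
    have hfac : (0 : ℝ) < n.factorial := by exact_mod_cast n.factorial_pos
    calc ‖p n‖ * (R / 3) ^ n = (n.factorial : ℝ)⁻¹ * ‖iteratedFDeriv ℂ n f c‖ * (R / 3) ^ n := by
          simp [p, norm_smul]
      _ ≤ (n.factorial : ℝ)⁻¹ * (C / (R / n) ^ n) * (R / 3) ^ n := by gcongr
      _ = C * (((n : ℝ) ^ n / n.factorial) / 3 ^ n) := by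
          clear_value R
          rw [div_pow, div_pow]; field_simp
      _ ≤ C * 1 := by
          gcongr
          rw [div_le_one (by positivity)]; exact h2
      _ = C := mul_one C
  let r : NNReal := ⟨R / 3, by positivity⟩
  refine ⟨p, r, ⟨p.le_radius_of_bound C (r := r) hpn, by
    exact ENNReal.coe_pos.2 (show (0 : ℝ) < R / 3 by positivity), ?_⟩⟩
  intro y hy
  have hy' : ‖y‖ < R / 3 := by
    rw [Metric.eball_coe, mem_ball_zero_iff] at hy; exact hy
  -- As `‖y‖ < R/3`, the complex line through `c` and `c + y` stays in the ball for `|z| < 3`. The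
  -- one-variable Taylor series may thus be evaluated at `z = 1`.
  have hmem : ∀ z ∈ ball (0 : ℂ) 3, c + z • y ∈ U := by
    intro z hz
    refine (hball _ (hsub ?_)).1
    rw [mem_ball_zero_iff] at hz
    rw [mem_closedBall, dist_eq_norm, add_sub_cancel_left, norm_smul]
    nlinarith [norm_nonneg z, norm_nonneg y]
  have hg : DifferentiableOn ℂ (fun z : ℂ => f (c + z • y)) (ball 0 3) := by
    intro z hz
    exact ((hf.differentiableAt (hU.mem_nhds (hmem z hz))).comp z
      (by fun_prop : DifferentiableAt ℂ (fun z : ℂ => c + z • y) z)).differentiableWithinAt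
  have hs := Complex.hasSum_taylorSeries_on_ball hg (z := 1) (by simp)
  simp only [sub_zero, one_pow, one_smul] at hs
  convert! hs using 2 with n
  rw [iteratedDeriv_comp_add_smul hU hf c y n 0 (by simpa using hc)]
  simp [p]

/-- Joint continuity of the derivative of a jointly continuous family of holomorphic functions. -/
theorem continuousOn_uncurry_fderiv {X : Type*} [TopologicalSpace X] {I : Set X} {U : Set E}
    (hU : IsOpen U) {f : X → E → F} (hd : ∀ t ∈ I, DifferentiableOn ℂ (f t) U)
    (hc : ContinuousOn (fun p : X × E => f p.1 p.2) (I ×ˢ U)) :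
    ContinuousOn (fun p : X × E => fderiv ℂ (f p.1) p.2) (I ×ˢ U) := by
  rintro ⟨t₀, z₀⟩ ⟨ht₀, hz₀⟩
  simp only at ht₀ hz₀
  have : ProperSpace E := FiniteDimensional.proper ℂ E
  obtain ⟨R, hR, hRU⟩ := Metric.isOpen_iff.1 hU z₀ hz₀
  set r := R / 4 with hr_def
  have hr : 0 < r := by positivity
  have hK : closedBall z₀ (2 * r) ⊆ U := fun z hz => hRU (by
    rw [mem_closedBall] at hz; rw [mem_ball]; linarith)
  rw [ContinuousWithinAt, Metric.tendsto_nhds]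
  intro ε hε
  -- The tolerance `ε/4 * r` anticipates the loss of `1/r` in Cauchy's estimate for `f t - f t₀`.
  obtain ⟨v, hv, hvK⟩ := (isCompact_closedBall z₀ (2 * r)).mem_uniformity_of_prod (f := f)
    (s := I) (q := t₀) (hc.mono (prod_mono_right hK)) ht₀
    (Metric.dist_mem_uniformity (show 0 < ε / 4 * r by positivity))
  have hcont : ∀ᶠ z in 𝓝 z₀, dist (fderiv ℂ (f t₀) z) (fderiv ℂ (f t₀) z₀) < ε / 2 :=
    Metric.tendsto_nhds.1 (continuousAt_fderiv_of_differentiableOn hU (hd t₀ ht₀) hz₀) _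
      (by positivity)
  have h1 : ∀ᶠ p in 𝓝[I ×ˢ U] (t₀, z₀), p.1 ∈ v ∧ p.1 ∈ I := by
    have : Tendsto Prod.fst (𝓝[I ×ˢ U] (t₀, z₀)) (𝓝[I] t₀) := by
      rw [nhdsWithin_prod_eq]; exact tendsto_fst
    exact (this.eventually hv).and (this.eventually self_mem_nhdsWithin)
  have h2 : ∀ᶠ p : X × E in 𝓝[I ×ˢ U] (t₀, z₀), p.2 ∈ closedBall z₀ r ∧
      dist (fderiv ℂ (f t₀) p.2) (fderiv ℂ (f t₀) z₀) < ε / 2 := by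
    have : Tendsto Prod.snd (𝓝[I ×ˢ U] (t₀, z₀)) (𝓝 z₀) :=
      (continuous_snd.tendsto (t₀, z₀)).mono_left nhdsWithin_le_nhds
    exact (this.eventually (closedBall_mem_nhds z₀ hr)).and (this.eventually hcont)
  filter_upwards [h1, h2] with ⟨t, z⟩ ⟨htv, htI⟩ ⟨hz, hz'⟩
  simp only at htv htI hz hz' ⊢
  have hsub : closedBall z r ⊆ closedBall z₀ (2 * r) := closedBall_subset_closedBall' (by
    rw [mem_closedBall] at hz; linarith)
  have hda : ∀ s ∈ I, ∀ w ∈ closedBall z r, DifferentiableAt ℂ (f s) w := fun s hs w hw =>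
    (hd s hs).differentiableAt (hU.mem_nhds (hK (hsub hw)))
  have key := norm_fderiv_le_of_closedBall (f := fun w => f t w - f t₀ w) hr
    (fun w hw => (hda t htI w hw).sub (hda t₀ ht₀ w hw)) (C := ε / 4 * r)
    (fun w hw => by
      have := hvK t htv w (hsub hw)
      rw [← dist_eq_norm]; exact (show dist (f t w) (f t₀ w) < _ from this).le)
  have hzz : z ∈ closedBall z r := mem_closedBall_self hr.le
  rw [fderiv_fun_sub (hda t htI z hzz) (hda t₀ ht₀ z hzz), mul_div_cancel_right₀ _ hr.ne',
    ← dist_eq_norm] at key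
  calc _ ≤ dist (fderiv ℂ (f t) z) (fderiv ℂ (f t₀) z) +
        dist (fderiv ℂ (f t₀) z) (fderiv ℂ (f t₀) z₀) := dist_triangle _ _ _
    _ < ε := by linarith

end Osgood

/-! ### The Catalan series and the square root of `1 - K`. -/

section SquareRoot

open Metric Set Filter Topology

variable {A : Type*} [NormedRing A] [NormedAlgebra ℂ A]

/-- The series `∑ Cₙ (K/4)^{n+1}`, with `Cₙ` the Catalan numbers, so that
`(1 - 2 Z(K))² = 1 - K`. -/
noncomputable def sqrtSeries (K : A) : A :=
  ∑' n : ℕ, ((catalan n : ℂ) / 4 ^ (n + 1)) • K ^ (n + 1)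

theorem catalan_le_four_pow (n : ℕ) : catalan n ≤ 4 ^ n := by
  rw [catalan_eq_centralBinom_div]
  calc n.centralBinom / (n + 1) ≤ n.centralBinom := Nat.div_le_self _ _
    _ ≤ 2 ^ (2 * n) := Nat.choose_le_two_pow _ _
    _ = 4 ^ n := by rw [pow_mul]; norm_num

theorem norm_catalan_div_le (n : ℕ) : ‖(catalan n : ℂ) / 4 ^ (n + 1)‖ ≤ 1 / 4 := by
  have h : (catalan n : ℝ) ≤ 4 ^ n := by exact_mod_cast catalan_le_four_pow n
  rw [norm_div, norm_pow, Complex.norm_natCast, show ‖(4 : ℂ)‖ = 4 by norm_num, pow_succ,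
    div_le_div_iff₀ (by positivity) (by norm_num)]
  linarith

theorem norm_sqrtSeries_term_le {K : A} {κ : ℝ} (hK : ‖K‖ ≤ κ) (n : ℕ) :
    ‖((catalan n : ℂ) / 4 ^ (n + 1)) • K ^ (n + 1)‖ ≤ κ / 4 * κ ^ n := by
  rw [norm_smul]
  calc _ ≤ 1 / 4 * κ ^ (n + 1) := by
        gcongr
        · exact norm_catalan_div_le n
        · exact (norm_pow_le' K n.succ_pos).trans (by gcongr)
    _ = _ := by rw [pow_succ]; ring

theorem summable_norm_sqrtSeries {K : A} (hK : ‖K‖ < 1) :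
    Summable fun n : ℕ => ‖((catalan n : ℂ) / 4 ^ (n + 1)) • K ^ (n + 1)‖ :=
  Summable.of_nonneg_of_le (fun _ => norm_nonneg _) (norm_sqrtSeries_term_le le_rfl)
    ((summable_geometric_of_lt_one (norm_nonneg K) hK).mul_left _)

theorem norm_sqrtSeries_le {K : A} {κ : ℝ} (hK : ‖K‖ ≤ κ) (hκ : κ < 1) :
    ‖sqrtSeries K‖ ≤ κ / (4 * (1 - κ)) := by
  have h0 : 0 ≤ κ := (norm_nonneg K).trans hK
  have h := (hasSum_geometric_of_lt_one h0 hκ).mul_left (κ / 4)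
  refine (tsum_of_norm_bounded h (norm_sqrtSeries_term_le hK)).trans_eq ?_
  have : 1 - κ ≠ 0 := by linarith
  field_simp

variable [CompleteSpace A]

theorem hasSum_sqrtSeries {K : A} (hK : ‖K‖ < 1) :
    HasSum (fun n : ℕ => ((catalan n : ℂ) / 4 ^ (n + 1)) • K ^ (n + 1)) (sqrtSeries K) :=
  (summable_norm_sqrtSeries hK).of_norm.hasSum

/-- The Catalan recurrence is exactly the Cauchy product of the series with itself, the term of
index 0 supplying `K / 4`. -/
theorem sqrtSeries_eq {K : A} (hK : ‖K‖ < 1) :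
    sqrtSeries K = (1 / 4 : ℂ) • K + sqrtSeries K * sqrtSeries K := by
  have hs := summable_norm_sqrtSeries hK
  conv_rhs => rw [sqrtSeries, tsum_mul_tsum_eq_tsum_sum_antidiagonal_of_summable_norm hs hs]
  rw [sqrtSeries, hs.of_norm.tsum_eq_zero_add]
  congr 1
  · simp
  · refine tsum_congr fun n => ?_
    rw [catalan_succ']
    push_cast
    rw [Finset.sum_div, Finset.sum_smul]
    refine Finset.sum_congr rfl fun p hp => ?_
    rw [smul_mul_smul_comm, ← pow_add, ← Finset.HasAntidiagonal.mem_antidiagonal.1 hp]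
    congr 1
    · rw [div_mul_div_comm, ← pow_add]; congr 2; ring
    · congr 1; ring

theorem one_sub_two_smul_sqrtSeries_mul_self {K : A} (hK : ‖K‖ < 1) :
    (1 - (2 : ℂ) • sqrtSeries K) * (1 - (2 : ℂ) • sqrtSeries K) = 1 - K := by
  have h : sqrtSeries K * sqrtSeries K = sqrtSeries K - (1 / 4 : ℂ) • K := by
    rw [eq_sub_iff_add_eq, add_comm]; exact (sqrtSeries_eq hK).symm
  rw [sub_mul, one_mul, mul_sub, mul_one, smul_mul_smul_comm, h]
  module

theorem analyticAt_sqrtSeries {K : A} (hK : ‖K‖ < 1) : AnalyticAt ℂ (sqrtSeries : A → A) K := by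
  -- The coefficients are shifted by one, since the series has no constant term.
  let c : ℕ → ℂ := fun n => match n with
    | 0 => 0
    | n + 1 => (catalan n : ℂ) / 4 ^ (n + 1)
  have hc : ∀ n, ‖c n‖ ≤ 1 / 4 := fun n => by
    cases n with
    | zero => simp [c]
    | succ n => exact norm_catalan_div_le n
  let p := FormalMultilinearSeries.ofScalars A c
  have hr : (1 : ENNReal) ≤ p.radius := by
    refine p.le_radius_of_bound (r := 1) (1 / 4) fun n => ?_
    rw [NNReal.coe_one, one_pow, mul_one]
    cases n with
    | zero => simp [p, c]
    | succ n => exact (FormalMultilinearSeries.ofScalars_norm_le A c _ n.succ_pos).trans (hc (n + 1))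
  have hp := p.hasFPowerSeriesOnBall (lt_of_lt_of_le one_pos hr)
  have hmem : K ∈ Metric.eball (0 : A) p.radius := by
    rw [Metric.mem_eball, edist_zero_right]
    exact lt_of_lt_of_le (by rw [← ofReal_norm, ← ENNReal.ofReal_one]
                             exact (ENNReal.ofReal_lt_ofReal_iff one_pos).2 hK) hr
  refine (hp.analyticAt_of_mem hmem).congr ?_
  filter_upwards [isOpen_ball.mem_nhds (show K ∈ ball (0 : A) 1 by simpa using hK)] with L hL
  rw [mem_ball_zero_iff] at hL
  have h1 : HasSum (fun n => c n • L ^ n) (sqrtSeries L) := by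
    rw [← hasSum_nat_add_iff' 1]
    simpa [c] using hasSum_sqrtSeries hL
  rw [← h1.tsum_eq]
  exact FormalMultilinearSeries.ofScalars_sum_eq c L

/-- Differentiating `Z = K/4 + Z²` in the noncommutative algebra gives `‖Z'‖ ≤ ‖K'‖/4 + 2ζ‖Z'‖`, and
the last term is absorbed on the left. -/
theorem norm_fderiv_sqrtSeries_comp_le {E : Type*} [NormedAddCommGroup E] [NormedSpace ℂ E]
    {L : E → A} {x : E} (hL : DifferentiableAt ℂ L x) (hx : ‖L x‖ < 1) {ζ : ℝ}
    (hζ : ‖sqrtSeries (L x)‖ ≤ ζ) (hζ' : ζ < 1 / 2) :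
    ‖fderiv ℂ (fun y => sqrtSeries (L y)) x‖ ≤ ‖fderiv ℂ L x‖ / (4 * (1 - 2 * ζ)) := by
  have hG : DifferentiableAt ℂ (fun y => sqrtSeries (L y)) x :=
    (analyticAt_sqrtSeries hx).differentiableAt.comp x hL
  set G := fun y => sqrtSeries (L y) with hGdef
  have hev : ∀ᶠ y in 𝓝 x, G y = (1 / 4 : ℂ) • L y + G y * G y :=
    (hL.continuousAt.norm.eventually_lt_const hx).mono fun y hy => sqrtSeries_eq hy
  have hpos : 0 < 1 - 2 * ζ := by linarith
  have key : ∀ v, ‖fderiv ℂ G x v‖ ≤ 1 / 4 * (‖fderiv ℂ L x‖ * ‖v‖) + 2 * ζ * ‖fderiv ℂ G x v‖ := by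
    intro v
    have hd : HasFDerivAt G _ x :=
      ((hL.hasFDerivAt.const_smul (1 / 4 : ℂ)).add
        (hG.hasFDerivAt.mul' hG.hasFDerivAt)).congr_of_eventuallyEq hev
    have e : fderiv ℂ G x v =
        (1 / 4 : ℂ) • fderiv ℂ L x v + (G x * fderiv ℂ G x v + fderiv ℂ G x v * G x) := by
      conv_lhs => rw [hd.fderiv]
      simp
    calc ‖fderiv ℂ G x v‖ ≤ ‖(1 / 4 : ℂ) • fderiv ℂ L x v‖ +
          (‖G x * fderiv ℂ G x v‖ + ‖fderiv ℂ G x v * G x‖) := by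
          conv_lhs => rw [e]
          exact (norm_add_le _ _).trans (by gcongr; exact norm_add_le _ _)
      _ ≤ 1 / 4 * (‖fderiv ℂ L x‖ * ‖v‖) + (ζ * ‖fderiv ℂ G x v‖ + ‖fderiv ℂ G x v‖ * ζ) := by
          gcongr
          · rw [norm_smul]
            norm_num
            exact ContinuousLinearMap.le_opNorm _ _
          · exact (norm_mul_le _ _).trans (by gcongr)
          · exact (norm_mul_le _ _).trans (by gcongr)
      _ = _ := by ring
  refine ContinuousLinearMap.opNorm_le_bound _ (by positivity) fun v => ?_
  rw [div_mul_eq_mul_div, le_div_iff₀ (by positivity)]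
  nlinarith [key v]

end SquareRoot

/-! ### Symmetry and reality of the operator square root. -/

section Operators

variable {E : Type*} [NormedAddCommGroup E] [NormedSpace ℂ E]

theorem bilin_pow_symm {β : E →L[ℂ] E →L[ℂ] ℂ} {K : E →L[ℂ] E}
    (hβ : ∀ u v, β (K u) v = β u (K v)) (n : ℕ) (u v : E) :
    β ((K ^ n) u) v = β u ((K ^ n) v) := by
  induction n generalizing u with
  | zero => rfl
  | succ n ih =>
    have h : (K ^ (n + 1)) v = K ((K ^ n) v) := by rw [pow_succ']; rfl
    rw [h, ← hβ, pow_succ]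
    exact ih (K u)

variable [CompleteSpace E]

/-- Self-adjointness for a complex bilinear form passes to powers, to linear combinations and to
norm limits. -/
theorem bilin_sqrtSeries_symm {β : E →L[ℂ] E →L[ℂ] ℂ} {K : E →L[ℂ] E} (hK : ‖K‖ < 1)
    (hβ : ∀ u v, β (K u) v = β u (K v)) (u v : E) :
    β (sqrtSeries K u) v = β u (sqrtSeries K v) := by
  have h := hasSum_sqrtSeries hK
  have h1 := h.mapL ((β.flip v).comp (ContinuousLinearMap.apply ℂ E u))
  have h2 := h.mapL ((β u).comp (ContinuousLinearMap.apply ℂ E v))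
  refine h1.unique ?_
  convert! h2 using 2 with n
  simpa using Or.inl (bilin_pow_symm hβ (n + 1) u v)

/-- If `K` preserves a closed real subspace then so does `sqrtSeries K`. -/
theorem sqrtSeries_mem_of_invariant {S : AddSubgroup E} (hS : IsClosed (S : Set E))
    (hsmul : ∀ (r : ℝ), ∀ u ∈ S, (r : ℂ) • u ∈ S)
    {K : E →L[ℂ] E} (hK : ‖K‖ < 1) (hKS : ∀ u ∈ S, K u ∈ S) {u : E} (hu : u ∈ S) :
    sqrtSeries K u ∈ S := by
  have hpow : ∀ n : ℕ, (K ^ n) u ∈ S := by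
    intro n
    induction n with
    | zero => exact hu
    | succ n ih => rw [pow_succ']; exact hKS _ ih
  have h := (hasSum_sqrtSeries hK).mapL (ContinuousLinearMap.apply ℂ E u)
  refine hS.mem_of_tendsto h (Filter.Eventually.of_forall fun s => ?_)
  refine S.sum_mem fun n _ => ?_
  -- The coefficients are real, and `S` is only stable under real scalars.
  have : ((catalan n : ℂ) / 4 ^ (n + 1)) = (((catalan n : ℝ) / 4 ^ (n + 1) : ℝ) : ℂ) := by
    push_cast; rfl
  rw [this, ContinuousLinearMap.apply_apply, smul_apply]
  exact hsmul _ _ (hpow _)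

end Operators

/-! ### The tubes around real space. -/

section Tube

open Metric Set Filter Topology

variable {ν : ℕ}

/-- The imaginary part of a complex vector. -/
def imVec (z : CSpace ν) : RSpace ν := WithLp.toLp 2 fun j => (z j).im

theorem imVec_add (z w : CSpace ν) : imVec (z + w) = imVec z + imVec w := by
  ext j; simp [imVec]

theorem imVec_smul (s : ℝ) (z : CSpace ν) : imVec ((s : ℂ) • z) = s • imVec z := by
  ext j; simp [imVec]

theorem norm_imVec_le (z : CSpace ν) : ‖imVec z‖ ≤ ‖z‖ := by
  rw [EuclideanSpace.norm_eq, EuclideanSpace.norm_eq]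
  gcongr with j
  exact Complex.abs_im_le_norm (z j)

theorem mem_tube {z : CSpace ν} {R : ℝ} : z ∈ tube ν R ↔ ‖imVec z‖ < R := Iff.rfl

theorem continuous_imVec : Continuous (imVec : CSpace ν → RSpace ν) := by
  unfold imVec; fun_prop

theorem isOpen_tube (R : ℝ) : IsOpen (tube ν R) :=
  isOpen_lt (continuous_imVec.norm) continuous_const

theorem smul_mem_tube {z : CSpace ν} {R s : ℝ} (hz : z ∈ tube ν R) (hs : s ∈ Icc (0 : ℝ) 1) :
    (s : ℂ) • z ∈ tube ν R := by
  rw [mem_tube] at *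
  rw [imVec_smul, norm_smul, Real.norm_of_nonneg hs.1]
  nlinarith [norm_nonneg (imVec z), hs.1, hs.2]

theorem closedBall_subset_tube {z : CSpace ν} {R r : ℝ} (hz : z ∈ tube ν R) :
    closedBall z r ⊆ tube ν (R + r) := by
  intro w hw
  rw [mem_tube] at *
  rw [mem_closedBall, dist_eq_norm] at hw
  calc ‖imVec w‖ = ‖imVec z + imVec (w - z)‖ := by rw [← imVec_add]; congr 2; abel
    _ ≤ ‖imVec z‖ + ‖imVec (w - z)‖ := norm_add_le _ _
    _ < R + r := by linarith [norm_imVec_le (w - z)]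

theorem tube_mono {R R' : ℝ} (h : R ≤ R') : tube ν R ⊆ tube ν R' := fun _ hz =>
  lt_of_lt_of_le hz h

theorem mem_tube_of_im_eq_zero {z : CSpace ν} {R : ℝ} (hR : 0 < R) (hz : ∀ j, (z j).im = 0) :
    z ∈ tube ν R := by
  have : imVec z = 0 := by ext j; simp [imVec, hz]
  rw [mem_tube, this, norm_zero]; exact hR

/-- The real subspace `ℝ^ν ⊆ ℂ^ν`. -/
def realVectors (ν : ℕ) : AddSubgroup (CSpace ν) where
  carrier := {z | ∀ j, (z j).im = 0}
  add_mem' hz hw j := by simp [hz j, hw j]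
  zero_mem' j := by simp
  neg_mem' hz j := by simp [hz j]

theorem mem_realVectors {z : CSpace ν} : z ∈ realVectors ν ↔ ∀ j, (z j).im = 0 := Iff.rfl

theorem smul_mem_realVectors (r : ℝ) (z : CSpace ν) (hz : z ∈ realVectors ν) :
    (r : ℂ) • z ∈ realVectors ν := fun j => by simp [hz j]

theorem isClosed_realVectors : IsClosed (realVectors ν : Set (CSpace ν)) := by
  have : (realVectors ν : Set (CSpace ν)) = ⋂ j, {z | (z j).im = 0} := by
    ext z; simp [mem_realVectors]
  rw [this]
  exact isClosed_iInter fun j => isClosed_eq (by fun_prop) continuous_const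

theorem norm_le_sum_norm_coord (z : CSpace ν) : ‖z‖ ≤ ∑ j, ‖z j‖ := by
  rw [EuclideanSpace.norm_eq]
  refine Real.sqrt_le_iff.2 ⟨by positivity, ?_⟩
  exact Finset.sum_sq_le_sq_sum_of_nonneg fun i _ => norm_nonneg _

end Tube

/-! ### The mean Hessian: Taylor's formula, symmetry, reality and Cauchy bounds. -/

section MeanHessian

set_option maxSynthPendingDepth 3

open Metric Set Filter Topology

variable {E : Type} [NormedAddCommGroup E] [NormedSpace ℂ E]

/-- A star-shaped open set `U` whose closed `2`-neighbourhood lies in the open set `V`. -/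
structure IsMorseDomain (U V : Set E) : Prop where
  isOpen_left : IsOpen U
  isOpen_right : IsOpen V
  smul_mem : ∀ x ∈ U, ∀ s ∈ Icc (0 : ℝ) 1, (s : ℂ) • x ∈ U
  closedBall_subset : ∀ x ∈ U, closedBall x 2 ⊆ V

theorem IsMorseDomain.subset {U V : Set E} (h : IsMorseDomain U V) : U ⊆ V := fun x hx =>
  h.closedBall_subset x hx (mem_closedBall_self (by norm_num))

/-- `∫₀¹ (1 - s) Φ''(s x) ds`, a bilinear form. -/
noncomputable def meanHessian (Φ : E → ℂ) (x : E) :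
    E →L[ℂ] E →L[ℂ] ℂ :=
  ∫ s in (0 : ℝ)..1, ((1 - s : ℝ) : ℂ) • fderiv ℂ (fderiv ℂ Φ) ((s : ℂ) • x)

theorem continuous_ofReal_one_sub : Continuous fun s : ℝ => ((1 - s : ℝ) : ℂ) := by fun_prop

variable {Φ : E → ℂ} {N B : ℝ} {U V : Set E}

theorem continuousOn_comp_smul (hD : IsMorseDomain U V) {G : Type*} [TopologicalSpace G]
    {f : E → G} (hf : ContinuousOn f V) {x : E} (hx : x ∈ U) :
    ContinuousOn (fun s : ℝ => f ((s : ℂ) • x)) (Icc 0 1) :=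
  hf.comp (by fun_prop) fun _ hs => hD.subset (hD.smul_mem _ hx _ hs)

/-- Along the real line `s ↦ z + s v` the imaginary part vanishes identically, hence so does that of
the derivative. Two applications make the Hessian real on `S`. -/
theorem im_fderiv_apply_eq_zero {S : AddSubgroup E}
    (hS : ∀ (r : ℝ), ∀ u ∈ S, (r : ℂ) • u ∈ S) {f : E → ℂ} {z v : E}
    (hz : z ∈ S) (hv : v ∈ S) (hf : DifferentiableAt ℂ f z)
    (hreal : ∀ w ∈ S, (f w).im = 0) : (fderiv ℂ f z v).im = 0 := by
  have hlin : HasDerivAt (fun w : ℂ => z + w • v) v 0 := by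
    simpa using ((hasDerivAt_id (0 : ℂ)).smul_const v).const_add z
  have hf' : HasFDerivAt f (fderiv ℂ f z) (z + (0 : ℂ) • v) := by
    simpa using hf.hasFDerivAt
  have e1 : HasDerivAt (fun s : ℝ => f (z + (s : ℂ) • v)) (fderiv ℂ f z v) 0 :=
    HasDerivAt.comp_ofReal (z := 0) (hf'.comp_hasDerivAt (0 : ℂ) hlin)
  have e2 : HasDerivAt (fun s : ℝ => (f (z + (s : ℂ) • v)).im) (fderiv ℂ f z v).im 0 :=
    Complex.imCLM.hasFDerivAt.comp_hasDerivAt 0 e1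
  have e3 : (fun s : ℝ => (f (z + (s : ℂ) • v)).im) = fun _ => 0 := by
    funext s
    refine hreal _ (S.add_mem hz (hS s v hv))
  rw [e3] at e2
  exact e2.unique (hasDerivAt_const _ _)

variable [FiniteDimensional ℂ E]

theorem norm_fderiv_fderiv_le (hD : IsMorseDomain U V) (hd : DifferentiableOn ℂ Φ V)
    (hN : ∀ z ∈ V, ‖Φ z‖ ≤ N) {z : E} (hz : z ∈ U) :
    ‖fderiv ℂ (fderiv ℂ Φ) z‖ ≤ N := by
  have hs : closedBall z ((2 : ℕ) * (1 : ℝ)) ⊆ V := by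
    simpa using hD.closedBall_subset z hz
  have h := norm_iteratedFDeriv_le_of_closedBall (hD.isOpen_right) one_pos 2 hd hs
    (fun w hw => hN w (hs hw))
  rwa [← norm_iteratedFDeriv_fderiv, ← norm_iteratedFDeriv_fderiv, norm_iteratedFDeriv_zero,
    one_pow, div_one] at h

/-- Three Cauchy steps of radius `2/3` fill the available distance 2, whence the constant `(3/2)³ =
27/8`. -/
theorem norm_fderiv_fderiv_fderiv_le (hD : IsMorseDomain U V) (hd : DifferentiableOn ℂ Φ V) {z : E}
    (hz : z ∈ U) {C : ℝ} (hC : ∀ w ∈ closedBall z 2, ‖Φ w‖ ≤ C) :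
    ‖fderiv ℂ (fderiv ℂ (fderiv ℂ Φ)) z‖ ≤ 27 / 8 * C := by
  have h3 : ((3 : ℕ) : ℝ) * (2 / 3) = 2 := by norm_num
  have hs : closedBall z ((3 : ℕ) * (2 / 3 : ℝ)) ⊆ V := by
    rw [h3]; exact hD.closedBall_subset z hz
  have h := norm_iteratedFDeriv_le_of_closedBall (hD.isOpen_right) (by norm_num : (0 : ℝ) < 2 / 3) 3
    hd hs (C := C) (fun w hw => hC w (by rwa [h3] at hw))
  rw [← norm_iteratedFDeriv_fderiv, ← norm_iteratedFDeriv_fderiv, ← norm_iteratedFDeriv_fderiv,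
    norm_iteratedFDeriv_zero] at h
  refine h.trans_eq ?_
  norm_num
  ring

/-- Decay of `Φ` is inherited by its derivatives: for `w` within 2 of `z` one has `‖z‖ ≤ ‖w‖ + 2`,
so `‖z‖ ‖Φ w‖ ≤ B + 2N` on the whole ball used by Cauchy's estimate. -/
theorem norm_mul_norm_fderiv_fderiv_fderiv_le (hD : IsMorseDomain U V) (hd : DifferentiableOn ℂ Φ V)
    (hN : ∀ z ∈ V, ‖Φ z‖ ≤ N) (hB : ∀ z ∈ V, ‖z‖ * ‖Φ z‖ ≤ B)
    {z : E} (hz : z ∈ U) :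
    ‖z‖ * ‖fderiv ℂ (fderiv ℂ (fderiv ℂ Φ)) z‖ ≤ 27 / 8 * (B + 2 * N) := by
  rcases eq_or_ne z 0 with rfl | hz0
  · have hN0 : 0 ≤ N := (norm_nonneg _).trans (hN 0 (hD.subset hz))
    have hB0 : 0 ≤ B := le_trans (by positivity) (hB 0 (hD.subset hz))
    rw [norm_zero, zero_mul]; positivity
  have hz' : 0 < ‖z‖ := norm_pos_iff.2 hz0
  have h := norm_fderiv_fderiv_fderiv_le hD hd hz (C := (B + 2 * N) / ‖z‖) fun w hw => by
    have hw3 : w ∈ V := hD.closedBall_subset z hz hw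
    rw [le_div_iff₀ hz']
    have h1 := hB w hw3
    have h2 : ‖z‖ ≤ ‖w‖ + 2 := by
      rw [mem_closedBall, dist_eq_norm] at hw
      have := norm_sub_norm_le z w
      rw [norm_sub_rev] at this
      linarith
    have h3 := hN w hw3
    nlinarith [norm_nonneg (Φ w)]
  calc _ ≤ ‖z‖ * (27 / 8 * ((B + 2 * N) / ‖z‖)) := by gcongr
    _ = _ := by field_simp

theorem differentiableOn_fderiv_fderiv (hD : IsMorseDomain U V) (hd : DifferentiableOn ℂ Φ V) :
    DifferentiableOn ℂ (fderiv ℂ (fderiv ℂ Φ)) (V) :=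
  differentiableOn_fderiv_of_finiteDimensional (hD.isOpen_right)
    (differentiableOn_fderiv_of_finiteDimensional (hD.isOpen_right) hd)

theorem continuousOn_meanHessian_integrand (hD : IsMorseDomain U V) (hd : DifferentiableOn ℂ Φ V)
    {x : E} (hx : x ∈ U) :
    ContinuousOn (fun s : ℝ => ((1 - s : ℝ) : ℂ) • fderiv ℂ (fderiv ℂ Φ) ((s : ℂ) • x))
      (Icc 0 1) :=
  ContinuousOn.smul continuous_ofReal_one_sub.continuousOn
    (continuousOn_comp_smul hD (differentiableOn_fderiv_fderiv hD hd).continuousOn hx)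

theorem intervalIntegrable_meanHessian_integrand (hD : IsMorseDomain U V) (hd : DifferentiableOn ℂ Φ V)
    {x : E} (hx : x ∈ U) :
    IntervalIntegrable
      (fun s : ℝ => ((1 - s : ℝ) : ℂ) • fderiv ℂ (fderiv ℂ Φ) ((s : ℂ) • x))
      MeasureTheory.volume 0 1 :=
  ContinuousOn.intervalIntegrable
    (by rw [uIcc_of_le zero_le_one]; exact continuousOn_meanHessian_integrand hD hd hx)

theorem meanHessian_apply (hD : IsMorseDomain U V) (hd : DifferentiableOn ℂ Φ V) {x : E}
    (hx : x ∈ U) (u v : E) :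
    meanHessian Φ x u v =
      ∫ s in (0 : ℝ)..1, ((1 - s : ℝ) : ℂ) * fderiv ℂ (fderiv ℂ Φ) ((s : ℂ) • x) u v := by
  have h := intervalIntegrable_meanHessian_integrand hD hd hx
  rw [meanHessian]
  have h1 := ContinuousLinearMap.intervalIntegral_comp_comm
    ((ContinuousLinearMap.apply ℂ ℂ v).comp
      (ContinuousLinearMap.apply ℂ (E →L[ℂ] ℂ) u)) h
  exact h1.symm

theorem integral_one_sub_mul (C : ℝ) : ∫ s in (0 : ℝ)..1, (1 - s) * C = C / 2 := by
  rw [intervalIntegral.integral_mul_const, intervalIntegral.integral_sub (by simp) (by simp)]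
  simp
  ring

theorem norm_intervalIntegral_le_half {G : Type*} [NormedAddCommGroup G] [NormedSpace ℝ G]
    {f : ℝ → G} {C : ℝ} (h : ∀ s ∈ Icc (0 : ℝ) 1, ‖f s‖ ≤ (1 - s) * C) :
    ‖∫ s in (0 : ℝ)..1, f s‖ ≤ C / 2 := by
  rw [← integral_one_sub_mul]
  refine intervalIntegral.norm_integral_le_of_norm_le zero_le_one
    (Eventually.of_forall fun s hs => h s (Ioc_subset_Icc_self hs)) ?_
  exact Continuous.intervalIntegrable (by fun_prop) _ _

theorem norm_meanHessian_le (hD : IsMorseDomain U V) (hd : DifferentiableOn ℂ Φ V)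
    (hN : ∀ z ∈ V, ‖Φ z‖ ≤ N) {x : E} (hx : x ∈ U) :
    ‖meanHessian Φ x‖ ≤ N / 2 := by
  refine norm_intervalIntegral_le_half fun s hs => ?_
  rw [norm_smul, Complex.norm_real, Real.norm_of_nonneg (by linarith [hs.2])]
  exact mul_le_mul_of_nonneg_left (norm_fderiv_fderiv_le hD hd hN (hD.smul_mem _ hx _ hs))
    (by linarith [hs.2])

theorem hasFDerivAt_meanHessian (hD : IsMorseDomain U V) (hd : DifferentiableOn ℂ Φ V)
    (hN : ∀ z ∈ V, ‖Φ z‖ ≤ N) {x : E} (hx : x ∈ U) :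
    HasFDerivAt (meanHessian Φ)
      (∫ s in (0 : ℝ)..1, ((1 - s : ℝ) : ℂ) • ((s : ℂ) •
        fderiv ℂ (fderiv ℂ (fderiv ℂ Φ)) ((s : ℂ) • x))) x := by
  have hd2 := differentiableOn_fderiv_fderiv hD hd
  have hd3 := differentiableOn_fderiv_of_finiteDimensional (hD.isOpen_right) hd2
  have hnhds : U ∈ 𝓝 x := (hD.isOpen_left).mem_nhds hx
  have hsub : uIoc (0 : ℝ) 1 ⊆ Icc 0 1 := by
    rw [uIoc_of_le zero_le_one]; exact Ioc_subset_Icc_self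
  have hN0 : 0 ≤ N := (norm_nonneg _).trans (hN x (hD.subset hx))
  refine intervalIntegral.hasFDerivAt_integral_of_dominated_of_fderiv_le (𝕜 := ℂ)
    (F := fun x s => ((1 - s : ℝ) : ℂ) • fderiv ℂ (fderiv ℂ Φ) ((s : ℂ) • x))
    (F' := fun x s => ((1 - s : ℝ) : ℂ) • ((s : ℂ) •
        fderiv ℂ (fderiv ℂ (fderiv ℂ Φ)) ((s : ℂ) • x)))
    (bound := fun _ => 27 / 8 * N) hnhds ?_ (intervalIntegrable_meanHessian_integrand hD hd hx) ?_
    ?_ (by simp) ?_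
  · filter_upwards [hnhds] with y hy
    exact ((continuousOn_meanHessian_integrand hD hd hy).mono hsub).aestronglyMeasurable
      measurableSet_uIoc
  · refine ContinuousOn.aestronglyMeasurable (ContinuousOn.mono ?_ hsub) measurableSet_uIoc
    exact ContinuousOn.smul continuous_ofReal_one_sub.continuousOn
      (ContinuousOn.smul Complex.continuous_ofReal.continuousOn (continuousOn_comp_smul hD hd3.continuousOn hx))
  · refine Eventually.of_forall fun s hs y hy => ?_
    have hs := hsub hs
    rw [norm_smul, norm_smul, Complex.norm_real, Complex.norm_real,
      Real.norm_of_nonneg (by linarith [hs.2]), Real.norm_of_nonneg hs.1]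
    have h := norm_fderiv_fderiv_fderiv_le hD hd (hD.smul_mem _ hy _ hs) (C := N)
      fun w hw => hN w (hD.closedBall_subset _ (hD.smul_mem _ hy s hs) hw)
    have h1 : s * ‖fderiv ℂ (fderiv ℂ (fderiv ℂ Φ)) ((s : ℂ) • y)‖ ≤ 1 * (27 / 8 * N) := by
      gcongr
      exact hs.2
    calc _ ≤ 1 * (1 * (27 / 8 * N)) :=
          mul_le_mul (by linarith [hs.1]) h1 (mul_nonneg hs.1 (norm_nonneg _)) zero_le_one
      _ = _ := by ring
  · refine Eventually.of_forall fun s hs y hy => ?_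
    have hs := hsub hs
    have h1 := (hd2.differentiableAt ((hD.isOpen_right).mem_nhds
      (hD.subset (hD.smul_mem _ hy _ hs)))).hasFDerivAt
    have h2 : HasFDerivAt (fun y : E => (s : ℂ) • y)
        ((s : ℂ) • ContinuousLinearMap.id ℂ (E)) y := (hasFDerivAt_id y).const_smul _
    have h3 := (h1.comp y h2).const_smul ((1 - s : ℝ) : ℂ)
    rw [ContinuousLinearMap.comp_smul, ContinuousLinearMap.comp_id] at h3
    exact h3

/-- The factor `s` produced by the chain rule combines with `‖x‖` into `‖s x‖`, so the weighted
estimate applies at the point `s x` itself. The remaining weight `1 - s` integrates to `1/2`. -/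
theorem norm_mul_norm_fderiv_meanHessian_le (hD : IsMorseDomain U V) (hd : DifferentiableOn ℂ Φ V)
    (hN : ∀ z ∈ V, ‖Φ z‖ ≤ N) (hB : ∀ z ∈ V, ‖z‖ * ‖Φ z‖ ≤ B)
    {x : E} (hx : x ∈ U) :
    ‖x‖ * ‖fderiv ℂ (meanHessian Φ) x‖ ≤ 27 / 16 * (B + 2 * N) := by
  rw [(hasFDerivAt_meanHessian hD hd hN hx).fderiv]
  have h : ‖∫ s in (0 : ℝ)..1, (‖x‖ : ℂ) • (((1 - s : ℝ) : ℂ) • ((s : ℂ) •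
        fderiv ℂ (fderiv ℂ (fderiv ℂ Φ)) ((s : ℂ) • x)))‖ ≤ 27 / 8 * (B + 2 * N) / 2 := by
    refine norm_intervalIntegral_le_half fun s hs => ?_
    have h1 := norm_mul_norm_fderiv_fderiv_fderiv_le hD hd hN hB (hD.smul_mem _ hx _ hs)
    rw [norm_smul, Complex.norm_real, Real.norm_of_nonneg hs.1] at h1
    rw [norm_smul, norm_smul, norm_smul, Complex.norm_real, Complex.norm_real, Complex.norm_real,
      norm_norm, Real.norm_of_nonneg (by linarith [hs.2]), Real.norm_of_nonneg hs.1]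
    have := mul_le_mul_of_nonneg_left h1 (by linarith [hs.2] : 0 ≤ 1 - s)
    calc _ = _ := by ring
      _ ≤ _ := this
  rw [intervalIntegral.integral_smul, norm_smul, Complex.norm_real, norm_norm] at h
  refine h.trans_eq (by ring)

theorem meanHessian_symm (hD : IsMorseDomain U V) (hd : DifferentiableOn ℂ Φ V) {x : E}
    (hx : x ∈ U) (u v : E) : meanHessian Φ x u v = meanHessian Φ x v u := by
  rw [meanHessian_apply hD hd hx, meanHessian_apply hD hd hx]
  refine intervalIntegral.integral_congr fun s hs => ?_
  rw [uIcc_of_le zero_le_one] at hs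
  have hmem : (s : ℂ) • x ∈ V := hD.subset (hD.smul_mem _ hx _ hs)
  have hcd : ContDiffAt ℂ (2 : ℕ) Φ ((s : ℂ) • x) :=
    (contDiffOn_nat_of_differentiableOn (hD.isOpen_right) 2 hd).contDiffAt
      ((hD.isOpen_right).mem_nhds hmem)
  have := (hcd.isSymmSndFDerivAt (by simp)).eq u v
  simp only [this]

/-- Taylor's formula with integral remainder: the integrand is the derivative of `(1-s) Φ'(sx)x +
Φ(sx)`, whose value at `s = 0` vanishes by hypothesis. -/
theorem meanHessian_self (hD : IsMorseDomain U V) (hd : DifferentiableOn ℂ Φ V) (h0 : Φ 0 = 0)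
    (h1 : fderiv ℂ Φ 0 = 0) {x : E} (hx : x ∈ U) : meanHessian Φ x x x = Φ x := by
  rw [meanHessian_apply hD hd hx]
  have hd1 := differentiableOn_fderiv_of_finiteDimensional (hD.isOpen_right) hd
  have hderiv : ∀ s ∈ uIcc (0 : ℝ) 1, HasDerivAt
      (fun s : ℝ => ((1 - s : ℝ) : ℂ) * fderiv ℂ Φ ((s : ℂ) • x) x + Φ ((s : ℂ) • x))
      (((1 - s : ℝ) : ℂ) * fderiv ℂ (fderiv ℂ Φ) ((s : ℂ) • x) x x) s := by
    intro s hs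
    rw [uIcc_of_le zero_le_one] at hs
    have hmem := (hD.isOpen_right).mem_nhds (hD.subset
      (hD.smul_mem _ hx _ hs))
    have hlin : HasDerivAt (fun w : ℂ => w • x) x s := by
      simpa using (hasDerivAt_id (s : ℂ)).smul_const x
    have e1 : HasDerivAt (fun w : ℂ => Φ (w • x)) (fderiv ℂ Φ ((s : ℂ) • x) x) s :=
      (hd.differentiableAt hmem).hasFDerivAt.comp_hasDerivAt (s : ℂ) hlin
    have e2 : HasDerivAt (fun w : ℂ => fderiv ℂ Φ (w • x))
        (fderiv ℂ (fderiv ℂ Φ) ((s : ℂ) • x) x) s :=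
      (hd1.differentiableAt hmem).hasFDerivAt.comp_hasDerivAt (s : ℂ) hlin
    have e3 : HasDerivAt (fun w : ℂ => fderiv ℂ Φ (w • x) x)
        (fderiv ℂ (fderiv ℂ Φ) ((s : ℂ) • x) x x) s :=
      (ContinuousLinearMap.apply ℂ ℂ x).hasFDerivAt.comp_hasDerivAt (s : ℂ) e2
    have e4 : HasDerivAt (fun w : ℂ => 1 - w) (-1) s := by
      simpa using (hasDerivAt_id (s : ℂ)).const_sub 1
    have e5 := ((e4.mul e3).add e1).comp_ofReal
    convert! e5 using 1
    · funext w; simp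
    · push_cast; ring
  rw [intervalIntegral.integral_eq_sub_of_hasDerivAt hderiv]
  · simp [h0, h1]
  · refine ContinuousOn.intervalIntegrable ?_
    rw [uIcc_of_le zero_le_one]
    refine ContinuousOn.mul (by fun_prop) ?_
    exact ((continuousOn_comp_smul hD (differentiableOn_fderiv_fderiv hD hd).continuousOn hx).clm_apply
      continuousOn_const).clm_apply continuousOn_const

theorem im_meanHessian_eq_zero {S : AddSubgroup E}
    (hS : ∀ (r : ℝ), ∀ u ∈ S, (r : ℂ) • u ∈ S) (hSU : ∀ u ∈ S, u ∈ U) (hD : IsMorseDomain U V) (hd : DifferentiableOn ℂ Φ V)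
    (hreal : ∀ w ∈ S, (Φ w).im = 0) {x u v : E}
    (hx : x ∈ S) (hu : u ∈ S) (hv : v ∈ S) :
    (meanHessian Φ x u v).im = 0 := by
  have hd1 := differentiableOn_fderiv_of_finiteDimensional (hD.isOpen_right) hd
  rw [meanHessian_apply hD hd (hSU x hx)]
  have hint : IntervalIntegrable (fun s : ℝ => ((1 - s : ℝ) : ℂ) *
      fderiv ℂ (fderiv ℂ Φ) ((s : ℂ) • x) u v) MeasureTheory.volume 0 1 := by
    refine ContinuousOn.intervalIntegrable ?_
    rw [uIcc_of_le zero_le_one]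
    refine ContinuousOn.mul (by fun_prop) ?_
    exact ((continuousOn_comp_smul hD (differentiableOn_fderiv_fderiv hD hd).continuousOn
      (hSU x hx)).clm_apply continuousOn_const).clm_apply continuousOn_const
  have h := ContinuousLinearMap.intervalIntegral_comp_comm Complex.imCLM hint
  simp only [Complex.imCLM_apply] at h
  rw [← h]
  refine intervalIntegral.integral_zero_ae (Eventually.of_forall fun s _ => ?_)
  have hsx : (s : ℂ) • x ∈ S := by
    exact hS s x hx
  have h2 : (fderiv ℂ (fderiv ℂ Φ) ((s : ℂ) • x) u v).im = 0 := by
    have hda := hd1.differentiableAt ((hD.isOpen_right).mem_nhds (hD.subset (hSU _ hsx)))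
    have h3 := im_fderiv_apply_eq_zero hS (f := fun z => fderiv ℂ Φ z v) hsx hu
      ((ContinuousLinearMap.apply ℂ ℂ v).differentiableAt.comp _ hda) fun w hw =>
        im_fderiv_apply_eq_zero hS hw hv
          (hd.differentiableAt ((hD.isOpen_right).mem_nhds (hD.subset (hSU _ hw)))) hreal
    have h4 : HasFDerivAt (fun z => fderiv ℂ Φ z v)
        ((ContinuousLinearMap.apply ℂ ℂ v).comp (fderiv ℂ (fderiv ℂ Φ) ((s : ℂ) • x)))
        ((s : ℂ) • x) :=
      (ContinuousLinearMap.apply ℂ ℂ v).hasFDerivAt.comp _ hda.hasFDerivAt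
    rw [h4.fderiv] at h3
    exact h3
  rw [Complex.mul_im, h2, Complex.ofReal_im, mul_zero, zero_mul, add_zero]

theorem continuousOn_uncurry_meanHessian (hD : IsMorseDomain U V) {T : ℝ} {Ψ : ℝ → E → ℂ}
    (hd : ∀ t ∈ Ioo 0 T, DifferentiableOn ℂ (Ψ t) (V))
    (hc : ContinuousOn (fun p : ℝ × E => Ψ p.1 p.2) (Ioo 0 T ×ˢ V))
    (hN : ∀ t ∈ Ioo 0 T, ∀ z ∈ V, ‖Ψ t z‖ ≤ N) :
    ContinuousOn (fun p : ℝ × E => meanHessian (Ψ p.1) p.2) (Ioo 0 T ×ˢ U) := by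
  have hU := hD.isOpen_right
  have hc2 := continuousOn_uncurry_fderiv hU
    (fun t ht => differentiableOn_fderiv_of_finiteDimensional hU (hd t ht))
    (continuousOn_uncurry_fderiv hU hd hc)
  have hsub : Ioc (0 : ℝ) 1 ⊆ Icc 0 1 := Ioc_subset_Icc_self
  simp only [meanHessian, intervalIntegral.integral_of_le zero_le_one]
  refine MeasureTheory.continuousOn_of_dominated (bound := fun _ => N) ?_ ?_ (by simp) ?_
  · rintro ⟨t, x⟩ ⟨ht, hx⟩
    exact ((continuousOn_meanHessian_integrand hD (hd t ht) hx).mono hsub).aestronglyMeasurable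
      measurableSet_Ioc
  · rintro ⟨t, x⟩ ⟨ht, hx⟩
    refine (MeasureTheory.ae_restrict_mem measurableSet_Ioc).mono fun s hs => ?_
    have hs := hsub hs
    rw [norm_smul, Complex.norm_real, Real.norm_of_nonneg (by linarith [hs.2])]
    have := norm_fderiv_fderiv_le hD (hd t ht) (hN t ht) (hD.smul_mem _ hx _ hs)
    calc _ ≤ 1 * N := mul_le_mul (by linarith [hs.1]) this (norm_nonneg _) zero_le_one
      _ = N := one_mul N
  · refine (MeasureTheory.ae_restrict_mem measurableSet_Ioc).mono fun s hs => ?_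
    have h : ContinuousOn (fun p : ℝ × E => fderiv ℂ (fderiv ℂ (Ψ p.1)) ((s : ℂ) • p.2))
        (Ioo 0 T ×ˢ U) := by
      refine hc2.comp (f := fun p : ℝ × E => (p.1, (s : ℂ) • p.2))
        (by fun_prop : Continuous fun p : ℝ × E => (p.1, (s : ℂ) • p.2)).continuousOn ?_
      rintro ⟨t, x⟩ ⟨ht, hx⟩
      exact ⟨ht, hD.subset (hD.smul_mem _ hx _ (hsub hs))⟩
    exact h.const_smul ((1 - s : ℝ) : ℂ)

end MeanHessian

/-! ### The displacement and its bounds for an abstract perturbation. -/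

section Morse

set_option maxSynthPendingDepth 3

open Metric Set Filter Topology

variable {E : Type} [NormedAddCommGroup E] [NormedSpace ℂ E] [FiniteDimensional ℂ E]

/-- The displacement `-2 Z(J ∘ H(x)) x`, with `H` the mean Hessian of `Φ`. -/
noncomputable def morseDisplacement (J : (E →L[ℂ] ℂ) →L[ℂ] E) (Φ : E → ℂ) (x : E) : E :=
  (-2 : ℂ) • sqrtSeries (J.comp (meanHessian Φ x)) x

variable {Φ : E → ℂ} {J : (E →L[ℂ] ℂ) →L[ℂ] E} {N B C : ℝ} {U V : Set E}

theorem norm_comp_meanHessian_le (hD : IsMorseDomain U V) (hd : DifferentiableOn ℂ Φ V)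
    (hN : ∀ z ∈ V, ‖Φ z‖ ≤ N) (hJ : ‖J‖ ≤ C) (hCN : C * N ≤ 1 / 17) {x : E} (hx : x ∈ U) :
    ‖J.comp (meanHessian Φ x)‖ ≤ 1 / 34 := by
  have h1 := norm_meanHessian_le hD hd hN hx
  have hC : 0 ≤ C := (norm_nonneg J).trans hJ
  calc _ ≤ ‖J‖ * ‖meanHessian Φ x‖ := ContinuousLinearMap.opNorm_comp_le _ _
    _ ≤ C * (N / 2) := mul_le_mul hJ h1 (norm_nonneg _) hC
    _ ≤ 1 / 34 := by linarith

theorem hasFDerivAt_comp_meanHessian (hD : IsMorseDomain U V) (hd : DifferentiableOn ℂ Φ V)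
    (hN : ∀ z ∈ V, ‖Φ z‖ ≤ N) {x : E} (hx : x ∈ U) :
    HasFDerivAt (fun y => J.comp (meanHessian Φ y))
      ((ContinuousLinearMap.compL ℂ E (E →L[ℂ] ℂ) E J).comp (fderiv ℂ (meanHessian Φ) x)) x :=
  (ContinuousLinearMap.compL ℂ E (E →L[ℂ] ℂ) E J).hasFDerivAt.comp x
    (hasFDerivAt_meanHessian hD hd hN hx).differentiableAt.hasFDerivAt

theorem norm_mul_norm_fderiv_comp_meanHessian_le (hD : IsMorseDomain U V)
    (hd : DifferentiableOn ℂ Φ V) (hN : ∀ z ∈ V, ‖Φ z‖ ≤ N) (hB : ∀ z ∈ V, ‖z‖ * ‖Φ z‖ ≤ B)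
    (hJ : ‖J‖ ≤ C) (hCB : C * (B + 2 * N) ≤ 3 / 17) {x : E} (hx : x ∈ U) :
    ‖x‖ * ‖fderiv ℂ (fun y => J.comp (meanHessian Φ y)) x‖ ≤ 81 / 272 := by
  have h1 := norm_mul_norm_fderiv_meanHessian_le hD hd hN hB hx
  have hC : 0 ≤ C := (norm_nonneg J).trans hJ
  rw [(hasFDerivAt_comp_meanHessian hD hd hN hx).fderiv]
  have h2 : ‖(ContinuousLinearMap.compL ℂ E (E →L[ℂ] ℂ) E J).comp
      (fderiv ℂ (meanHessian Φ) x)‖ ≤ C * ‖fderiv ℂ (meanHessian Φ) x‖ := by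
    refine ContinuousLinearMap.opNorm_le_bound _ (by positivity) fun v => ?_
    calc ‖J.comp (fderiv ℂ (meanHessian Φ) x v)‖ ≤ ‖J‖ * ‖fderiv ℂ (meanHessian Φ) x v‖ :=
          ContinuousLinearMap.opNorm_comp_le _ _
      _ ≤ C * (‖fderiv ℂ (meanHessian Φ) x‖ * ‖v‖) :=
          mul_le_mul hJ (ContinuousLinearMap.le_opNorm _ _) (norm_nonneg _) hC
      _ = _ := by ring
  calc _ ≤ ‖x‖ * (C * ‖fderiv ℂ (meanHessian Φ) x‖) :=
        mul_le_mul_of_nonneg_left h2 (norm_nonneg _)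
    _ = C * (‖x‖ * ‖fderiv ℂ (meanHessian Φ) x‖) := by ring
    _ ≤ C * (27 / 16 * (B + 2 * N)) := mul_le_mul_of_nonneg_left h1 hC
    _ ≤ 81 / 272 := by linarith

theorem norm_sqrtSeries_comp_meanHessian_le (hD : IsMorseDomain U V)
    (hd : DifferentiableOn ℂ Φ V) (hN : ∀ z ∈ V, ‖Φ z‖ ≤ N) (hJ : ‖J‖ ≤ C)
    (hCN : C * N ≤ 1 / 17) {x : E} (hx : x ∈ U) :
    ‖sqrtSeries (J.comp (meanHessian Φ x))‖ ≤ 1 / 132 := by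
  -- For `κ = 1/34` the bound `κ / (4(1-κ))` is exactly `1/132`.
  refine (norm_sqrtSeries_le (norm_comp_meanHessian_le hD hd hN hJ hCN hx) (by norm_num)).trans ?_
  norm_num

theorem analyticOnNhd_morseDisplacement (hD : IsMorseDomain U V) (hd : DifferentiableOn ℂ Φ V)
    (hN : ∀ z ∈ V, ‖Φ z‖ ≤ N) (hJ : ‖J‖ ≤ C) (hCN : C * N ≤ 1 / 17) :
    AnalyticOnNhd ℂ (morseDisplacement J Φ) U := by
  refine analyticOnNhd_of_differentiableOn hD.isOpen_left fun x hx => ?_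
  have h1 := norm_comp_meanHessian_le hD hd hN hJ hCN hx
  have h2 : DifferentiableAt ℂ (fun y => sqrtSeries (J.comp (meanHessian Φ y))) x :=
    DifferentiableAt.comp (g := sqrtSeries) (f := fun y => J.comp (meanHessian Φ y)) x
      (analyticAt_sqrtSeries (h1.trans_lt (by norm_num))).differentiableAt
      (hasFDerivAt_comp_meanHessian hD hd hN hx).differentiableAt
  exact ((h2.clm_apply differentiableAt_id).const_smul (-2 : ℂ)).differentiableWithinAt

/-- The derivative in the direction `v` is `-2 (Z v + (Z' v) x)`. The first term is small because
`Z` is; in the second the factor `x` is compensated by the bound on `‖x‖ ‖K'(x)‖`. The total is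
about `1/6`. -/
theorem norm_fderiv_morseDisplacement_le (hD : IsMorseDomain U V) (hd : DifferentiableOn ℂ Φ V)
    (hN : ∀ z ∈ V, ‖Φ z‖ ≤ N) (hB : ∀ z ∈ V, ‖z‖ * ‖Φ z‖ ≤ B) (hJ : ‖J‖ ≤ C)
    (hCN : C * N ≤ 1 / 17) (hCB : C * (B + 2 * N) ≤ 3 / 17) {x : E} (hx : x ∈ U) :
    ‖fderiv ℂ (morseDisplacement J Φ) x‖ ≤ 1 / 2 := by
  have h1 : ‖J.comp (meanHessian Φ x)‖ < 1 :=
    (norm_comp_meanHessian_le hD hd hN hJ hCN hx).trans_lt (by norm_num)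
  have hL := (hasFDerivAt_comp_meanHessian (J := J) hD hd hN hx).differentiableAt
  have hZ := norm_sqrtSeries_comp_meanHessian_le hD hd hN hJ hCN hx
  have h2 : DifferentiableAt ℂ (fun y => sqrtSeries (J.comp (meanHessian Φ y))) x :=
    DifferentiableAt.comp (g := sqrtSeries) (f := fun y => J.comp (meanHessian Φ y)) x
      (analyticAt_sqrtSeries h1).differentiableAt hL
  have h3 := norm_fderiv_sqrtSeries_comp_le hL h1 hZ (by norm_num)
  have h4 := norm_mul_norm_fderiv_comp_meanHessian_le hD hd hN hB hJ hCB hx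
  have h5 : HasFDerivAt (morseDisplacement J Φ) _ x :=
    (h2.hasFDerivAt.clm_apply (hasFDerivAt_id x)).const_smul (-2 : ℂ)
  rw [h5.fderiv]
  refine ContinuousLinearMap.opNorm_le_bound _ (by norm_num) fun v => ?_
  set Z := fun y => sqrtSeries (J.comp (meanHessian Φ y)) with hZdef
  have e : ((-2 : ℂ) • ((Z x).comp (ContinuousLinearMap.id ℂ E) +
      (fderiv ℂ Z x).flip (id x))) v = (-2 : ℂ) • (Z x v + fderiv ℂ Z x v x) := rfl
  rw [e, norm_smul, show ‖(-2 : ℂ)‖ = 2 by norm_num]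
  have h6 : ‖Z x v‖ ≤ 1 / 132 * ‖v‖ := (Z x).le_of_opNorm_le hZ v
  have h7 : ‖fderiv ℂ Z x v x‖ ≤ ‖x‖ * ‖fderiv ℂ Z x‖ * ‖v‖ := by
    calc _ ≤ ‖fderiv ℂ Z x v‖ * ‖x‖ := ContinuousLinearMap.le_opNorm _ _
      _ ≤ ‖fderiv ℂ Z x‖ * ‖v‖ * ‖x‖ :=
        mul_le_mul_of_nonneg_right (ContinuousLinearMap.le_opNorm _ _) (norm_nonneg _)
      _ = _ := by ring
  have h8 : ‖x‖ * ‖fderiv ℂ Z x‖ ≤ 81 / 272 / (4 * (1 - 2 * (1 / 132))) := by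
    calc _ ≤ ‖x‖ * (‖fderiv ℂ (fun y => J.comp (meanHessian Φ y)) x‖ /
          (4 * (1 - 2 * (1 / 132)))) := mul_le_mul_of_nonneg_left h3 (norm_nonneg _)
      _ = ‖x‖ * ‖fderiv ℂ (fun y => J.comp (meanHessian Φ y)) x‖ /
          (4 * (1 - 2 * (1 / 132))) := by ring
      _ ≤ _ := by gcongr
  have h9 := mul_le_mul_of_nonneg_right h8 (norm_nonneg v)
  calc 2 * ‖Z x v + fderiv ℂ Z x v x‖ ≤ 2 * (‖Z x v‖ + ‖fderiv ℂ Z x v x‖) :=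
        mul_le_mul_of_nonneg_left (norm_add_le _ _) (by norm_num)
    _ ≤ 2 * (1 / 132 * ‖v‖ + 81 / 272 / (4 * (1 - 2 * (1 / 132))) * ‖v‖) := by linarith
    _ ≤ 1 / 2 * ‖v‖ := by
        norm_num
        linarith [norm_nonneg v]

theorem morseDisplacement_mem {S : AddSubgroup E} (hS : ∀ (r : ℝ), ∀ u ∈ S, (r : ℂ) • u ∈ S)
    (hSc : IsClosed (S : Set E)) (hSU : ∀ u ∈ S, u ∈ U) (hD : IsMorseDomain U V)
    (hd : DifferentiableOn ℂ Φ V) (hN : ∀ z ∈ V, ‖Φ z‖ ≤ N) (hJ : ‖J‖ ≤ C)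
    (hCN : C * N ≤ 1 / 17) (hreal : ∀ w ∈ S, (Φ w).im = 0)
    (hJS : ∀ ℓ : E →L[ℂ] ℂ, (∀ v ∈ S, (ℓ v).im = 0) → J ℓ ∈ S) {x : E} (hx : x ∈ S) :
    morseDisplacement J Φ x ∈ S := by
  have h1 := norm_comp_meanHessian_le hD hd hN hJ hCN (hSU x hx)
  have h2 := sqrtSeries_mem_of_invariant hSc hS (h1.trans_lt (by norm_num))
    (fun u hu => hJS _ fun v hv => im_meanHessian_eq_zero hS hSU hD hd hreal hx hu hv) hx
  have h3 := hS (-2) _ h2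
  rw [morseDisplacement]
  simpa using h3

/-- With `W = 1 - 2Z(K)` self-adjoint for `β` and `W² = 1 - K`, one has `β(Wx, Wx) = β(x, W²x) =
β(x,x) - β(Kx, x)`, and `β(Kx, x) = t H(x)(x,x) = t Φ(x)`. -/
theorem bilin_morseDisplacement (hD : IsMorseDomain U V) (hd : DifferentiableOn ℂ Φ V)
    (hN : ∀ z ∈ V, ‖Φ z‖ ≤ N) (hJ : ‖J‖ ≤ C) (hCN : C * N ≤ 1 / 17) (h0 : Φ 0 = 0)
    (h1 : fderiv ℂ Φ 0 = 0) {β : E →L[ℂ] E →L[ℂ] ℂ} {t : ℂ} (hβ : ∀ u v, β u v = β v u)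
    (hβJ : ∀ ℓ v, β (J ℓ) v = t * ℓ v) {x : E} (hx : x ∈ U) :
    β (x + morseDisplacement J Φ x) (x + morseDisplacement J Φ x) = β x x - t * Φ x := by
  set K := J.comp (meanHessian Φ x) with hKdef
  have hK : ‖K‖ < 1 := (norm_comp_meanHessian_le hD hd hN hJ hCN hx).trans_lt (by norm_num)
  -- Since `β(Ku, v) = t H(u,v)`, self-adjointness of `K` is the symmetry of the Hessian.
  have hsymm : ∀ u v, β (K u) v = β u (K v) := by
    intro u v
    rw [hβ u (K v)]
    change β (J (meanHessian Φ x u)) v = β (J (meanHessian Φ x v)) u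
    rw [hβJ, hβJ, meanHessian_symm hD hd hx]
  have hw : x + morseDisplacement J Φ x = (1 - (2 : ℂ) • sqrtSeries K) x := by
    change x + (-2 : ℂ) • sqrtSeries K x = x - (2 : ℂ) • sqrtSeries K x
    module
  have hW : ∀ u v, β ((1 - (2 : ℂ) • sqrtSeries K) u) v =
      β u ((1 - (2 : ℂ) • sqrtSeries K) v) := by
    intro u v
    change β (u - (2 : ℂ) • sqrtSeries K u) v = β u (v - (2 : ℂ) • sqrtSeries K v)
    rw [map_sub, map_sub, map_smul, map_smul, sub_apply, smul_apply,
      bilin_sqrtSeries_symm hK hsymm]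
  rw [hw, hW]
  have h2 : (1 - (2 : ℂ) • sqrtSeries K) ((1 - (2 : ℂ) • sqrtSeries K) x) = x - K x := by
    change ((1 - (2 : ℂ) • sqrtSeries K) * (1 - (2 : ℂ) • sqrtSeries K)) x = _
    rw [one_sub_two_smul_sqrtSeries_mul_self hK]
    rfl
  rw [h2, map_sub, hβ x (K x)]
  change β x x - β (J (meanHessian Φ x x)) x = _
  rw [hβJ, meanHessian_self hD hd h0 h1 hx]

theorem continuousOn_uncurry_morseDisplacement (hD : IsMorseDomain U V) {T : ℝ}
    {Ψ : ℝ → E → ℂ} {J : ℝ → (E →L[ℂ] ℂ) →L[ℂ] E}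
    (hd : ∀ t ∈ Ioo 0 T, DifferentiableOn ℂ (Ψ t) V)
    (hc : ContinuousOn (fun p : ℝ × E => Ψ p.1 p.2) (Ioo 0 T ×ˢ V))
    (hN : ∀ t ∈ Ioo 0 T, ∀ z ∈ V, ‖Ψ t z‖ ≤ N) (hJ : ∀ t ∈ Ioo 0 T, ‖J t‖ ≤ C)
    (hJc : ContinuousOn J (Ioo 0 T)) (hCN : C * N ≤ 1 / 17) :
    ContinuousOn (fun p : ℝ × E => morseDisplacement (J p.1) (Ψ p.1) p.2) (Ioo 0 T ×ˢ U) := by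
  have h1 := continuousOn_uncurry_meanHessian hD hd hc hN
  have h2 : ContinuousOn (fun p : ℝ × E => J p.1) (Ioo 0 T ×ˢ U) :=
    hJc.comp continuousOn_fst fun p hp => hp.1
  have h3 : ContinuousOn (fun p : ℝ × E => (J p.1).comp (meanHessian (Ψ p.1) p.2))
      (Ioo 0 T ×ˢ U) := h2.clm_comp h1
  have h4 : ContinuousOn (fun p : ℝ × E => sqrtSeries ((J p.1).comp (meanHessian (Ψ p.1) p.2)))
      (Ioo 0 T ×ˢ U) := by
    intro p hp
    have h5 := norm_comp_meanHessian_le hD (hd p.1 hp.1) (hN p.1 hp.1) (hJ p.1 hp.1) hCN hp.2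
    exact ContinuousAt.comp_continuousWithinAt (g := sqrtSeries)
      (f := fun p : ℝ × E => (J p.1).comp (meanHessian (Ψ p.1) p.2))
      (analyticAt_sqrtSeries (h5.trans_lt (by norm_num))).continuousAt (h3 p hp)
  exact (h4.clm_apply continuousOn_snd).const_smul (-2 : ℂ)

end Morse

/-! ### Labelled trees: parent maps, weighted enumeration, leaves. -/

section Trees

open Classical in
theorem mem_trees {m : ℕ} {g : SimpleGraph (Fin m)} : g ∈ trees m ↔ g.IsTree := by
  simp [trees]

open Classical in
theorem mem_edges {m : ℕ} {g : SimpleGraph (Fin m)} {p : Fin m × Fin m} :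
    p ∈ edges g ↔ p.1 < p.2 ∧ g.Adj p.1 p.2 := by
  simp [edges]

open Classical in
theorem image_edges_eq_edgeFinset {m : ℕ} (g : SimpleGraph (Fin m)) :
    (edges g).image (fun p => s(p.1, p.2)) = g.edgeFinset := by
  ext e
  induction e with
  | h a b =>
    simp only [Finset.mem_image, mem_edges, SimpleGraph.mem_edgeFinset, SimpleGraph.mem_edgeSet,
      Prod.exists]
    constructor
    · rintro ⟨c, d, ⟨-, h⟩, he⟩
      rw [← SimpleGraph.mem_edgeSet] at h ⊢
      rwa [← he]
    · intro h
      rcases lt_or_gt_of_ne h.ne with hab | hab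
      · exact ⟨a, b, ⟨hab, h⟩, rfl⟩
      · exact ⟨b, a, ⟨hab, h.symm⟩, Sym2.eq_swap⟩

theorem injOn_edges {m : ℕ} (g : SimpleGraph (Fin m)) :
    Set.InjOn (fun p : Fin m × Fin m => s(p.1, p.2)) (edges g) := by
  rintro ⟨a, b⟩ h ⟨c, d⟩ h' he
  simp only [Finset.mem_coe, mem_edges] at h h'
  simp only [Sym2.eq_iff] at he
  rcases he with ⟨rfl, rfl⟩ | ⟨rfl, rfl⟩
  · rfl
  · exact absurd h.1 h'.1.asymm

open Classical in
theorem card_edges_of_isTree {m : ℕ} {g : SimpleGraph (Fin (m + 1))} (hg : g.IsTree) :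
    (edges g).card = m := by
  have h := hg.card_edgeFinset
  rw [← image_edges_eq_edgeFinset, Finset.card_image_of_injOn (injOn_edges g),
    Fintype.card_fin] at h
  omega

/-- Every vertex of a connected graph other than the root has a neighbour closer to the root. -/
theorem exists_adj_dist_lt {V : Type*} {g : SimpleGraph V} (hg : g.Connected) {v w : V}
    (h : v ≠ w) : ∃ u, g.Adj v u ∧ g.dist u w < g.dist v w := by
  obtain ⟨p, hp⟩ := hg.exists_walk_length_eq_dist v w
  cases p with
  | nil => exact absurd rfl h
  | cons hadj q =>
    refine ⟨_, hadj, ?_⟩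
    rw [← hp, SimpleGraph.Walk.length_cons]
    exact Nat.lt_succ_of_le (SimpleGraph.dist_le q)

open Classical in
-- Root the tree at `0` and let `f` choose a neighbour closer to the root. No edge is chosen from
-- both ends, as the distance would then decrease in both directions; the `m` distinct edges
-- obtained are all of them by counting.
theorem exists_parent_of_isTree {m : ℕ} {g : SimpleGraph (Fin (m + 1))} (hg : g.IsTree) :
    ∃ f : Fin m → Fin (m + 1), Function.Injective (fun j => s(j.succ, f j)) ∧
      Finset.univ.image (fun j => s(j.succ, f j)) = g.edgeFinset := by
  have h : ∀ j : Fin m, ∃ u, g.Adj j.succ u ∧ g.dist u 0 < g.dist j.succ 0 := fun j =>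
    exists_adj_dist_lt hg.connected (Fin.succ_ne_zero j)
  choose f hf hd using h
  have hinj : Function.Injective (fun j => s(j.succ, f j)) := by
    intro j k hjk
    simp only [Sym2.eq_iff] at hjk
    rcases hjk with ⟨h, -⟩ | ⟨h1, h2⟩
    · exact Fin.succ_injective _ h
    · have h3 := hd j
      have h4 := hd k
      rw [h2] at h3
      rw [← h1] at h4
      omega
  refine ⟨f, hinj, Finset.eq_of_subset_of_card_le ?_ ?_⟩
  · intro e he
    obtain ⟨j, -, rfl⟩ := Finset.mem_image.1 he
    rw [SimpleGraph.mem_edgeFinset, SimpleGraph.mem_edgeSet]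
    exact hf j
  · rw [Finset.card_image_of_injective _ hinj, Finset.card_univ, Fintype.card_fin]
    have := hg.card_edgeFinset
    rw [Fintype.card_fin] at this
    omega

open Classical in
theorem prod_edges_eq_of_image_eq {m : ℕ} {g : SimpleGraph (Fin (m + 1))}
    {f : Fin m → Fin (m + 1)} (hf : Function.Injective (fun j => s(j.succ, f j)))
    (hg : Finset.univ.image (fun j => s(j.succ, f j)) = g.edgeFinset) (r : Fin (m + 1) → ℝ) :
    ∏ p ∈ edges g, (r p.1 * r p.2) = ∏ j, (r j.succ * r (f j)) := by
  obtain ⟨w, hw⟩ : ∃ w : Sym2 (Fin (m + 1)) → ℝ, ∀ a b, w s(a, b) = r a * r b :=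
    ⟨Sym2.lift ⟨fun a b => r a * r b, fun a b => mul_comm _ _⟩, fun _ _ => rfl⟩
  simp only [← hw]
  rw [← Finset.prod_image (f := w) (injOn_edges g), image_edges_eq_edgeFinset, ← hg,
    Finset.prod_image hf.injOn]

/-- The weighted enumeration bound for labelled trees. -/
theorem sum_trees_prod_edges_le {m : ℕ} {r : Fin (m + 1) → ℝ} (hr : ∀ j, 0 ≤ r j) :
    ∑ g ∈ trees (m + 1), ∏ p ∈ edges g, (r p.1 * r p.2) ≤
      (∏ j : Fin m, r j.succ) * (∑ j, r j) ^ m := by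
  classical
  choose! F hF using fun (g : SimpleGraph (Fin (m + 1))) (hg : g.IsTree) =>
    exists_parent_of_isTree hg
  -- The parent map determines the edge set, so trees inject into all maps `Fin m → Fin (m + 1)`.
  -- Summing over all such maps expands `(∑ r)^m`.
  have hFinj : Set.InjOn F (trees (m + 1) : Set (SimpleGraph (Fin (m + 1)))) := by
    intro g hg g' hg' h
    have h1 := (hF g (mem_trees.1 hg)).2
    have h2 := (hF g' (mem_trees.1 hg')).2
    rw [h, h2] at h1
    exact (SimpleGraph.edgeFinset_inj.1 h1).symm
  calc ∑ g ∈ trees (m + 1), ∏ p ∈ edges g, (r p.1 * r p.2)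
      = ∑ g ∈ trees (m + 1), ∏ j, (r j.succ * r (F g j)) :=
        Finset.sum_congr rfl fun g hg => by
          have h := hF g (mem_trees.1 hg)
          exact prod_edges_eq_of_image_eq h.1 h.2 r
    _ = ∑ f ∈ (trees (m + 1)).image F, ∏ j, (r j.succ * r (f j)) :=
        (Finset.sum_image (f := fun f : Fin m → Fin (m + 1) => ∏ j, (r j.succ * r (f j)))
          hFinj).symm
    _ ≤ ∑ f : Fin m → Fin (m + 1), ∏ j, (r j.succ * r (f j)) :=
        Finset.sum_le_sum_of_subset_of_nonneg (Finset.subset_univ _) fun f _ _ =>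
          Finset.prod_nonneg fun j _ => mul_nonneg (hr _) (hr _)
    _ = _ := by
        rw [Fintype.sum_pow, Finset.mul_sum]
        exact Finset.sum_congr rfl fun f _ => Finset.prod_mul_distrib

open Classical in
/-- A nontrivial tree has a leaf different from any given vertex. -/
theorem exists_leaf_ne {m : ℕ} {g : SimpleGraph (Fin (m + 2))} (hg : g.IsTree)
    (j : Fin (m + 2)) : ∃ k ≠ j, ∃ l, g.Adj k l ∧ ∀ l', g.Adj k l' → l' = l := by
  obtain ⟨u, v, huv, hu, hv⟩ := hg.exists_ne_and_degree_eq_one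
  have key : ∀ k, g.degree k = 1 → ∃ l, g.Adj k l ∧ ∀ l', g.Adj k l' → l' = l := by
    intro k hk
    rw [SimpleGraph.degree_eq_one_iff_existsUnique_adj] at hk
    exact hk
  rcases eq_or_ne u j with rfl | h
  · exact ⟨v, huv.symm, key v hv⟩
  · exact ⟨u, h, key u hu⟩

end Trees

/-! ### Volume of the ordered simplex. -/

section Simplex

open MeasureTheory Set

theorem isOpen_openSimplex (m : ℕ) : IsOpen (openSimplex m) := by
  have h : openSimplex m = (⋂ i : Fin m, ⋂ j : Fin m, ⋂ _ : i < j, {s | s i < s j}) ∩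
      ⋂ j : Fin m, {s | s j ∈ Ioo (0 : ℝ) 1} := by
    ext s
    simp [openSimplex, StrictMono]
  rw [h]
  refine IsOpen.inter ?_ (isOpen_iInter_of_finite fun j => isOpen_Ioo.preimage (by fun_prop))
  exact isOpen_iInter_of_finite fun i => isOpen_iInter_of_finite fun j =>
    isOpen_iInter_of_finite fun _ => isOpen_lt (by fun_prop) (by fun_prop)

/-- The `m!` images of the simplex under permutations of coordinates have equal volume, are
disjoint, and lie in the unit cube. -/
theorem volume_openSimplex_le (m : ℕ) :
    volume (openSimplex m) ≤ ENNReal.ofReal (1 / m.factorial) := by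
  let A : Equiv.Perm (Fin m) → Set (Fin m → ℝ) := fun σ => {s | s ∘ σ ∈ openSimplex m}
  have hA : ∀ σ, A σ = (MeasurableEquiv.piCongrLeft (fun _ => ℝ) σ.symm) ⁻¹' openSimplex m := by
    intro σ
    ext s
    have : MeasurableEquiv.piCongrLeft (fun _ => ℝ) σ.symm s = s ∘ σ := by
      funext j
      have := Equiv.piCongrLeft_apply_apply (fun _ : Fin m => ℝ) σ.symm s (σ j)
      rw [Equiv.symm_apply_apply] at this
      exact this
    rw [mem_preimage, this]
    rfl
  have hvol : ∀ σ, volume (A σ) = volume (openSimplex m) := by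
    intro σ
    rw [hA]
    exact (volume_measurePreserving_piCongrLeft (fun _ : Fin m => ℝ) σ.symm).measure_preimage
      (isOpen_openSimplex m).measurableSet.nullMeasurableSet
  have hmeas : ∀ σ, MeasurableSet (A σ) := by
    intro σ
    rw [hA]
    exact (MeasurableEquiv.measurable _) (isOpen_openSimplex m).measurableSet
  have hdisj : Pairwise (Function.onFun Disjoint A) := by
    intro σ τ hne
    refine Set.disjoint_left.2 fun s hs hs' => hne ?_
    -- An increasing enumeration is determined by its range, so one point has at most one sorting
    -- permutation.
    have hr : range (s ∘ σ) = range (s ∘ τ) := by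
      rw [range_comp, range_comp, σ.surjective.range_eq, τ.surjective.range_eq]
    have he : s ∘ σ = s ∘ τ := (StrictMono.range_inj hs.1 hs'.1).1 hr
    have hinj : Function.Injective s := by
      intro a b hab
      have := hs.1.injective (a₁ := σ.symm a) (a₂ := σ.symm b) (by simpa using hab)
      exact σ.symm.injective this
    ext j
    exact congrArg _ (hinj (congrFun he j))
  have hsub : (⋃ σ, A σ) ⊆ Set.pi univ fun _ => Ioo (0 : ℝ) 1 := by
    intro s hs j _
    obtain ⟨σ, hσ⟩ := mem_iUnion.1 hs
    have := hσ.2 (σ.symm j)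
    simpa using this
  have h1 : (m.factorial : ENNReal) * volume (openSimplex m) ≤ 1 := by
    calc _ = ∑ σ : Equiv.Perm (Fin m), volume (A σ) := by
          simp [hvol, Fintype.card_perm]
      _ = volume (⋃ σ, A σ) := by rw [measure_iUnion hdisj hmeas, tsum_fintype]
      _ ≤ volume (Set.pi univ fun _ : Fin m => Ioo (0 : ℝ) 1) := measure_mono hsub
      _ = 1 := by rw [volume_pi_pi]; simp
  have hf : (0 : ℝ) < m.factorial := by exact_mod_cast m.factorial_pos
  rw [ENNReal.ofReal_div_of_pos hf, ENNReal.ofReal_one, ENNReal.ofReal_natCast,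
    ENNReal.le_div_iff_mul_le (Or.inl (by exact_mod_cast m.factorial_ne_zero))
      (Or.inl (ENNReal.natCast_ne_top _)), mul_comm]
  exact h1

instance isFiniteMeasure_restrict_openSimplex (m : ℕ) :
    IsFiniteMeasure (volume.restrict (openSimplex m)) :=
  ⟨by rw [Measure.restrict_apply_univ]
      exact (volume_openSimplex_le m).trans_lt ENNReal.ofReal_lt_top⟩

theorem norm_setIntegral_openSimplex_le {m : ℕ} {f : (Fin m → ℝ) → ℂ} {C : ℝ}
    (hf : ∀ s ∈ openSimplex m, ‖f s‖ ≤ C) (hC : 0 ≤ C) :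
    ‖∫ s in openSimplex m, f s‖ ≤ C / m.factorial := by
  have h := norm_setIntegral_le_of_norm_le_const
    ((volume_openSimplex_le m).trans_lt ENNReal.ofReal_lt_top) hf
  refine h.trans ?_
  have : volume.real (openSimplex m) ≤ 1 / m.factorial :=
    ENNReal.toReal_le_of_le_ofReal (by positivity) (volume_openSimplex_le m)
  calc _ ≤ C * (1 / m.factorial) := by gcongr
    _ = _ := by ring

end Simplex

/-! ### Hyperbolic inequalities for edge and path factors. -/

section Hyperbolic

open Real

theorem sinh_le_mul_cosh {u : ℝ} (hu : 0 ≤ u) : sinh u ≤ u * cosh u := by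
  have hd : ∀ x, HasDerivAt (fun x => x * cosh x - sinh x) (x * sinh x) x := fun x => by
    have := ((hasDerivAt_id x).mul (hasDerivAt_cosh x)).sub (hasDerivAt_sinh x)
    convert! this using 1
    simp
  have hmono : MonotoneOn (fun x => x * cosh x - sinh x) (Set.Ici 0) := by
    refine monotoneOn_of_deriv_nonneg (convex_Ici 0) (by fun_prop) (by fun_prop) fun x hx => ?_
    rw [interior_Ici] at hx
    rw [(hd x).deriv]
    exact mul_nonneg (le_of_lt hx) (sinh_nonneg_iff.2 (le_of_lt hx))
  have := hmono (Set.self_mem_Ici) hu hu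
  simp only [zero_mul, sinh_zero, sub_zero] at this
  linarith

theorem mul_cosh_le {u : ℝ} (hu : 0 ≤ u) : u * cosh u ≤ (1 + u) * sinh u := by
  have h1 : u * cosh u - u * sinh u = u * exp (-u) := by rw [← mul_sub, cosh_sub_sinh]
  have h2 : u ≤ sinh u := self_le_sinh_iff.2 hu
  have h3 : exp (-u) ≤ 1 := exp_le_one_iff.2 (by linarith)
  nlinarith

/-- Replacing `s'` by `s` only increases the numerator, which is then at most `(ch τ - 1)/2 =
sh²(τ/2)`. The inequality `sh u ≤ u ch u` at `u = τ/2` bounds this by `τ sh τ / 4`. -/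
theorem sinh_mul_sinh_div_mem {τ s s' : ℝ} (hτ : 0 < τ) (hs : 0 < s) (hss' : s < s')
    (hs' : s' < 1) :
    sinh (τ * s) * sinh (τ * (1 - s')) / (τ * sinh τ) ∈ Set.Icc (0 : ℝ) (1 / 4) := by
  have hsh : 0 < sinh τ := sinh_pos_iff.2 hτ
  have h1 : 0 ≤ sinh (τ * s) := sinh_nonneg_iff.2 (by positivity)
  have h2 : 0 ≤ sinh (τ * (1 - s')) := sinh_nonneg_iff.2 (mul_nonneg hτ.le (by linarith))
  refine ⟨by positivity, ?_⟩
  rw [div_le_iff₀ (by positivity)]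
  have h3 : sinh (τ * (1 - s')) ≤ sinh (τ * (1 - s)) := sinh_le_sinh.2 (by nlinarith)
  have h4 : sinh (τ * s) * sinh (τ * (1 - s)) = (cosh τ - cosh (τ * s - τ * (1 - s))) / 2 := by
    rw [show cosh τ = cosh (τ * s + τ * (1 - s)) by ring_nf, cosh_add, cosh_sub]; ring
  have h5 := one_le_cosh (τ * s - τ * (1 - s))
  have hu := sinh_le_mul_cosh (u := τ / 2) (by positivity)
  have hsu : 0 ≤ sinh (τ / 2) := sinh_nonneg_iff.2 (by positivity)
  have h6 : cosh τ = 1 + 2 * sinh (τ / 2) ^ 2 := by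
    rw [show τ = 2 * (τ / 2) by ring, cosh_two_mul, cosh_sq]; ring_nf
  have h7 : sinh τ = 2 * sinh (τ / 2) * cosh (τ / 2) := by
    conv_lhs => rw [show τ = 2 * (τ / 2) by ring, sinh_two_mul]
  have h8 := mul_le_mul_of_nonneg_left hu hsu
  have h9 := mul_le_mul_of_nonneg_left h3 h1
  nlinarith

/-- The ratio `q_{t,υ}(s) / x_υ` along the diagonal `x = y`. -/
noncomputable def pathFactor {ν : ℕ} (ω : Fin ν → ℝ) (t s : ℝ) (υ : Fin ν) : ℝ :=
  (sinh (ω υ * t * s) + sinh (ω υ * t * (1 - s))) / sinh (ω υ * t)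

theorem path_self {ν : ℕ} (ω : Fin ν → ℝ) (t : ℝ) (x : CSpace ν) (s : ℝ) (υ : Fin ν) :
    path ω t x x s υ = pathFactor ω t s υ * x υ := by
  rw [path, pathFactor]
  push_cast
  ring

theorem pathFactor_eq {ν : ℕ} {ω : Fin ν → ℝ} {t s : ℝ} {υ : Fin ν} (h : 0 < ω υ * t) :
    pathFactor ω t s υ = cosh (ω υ * t * (s - 1 / 2)) / cosh (ω υ * t / 2) := by
  rw [pathFactor]
  set τ := ω υ * t
  have h1 : sinh (τ / 2) ≠ 0 := (sinh_pos_iff.2 (by positivity)).ne'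
  have h2 : cosh (τ / 2) ≠ 0 := (cosh_pos _).ne'
  have e1 : sinh (τ * s) + sinh (τ * (1 - s)) =
      2 * sinh (τ / 2) * cosh (τ * (s - 1 / 2)) := by
    rw [show τ * s = τ / 2 + τ * (s - 1 / 2) by ring,
      show τ * (1 - s) = τ / 2 - τ * (s - 1 / 2) by ring, sinh_add, sinh_sub]; ring
  have e2 : sinh τ = 2 * sinh (τ / 2) * cosh (τ / 2) := by
    conv_lhs => rw [show τ = 2 * (τ / 2) by ring, sinh_two_mul]
  rw [e1, e2]
  field_simp

theorem pathFactor_le_one {ν : ℕ} {ω : Fin ν → ℝ} {t s : ℝ} {υ : Fin ν} (h : 0 < ω υ * t)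
    (hs : s ∈ Set.Ioo (0 : ℝ) 1) : pathFactor ω t s υ ≤ 1 := by
  rw [pathFactor_eq h, div_le_one (cosh_pos _), cosh_le_cosh, abs_mul, abs_of_pos h,
    abs_of_pos (by linarith : 0 < ω υ * t / 2)]
  have : |s - 1 / 2| ≤ 1 / 2 := abs_le.2 ⟨by linarith [hs.1], by linarith [hs.2]⟩
  nlinarith

/-- This lower bound on the path factor makes it possible to divide by it after integrating by
parts. -/
theorem one_le_cosh_mul_pathFactor {ν : ℕ} {ω : Fin ν → ℝ} {t s c : ℝ} {υ : Fin ν}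
    (h : 0 < ω υ * t) (hc : cosh (ω υ * t / 2) ≤ c) : 1 ≤ c * pathFactor ω t s υ := by
  rw [pathFactor_eq h]
  calc 1 = cosh (ω υ * t / 2) * (1 / cosh (ω υ * t / 2)) := by
        field_simp
    _ ≤ _ := by
        gcongr
        · exact (cosh_pos _).le.trans hc
        · exact one_le_cosh _

theorem pathFactor_pos {ν : ℕ} {ω : Fin ν → ℝ} {t s : ℝ} {υ : Fin ν} (h : 0 < ω υ * t) :
    0 < pathFactor ω t s υ := by
  rw [pathFactor_eq h]
  have := cosh_pos (ω υ * t * (s - 1 / 2))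
  have := cosh_pos (ω υ * t / 2)
  positivity

end Hyperbolic

/-! ### Bounds for the sum of tree weights and its derivative at the root. -/

section TreeSum

variable {ν m : ℕ} {ω : Fin ν → ℝ} {t : ℝ}

theorem sum_abs_mul_abs_le (x y : RSpace ν) : ∑ υ, |x υ| * |y υ| ≤ ‖x‖ * ‖y‖ := by
  have h := Real.sum_mul_le_sqrt_mul_sqrt Finset.univ (fun υ => |x υ|) fun υ => |y υ|
  rw [EuclideanSpace.norm_eq, EuclideanSpace.norm_eq]
  simpa only [Real.norm_eq_abs] using h

/-- The factor of the tree weight attached to the edge `p`. -/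
noncomputable def edgeTerm (ω : Fin ν → ℝ) (t : ℝ) (s : Fin m → ℝ) (p : Fin m × Fin m)
    (x y : RSpace ν) : ℝ :=
  ∑ υ : Fin ν, Real.sinh (ω υ * t * s p.1) * Real.sinh (ω υ * t * (1 - s p.2)) /
      (ω υ * t * Real.sinh (ω υ * t)) * x υ * y υ

theorem treeWeight_eq (g : SimpleGraph (Fin m)) (s : Fin m → ℝ) (ξ : Fin m → RSpace ν) :
    treeWeight ω t g s ξ = ∏ p ∈ edges g, edgeTerm ω t s p (ξ p.1) (ξ p.2) := rfl

theorem abs_edgeTerm_le (hω : ∀ υ, 0 < ω υ) (ht : 0 < t) {s : Fin m → ℝ}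
    (hs : s ∈ openSimplex m) {p : Fin m × Fin m} (hp : p.1 < p.2) (x y : RSpace ν) :
    |edgeTerm ω t s p x y| ≤ 1 / 4 * (‖x‖ * ‖y‖) := by
  calc |edgeTerm ω t s p x y| ≤ ∑ υ, 1 / 4 * (|x υ| * |y υ|) := by
        refine (Finset.abs_sum_le_sum_abs _ _).trans (Finset.sum_le_sum fun υ _ => ?_)
        have h := sinh_mul_sinh_div_mem (mul_pos (hω υ) ht) (hs.2 p.1).1 (hs.1 hp) (hs.2 p.2).2
        rw [abs_mul, abs_mul, abs_of_nonneg h.1, mul_assoc]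
        exact mul_le_mul_of_nonneg_right h.2 (by positivity)
    _ ≤ _ := by
        rw [← Finset.mul_sum]
        exact mul_le_mul_of_nonneg_left (sum_abs_mul_abs_le x y) (by norm_num)

/-- The weights `r_0 = |ξ_0| + 1`, `r_j = |ξ_j|` for `j ≠ 0`. -/
noncomputable def vertexWeight (ξ : Fin (m + 1) → RSpace ν) (j : Fin (m + 1)) : ℝ :=
  ‖ξ j‖ + if j = 0 then 1 else 0

/-- The extra 1 at the root lets the same weights dominate the unit vector that replaces `ξ 0` when
an edge factor is differentiated. -/
theorem norm_le_vertexWeight (ξ : Fin (m + 1) → RSpace ν) (j : Fin (m + 1)) :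
    ‖ξ j‖ ≤ vertexWeight ξ j := by
  rw [vertexWeight]; split_ifs <;> simp

theorem vertexWeight_nonneg (ξ : Fin (m + 1) → RSpace ν) (j : Fin (m + 1)) :
    0 ≤ vertexWeight ξ j := (norm_nonneg _).trans (norm_le_vertexWeight ξ j)

/-- The sum of the tree majorants. -/
theorem sum_trees_vertexWeight_le (ξ : Fin (m + 1) → RSpace ν) :
    ∑ g ∈ trees (m + 1), ∏ p ∈ edges g, (1 / 4 * (vertexWeight ξ p.1 * vertexWeight ξ p.2)) ≤
      m.factorial * Real.exp (2 * ∑ j, ‖ξ j‖) := by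
  set S := ∑ j, ‖ξ j‖ with hS
  have hS0 : 0 ≤ S := Finset.sum_nonneg fun j _ => norm_nonneg _
  have h1 : ∑ j, vertexWeight ξ j = 1 + S := by
    simp [vertexWeight, Finset.sum_add_distrib, add_comm, hS]
  have h2 : ∏ j : Fin m, vertexWeight ξ j.succ ≤ Real.exp S := by
    calc ∏ j : Fin m, vertexWeight ξ j.succ = ∏ j : Fin m, ‖ξ j.succ‖ := by
          simp [vertexWeight]
      _ ≤ ∏ j : Fin m, Real.exp ‖ξ j.succ‖ :=
          Finset.prod_le_prod (fun _ _ => norm_nonneg _) fun j _ =>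
            (by linarith [Real.add_one_le_exp ‖ξ j.succ‖])
      _ = Real.exp (∑ j : Fin m, ‖ξ j.succ‖) := (Real.exp_sum _ _).symm
      _ ≤ Real.exp S := by
          rw [hS, Fin.sum_univ_succ]
          exact Real.exp_le_exp.2 (by linarith [norm_nonneg (ξ 0)])
  have hf : (0 : ℝ) < m.factorial := by exact_mod_cast m.factorial_pos
  -- The factor `e` in `e^{1+S}` is absorbed by `4^m`, which the edge constants `1/4` later cancel.
  -- For `m = 0` there is nothing to absorb it, but the power is then 1.
  have h3 : (1 + S) ^ m ≤ m.factorial * (4 ^ m * Real.exp S) := by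
    rcases Nat.eq_zero_or_pos m with rfl | hm
    · simpa using hS0
    · have h := Real.pow_div_factorial_le_exp (1 + S) (by linarith) m
      rw [div_le_iff₀ hf, Real.exp_add] at h
      have h4 : Real.exp 1 ≤ 4 ^ m :=
        (Real.exp_one_lt_three.le.trans (by norm_num)).trans
          (le_self_pow₀ (by norm_num : (1 : ℝ) ≤ 4) hm.ne')
      calc _ ≤ _ := h
        _ ≤ 4 ^ m * Real.exp S * m.factorial := by gcongr
        _ = _ := by ring
  calc _ = ∑ g ∈ trees (m + 1), (1 / 4) ^ m * ∏ p ∈ edges g,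
        (vertexWeight ξ p.1 * vertexWeight ξ p.2) := by
        refine Finset.sum_congr rfl fun g hg => ?_
        rw [Finset.prod_mul_distrib, Finset.prod_const, card_edges_of_isTree (mem_trees.1 hg)]
    _ ≤ (1 / 4) ^ m * ((∏ j : Fin m, vertexWeight ξ j.succ) * (∑ j, vertexWeight ξ j) ^ m) := by
        rw [← Finset.mul_sum]
        gcongr
        exact sum_trees_prod_edges_le (vertexWeight_nonneg ξ)
    _ ≤ (1 / 4) ^ m * (Real.exp S * (m.factorial * (4 ^ m * Real.exp S))) := by
        rw [h1]
        gcongr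
    _ = m.factorial * Real.exp (2 * S) := by
        rw [two_mul, Real.exp_add, one_div, inv_pow]
        field_simp

/-- The sum of the tree weights over all trees on `m + 1` vertices. -/
noncomputable def treeSum (ω : Fin ν → ℝ) (t : ℝ) (s : Fin (m + 1) → ℝ)
    (ξ : Fin (m + 1) → RSpace ν) : ℝ :=
  ∑ g ∈ trees (m + 1), treeWeight ω t g s ξ

theorem abs_treeWeight_le (hω : ∀ υ, 0 < ω υ) (ht : 0 < t) {s : Fin (m + 1) → ℝ}
    (hs : s ∈ openSimplex (m + 1)) (g : SimpleGraph (Fin (m + 1)))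
    (ξ : Fin (m + 1) → RSpace ν) :
    |treeWeight ω t g s ξ| ≤
      ∏ p ∈ edges g, (1 / 4 * (vertexWeight ξ p.1 * vertexWeight ξ p.2)) := by
  rw [treeWeight_eq, Finset.abs_prod]
  refine Finset.prod_le_prod (fun _ _ => abs_nonneg _) fun p hp => ?_
  refine (abs_edgeTerm_le hω ht hs (mem_edges.1 hp).1 _ _).trans ?_
  have := mul_le_mul (norm_le_vertexWeight ξ p.1) (norm_le_vertexWeight ξ p.2) (norm_nonneg _)
    (vertexWeight_nonneg ξ p.1)
  linarith

theorem abs_treeWeight_le_exp (hω : ∀ υ, 0 < ω υ) (ht : 0 < t) {s : Fin (m + 1) → ℝ}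
    (hs : s ∈ openSimplex (m + 1)) {g : SimpleGraph (Fin (m + 1))} (hg : g ∈ trees (m + 1))
    (ξ : Fin (m + 1) → RSpace ν) :
    |treeWeight ω t g s ξ| ≤ m.factorial * Real.exp (2 * ∑ j, ‖ξ j‖) := by
  refine (abs_treeWeight_le hω ht hs g ξ).trans (le_trans ?_ (sum_trees_vertexWeight_le ξ))
  refine Finset.single_le_sum (f := fun g => ∏ q ∈ edges g,
    (1 / 4 * (vertexWeight ξ q.1 * vertexWeight ξ q.2))) (fun g _ => ?_) hg
  refine Finset.prod_nonneg fun q _ => ?_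
  have := mul_nonneg (vertexWeight_nonneg ξ q.1) (vertexWeight_nonneg ξ q.2)
  positivity

theorem abs_treeSum_le (hω : ∀ υ, 0 < ω υ) (ht : 0 < t) {s : Fin (m + 1) → ℝ}
    (hs : s ∈ openSimplex (m + 1)) (ξ : Fin (m + 1) → RSpace ν) :
    |treeSum ω t s ξ| ≤ m.factorial * Real.exp (2 * ∑ j, ‖ξ j‖) :=
  (Finset.abs_sum_le_sum_abs _ _).trans
    ((Finset.sum_le_sum fun g _ => abs_treeWeight_le hω ht hs g ξ).trans
      (sum_trees_vertexWeight_le ξ))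

/-- The direction `e` in the component of the vertex `0`. -/
def rootDir (e : RSpace ν) : Fin (m + 1) → RSpace ν := Pi.single 0 e

@[simp] theorem rootDir_zero (e : RSpace ν) : (rootDir e : Fin (m + 1) → RSpace ν) 0 = e := by
  simp [rootDir]

theorem rootDir_of_ne (e : RSpace ν) {j : Fin (m + 1)} (hj : j ≠ 0) :
    (rootDir e : Fin (m + 1) → RSpace ν) j = 0 := by
  simp [rootDir, hj]

/-- The derivative of the edge factor when `ξ_0` moves in the direction `e`. -/
noncomputable def edgeDeriv (ω : Fin ν → ℝ) (t : ℝ) (s : Fin (m + 1) → ℝ) (e : RSpace ν)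
    (ξ : Fin (m + 1) → RSpace ν) (p : Fin (m + 1) × Fin (m + 1)) : ℝ :=
  if p.1 = 0 then edgeTerm ω t s p e (ξ p.2) else 0

theorem hasDerivAt_edgeTerm (s : Fin (m + 1) → ℝ) (e : RSpace ν)
    (ξ : Fin (m + 1) → RSpace ν) {p : Fin (m + 1) × Fin (m + 1)} (hp : p.1 < p.2) :
    HasDerivAt (fun τ : ℝ => edgeTerm ω t s p (ξ p.1 + τ • rootDir e p.1)
      (ξ p.2 + τ • rootDir e p.2)) (edgeDeriv ω t s e ξ p) 0 := by
  -- The root has the least index, so it is never the larger endpoint of an edge.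
  have h2 : p.2 ≠ 0 := (lt_of_le_of_lt (Fin.zero_le _) hp).ne'
  have e2 : ∀ τ : ℝ, ξ p.2 + τ • rootDir e p.2 = ξ p.2 := by
    intro τ; simp [rootDir_of_ne e h2]
  simp only [e2]
  rw [edgeDeriv]
  split_ifs with h1
  · have e1 : ∀ τ : ℝ, edgeTerm ω t s p (ξ p.1 + τ • rootDir e p.1)
        (ξ p.2) = edgeTerm ω t s p (ξ 0) (ξ p.2) + τ * edgeTerm ω t s p e (ξ p.2) := by
      intro τ
      rw [edgeTerm, edgeTerm, edgeTerm, Finset.mul_sum, ← Finset.sum_add_distrib]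
      refine Finset.sum_congr rfl fun υ _ => ?_
      simp [h1]
      ring
    simp only [e1]
    simpa using ((hasDerivAt_id (0 : ℝ)).mul_const (edgeTerm ω t s p e (ξ p.2))).const_add
      (edgeTerm ω t s p (ξ 0) (ξ p.2))
  · have e1 : ∀ τ : ℝ, ξ p.1 + τ • rootDir e p.1 = ξ p.1 := by
      intro τ; simp [rootDir_of_ne e h1]
    simp only [e1]
    exact hasDerivAt_const _ _

theorem abs_edgeDeriv_le (hω : ∀ υ, 0 < ω υ) (ht : 0 < t) {s : Fin (m + 1) → ℝ}
    (hs : s ∈ openSimplex (m + 1)) {e : RSpace ν} (he : ‖e‖ ≤ 1) (ξ : Fin (m + 1) → RSpace ν)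
    {p : Fin (m + 1) × Fin (m + 1)} (hp : p.1 < p.2) :
    |edgeDeriv ω t s e ξ p| ≤ 1 / 4 * (vertexWeight ξ p.1 * vertexWeight ξ p.2) := by
  have h0 := mul_nonneg (vertexWeight_nonneg ξ p.1) (vertexWeight_nonneg ξ p.2)
  rw [edgeDeriv]
  split_ifs with h1
  · refine (abs_edgeTerm_le hω ht hs hp _ _).trans ?_
    have h2 : ‖e‖ ≤ vertexWeight ξ p.1 := by
      rw [vertexWeight, if_pos h1]; linarith [norm_nonneg (ξ p.1)]
    have := mul_le_mul h2 (norm_le_vertexWeight ξ p.2) (norm_nonneg _) (vertexWeight_nonneg ξ p.1)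
    linarith
  · rw [abs_zero]; positivity

open Classical in
/-- The derivative of the tree sum when `ξ_0` moves in the direction `e`. -/
noncomputable def treeSumDeriv (ω : Fin ν → ℝ) (t : ℝ) (s : Fin (m + 1) → ℝ) (e : RSpace ν)
    (ξ : Fin (m + 1) → RSpace ν) : ℝ :=
  ∑ g ∈ trees (m + 1), ∑ p ∈ edges g,
    (∏ q ∈ (edges g).erase p, edgeTerm ω t s q (ξ q.1) (ξ q.2)) * edgeDeriv ω t s e ξ p

theorem hasDerivAt_treeSum (s : Fin (m + 1) → ℝ) (e : RSpace ν) (ξ : Fin (m + 1) → RSpace ν) :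
    HasDerivAt (fun τ : ℝ => treeSum ω t s (ξ + τ • rootDir e)) (treeSumDeriv ω t s e ξ) 0 := by
  classical
  refine HasDerivAt.fun_sum fun g _ => ?_
  simp only [treeWeight_eq]
  have h := HasDerivAt.fun_finsetProd (u := edges g) (x := (0 : ℝ)) (fun p hp =>
    hasDerivAt_edgeTerm (ω := ω) (t := t) s e ξ (mem_edges.1 hp).1)
  simpa using h

/-- Each term of the product rule is dominated by the full product of vertex weights; a tree has `m`
edges, hence the factor `m`. -/
theorem abs_treeSumDeriv_le (hω : ∀ υ, 0 < ω υ) (ht : 0 < t) {s : Fin (m + 1) → ℝ}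
    (hs : s ∈ openSimplex (m + 1)) {e : RSpace ν} (he : ‖e‖ ≤ 1) (ξ : Fin (m + 1) → RSpace ν) :
    |treeSumDeriv ω t s e ξ| ≤ m * (m.factorial * Real.exp (2 * ∑ j, ‖ξ j‖)) := by
  classical
  refine (Finset.abs_sum_le_sum_abs _ _).trans ?_
  calc _ ≤ ∑ g ∈ trees (m + 1),
        m * ∏ p ∈ edges g, (1 / 4 * (vertexWeight ξ p.1 * vertexWeight ξ p.2)) := by
        refine Finset.sum_le_sum fun g hg => (Finset.abs_sum_le_sum_abs _ _).trans ?_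
        have hcard := card_edges_of_isTree (mem_trees.1 hg)
        calc _ ≤ ∑ p' ∈ edges g, ∏ p ∈ edges g,
              (1 / 4 * (vertexWeight ξ p.1 * vertexWeight ξ p.2)) := by
              refine Finset.sum_le_sum fun p hp => ?_
              rw [← Finset.prod_erase_mul _ _ hp, abs_mul, Finset.abs_prod]
              refine mul_le_mul ?_ (abs_edgeDeriv_le hω ht hs he ξ (mem_edges.1 hp).1)
                (abs_nonneg _) (Finset.prod_nonneg fun q _ => ?_)
              · refine Finset.prod_le_prod (fun _ _ => abs_nonneg _) fun q hq => ?_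
                have hq' := (mem_edges.1 (Finset.mem_of_mem_erase hq)).1
                refine (abs_edgeTerm_le hω ht hs hq' _ _).trans ?_
                have := mul_le_mul (norm_le_vertexWeight ξ q.1) (norm_le_vertexWeight ξ q.2)
                  (norm_nonneg _) (vertexWeight_nonneg ξ q.1)
                linarith
              · have := mul_nonneg (vertexWeight_nonneg ξ q.1) (vertexWeight_nonneg ξ q.2)
                positivity
          _ = _ := by rw [Finset.sum_const, hcard, nsmul_eq_mul]
    _ ≤ _ := by
        rw [← Finset.mul_sum]
        exact mul_le_mul_of_nonneg_left (sum_trees_vertexWeight_le ξ) (Nat.cast_nonneg m)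

end TreeSum

/-! ### The diagonal integrand: domination, holomorphy and joint continuity. -/

section Kernel

open MeasureTheory Set Filter Topology

variable {ν m : ℕ} {ω : Fin ν → ℝ} {ρ : RSpace ν → ℂ} {t : ℝ}

/-- The linear form `z ↦ ∑_j q_t(s_j) · ξ_j` for `x = y = z`. -/
noncomputable def phaseForm (ω : Fin ν → ℝ) (t : ℝ) (s : Fin m → ℝ) (ξ : Fin m → RSpace ν) :
    CSpace ν →L[ℂ] ℂ :=
  ∑ j, ∑ υ, ((pathFactor ω t (s j) υ * ξ j υ : ℝ) : ℂ) • EuclideanSpace.proj υ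

theorem phaseForm_apply (s : Fin m → ℝ) (ξ : Fin m → RSpace ν) (z : CSpace ν) :
    phaseForm ω t s ξ z = ∑ j, ∑ υ, ((pathFactor ω t (s j) υ * ξ j υ : ℝ) : ℂ) * z υ := by
  simp [phaseForm]

theorem sum_path_mul_eq_phaseForm (s : Fin m → ℝ) (ξ : Fin m → RSpace ν) (z : CSpace ν) :
    ∑ j, ∑ υ, path ω t z z (s j) υ * (ξ j υ : ℂ) = phaseForm ω t s ξ z := by
  rw [phaseForm_apply]
  refine Finset.sum_congr rfl fun j _ => Finset.sum_congr rfl fun υ _ => ?_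
  rw [path_self]; push_cast; ring

theorem sum_abs_pathFactor_mul_le (hω : ∀ υ, 0 < ω υ) (ht : 0 < t) {s : Fin m → ℝ}
    (hs : s ∈ openSimplex m) (ξ : Fin m → RSpace ν) (b : RSpace ν) :
    ∑ j, ∑ υ, |pathFactor ω t (s j) υ * ξ j υ| * |b υ| ≤ ‖b‖ * ∑ j, ‖ξ j‖ := by
  rw [Finset.mul_sum]
  refine Finset.sum_le_sum fun j _ => ?_
  refine le_trans (Finset.sum_le_sum fun υ _ => ?_) (sum_abs_mul_abs_le b (ξ j))
  have h := mul_pos (hω υ) ht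
  rw [abs_mul, abs_of_pos (pathFactor_pos h), mul_comm |b υ|]
  have h1 := pathFactor_le_one h (hs.2 j)
  calc _ ≤ 1 * |ξ j υ| * |b υ| := by gcongr
    _ = _ := by ring

theorem norm_phaseForm_le (hω : ∀ υ, 0 < ω υ) (ht : 0 < t) {s : Fin m → ℝ}
    (hs : s ∈ openSimplex m) (ξ : Fin m → RSpace ν) :
    ‖phaseForm ω t s ξ‖ ≤ ∑ j, ‖ξ j‖ := by
  refine ContinuousLinearMap.opNorm_le_bound _ (Finset.sum_nonneg fun _ _ => norm_nonneg _)
    fun z => ?_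
  have h := sum_abs_pathFactor_mul_le hω ht hs ξ (WithLp.toLp 2 fun υ => ‖z υ‖)
  have hz : ‖(WithLp.toLp 2 fun υ => ‖z υ‖ : RSpace ν)‖ = ‖z‖ := by
    simp [EuclideanSpace.norm_eq]
  rw [hz, mul_comm] at h
  refine le_trans ?_ h
  rw [phaseForm_apply]
  refine (norm_sum_le _ _).trans (Finset.sum_le_sum fun j _ => ?_)
  refine (norm_sum_le _ _).trans (Finset.sum_le_sum fun υ _ => ?_)
  rw [norm_mul, Complex.norm_real, Real.norm_eq_abs]
  simp

theorem abs_im_phaseForm_le (hω : ∀ υ, 0 < ω υ) (ht : 0 < t) {s : Fin m → ℝ}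
    (hs : s ∈ openSimplex m) (ξ : Fin m → RSpace ν) (z : CSpace ν) :
    |(phaseForm ω t s ξ z).im| ≤ ‖imVec z‖ * ∑ j, ‖ξ j‖ := by
  refine le_trans ?_ (sum_abs_pathFactor_mul_le hω ht hs ξ (imVec z))
  rw [phaseForm_apply, Complex.im_sum]
  refine (Finset.abs_sum_le_sum_abs _ _).trans (Finset.sum_le_sum fun j _ => ?_)
  rw [Complex.im_sum]
  refine (Finset.abs_sum_le_sum_abs _ _).trans (Finset.sum_le_sum fun υ _ => ?_)
  rw [Complex.im_ofReal_mul, abs_mul]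
  rfl

theorem norm_exp_phaseForm_le (hω : ∀ υ, 0 < ω υ) (ht : 0 < t) {s : Fin m → ℝ}
    (hs : s ∈ openSimplex m) (ξ : Fin m → RSpace ν) {z : CSpace ν} {R : ℝ} (hz : z ∈ tube ν R) :
    ‖Complex.exp (Complex.I * phaseForm ω t s ξ z)‖ ≤ Real.exp (R * ∑ j, ‖ξ j‖) := by
  rw [Complex.norm_exp, Complex.I_mul_re, Real.exp_le_exp]
  have h1 := (neg_le_abs _).trans (abs_im_phaseForm_le hω ht hs ξ z)
  refine h1.trans (mul_le_mul_of_nonneg_right (le_of_lt hz)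
    (Finset.sum_nonneg fun _ _ => norm_nonneg _))

/-- The integrand of `Q_{m+1}(t,z,z)`, summed over trees. -/
noncomputable def kernel (ω : Fin ν → ℝ) (ρ : RSpace ν → ℂ) (t : ℝ) (z : CSpace ν)
    (s : Fin (m + 1) → ℝ) (ξ : Fin (m + 1) → RSpace ν) : ℂ :=
  (treeSum ω t s ξ : ℂ) * Complex.exp (Complex.I * phaseForm ω t s ξ z) * ∏ j, ρ (ξ j)

/-- The dominating function `∏_j e^{R |ξ_j|} |ρ(ξ_j)|`. -/
noncomputable def majorant (ρ : RSpace ν → ℂ) (R : ℝ) (ξ : Fin m → RSpace ν) : ℝ :=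
  ∏ j, Real.exp (R * ‖ξ j‖) * ‖ρ (ξ j)‖

theorem majorant_eq (R : ℝ) (ξ : Fin m → RSpace ν) :
    majorant ρ R ξ = Real.exp (R * ∑ j, ‖ξ j‖) * ‖∏ j, ρ (ξ j)‖ := by
  rw [majorant, Finset.prod_mul_distrib, Finset.mul_sum, Real.exp_sum, norm_prod]

theorem majorant_nonneg (R : ℝ) (ξ : Fin m → RSpace ν) : 0 ≤ majorant ρ R ξ :=
  Finset.prod_nonneg fun _ _ => by positivity

theorem integrable_majorant {R : ℝ}
    (hexp : Integrable (fun ξ : RSpace ν => Real.exp (R * ‖ξ‖) * ‖ρ ξ‖)) :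
    Integrable (majorant ρ R : (Fin m → RSpace ν) → ℝ) :=
  Integrable.fintype_prod (f := fun _ (ξ : RSpace ν) => Real.exp (R * ‖ξ‖) * ‖ρ ξ‖) fun _ => hexp

/-- The exponent 5 of the moments splits as 2 from the tree weights and 3 from the width of the
tube. -/
theorem norm_mul_exp_mul_prod_le (hω : ∀ υ, 0 < ω υ) (ht : 0 < t) {s : Fin (m + 1) → ℝ}
    (hs : s ∈ openSimplex (m + 1)) (ξ : Fin (m + 1) → RSpace ν) {z : CSpace ν}
    (hz : z ∈ tube ν 3) {a : ℝ} (ha : |a| ≤ m.factorial * Real.exp (2 * ∑ j, ‖ξ j‖)) :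
    ‖(a : ℂ) * Complex.exp (Complex.I * phaseForm ω t s ξ z) * ∏ j, ρ (ξ j)‖ ≤
      m.factorial * majorant ρ 5 ξ := by
  rw [norm_mul, norm_mul, Complex.norm_real, Real.norm_eq_abs, majorant_eq]
  calc _ ≤ m.factorial * Real.exp (2 * ∑ j, ‖ξ j‖) * Real.exp (3 * ∑ j, ‖ξ j‖) *
        ‖∏ j, ρ (ξ j)‖ := by
        gcongr
        exact norm_exp_phaseForm_le hω ht hs ξ hz
    _ = _ := by
        rw [mul_assoc (m.factorial : ℝ), ← Real.exp_add, ← mul_assoc]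
        ring_nf

theorem norm_kernel_le (hω : ∀ υ, 0 < ω υ) (ht : 0 < t) {s : Fin (m + 1) → ℝ}
    (hs : s ∈ openSimplex (m + 1)) (ξ : Fin (m + 1) → RSpace ν) {z : CSpace ν}
    (hz : z ∈ tube ν 3) : ‖kernel ω ρ t z s ξ‖ ≤ m.factorial * majorant ρ 5 ξ :=
  norm_mul_exp_mul_prod_le hω ht hs ξ hz (abs_treeSum_le hω ht hs ξ)

/-- One more unit of exponential weight absorbs the linear factor produced by differentiating the
exponential in `z`. -/
theorem sum_mul_majorant_le {S : ℝ} (ξ : Fin m → RSpace ν) (hS : S = ∑ j, ‖ξ j‖) :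
    S * majorant ρ 5 ξ ≤ majorant ρ 6 ξ := by
  rw [majorant_eq, majorant_eq, ← hS, ← mul_assoc, show 6 * S = S + 5 * S by ring, Real.exp_add]
  have : S ≤ Real.exp S := by linarith [Real.add_one_le_exp S]
  gcongr

theorem continuous_pathFactor (t : ℝ) (υ : Fin ν) :
    Continuous fun s : ℝ => pathFactor ω t s υ := by
  unfold pathFactor
  fun_prop

theorem continuous_phaseForm (t : ℝ) (z : CSpace ν) :
    Continuous fun p : (Fin m → ℝ) × (Fin m → RSpace ν) => phaseForm ω t p.1 p.2 z := by
  simp only [phaseForm_apply]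
  refine continuous_finsetSum _ fun j _ => continuous_finsetSum _ fun υ _ => ?_
  refine Continuous.mul (Complex.continuous_ofReal.comp (Continuous.mul ?_ (by fun_prop)))
    continuous_const
  exact (continuous_pathFactor t υ).comp (by fun_prop)

theorem continuous_treeWeight (t : ℝ) (g : SimpleGraph (Fin m)) :
    Continuous fun p : (Fin m → ℝ) × (Fin m → RSpace ν) => treeWeight ω t g p.1 p.2 := by
  unfold treeWeight
  fun_prop

theorem continuous_treeSum (t : ℝ) :
    Continuous fun p : (Fin (m + 1) → ℝ) × (Fin (m + 1) → RSpace ν) => treeSum ω t p.1 p.2 :=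
  continuous_finsetSum _ fun g _ => continuous_treeWeight t g

theorem continuous_kernel (hρ : Continuous ρ) (t : ℝ) (z : CSpace ν) :
    Continuous fun p : (Fin (m + 1) → ℝ) × (Fin (m + 1) → RSpace ν) =>
      kernel ω ρ t z p.1 p.2 := by
  unfold kernel
  have h1 := continuous_treeSum (ω := ω) (m := m) t
  have h2 := continuous_phaseForm (ω := ω) (m := m + 1) t z
  fun_prop

theorem continuousOn_kernel (hω : ∀ υ, 0 < ω υ) (s : Fin (m + 1) → ℝ)
    (ξ : Fin (m + 1) → RSpace ν) :
    ContinuousOn (fun q : ℝ × CSpace ν => kernel ω ρ q.1 q.2 s ξ) (Ioi 0 ×ˢ univ) := by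
  have h0 : ∀ υ, ∀ q ∈ (Ioi 0 ×ˢ univ : Set (ℝ × CSpace ν)), Real.sinh (ω υ * q.1) ≠ 0 :=
    fun υ q hq => (Real.sinh_pos_iff.2 (mul_pos (hω υ) hq.1)).ne'
  have h1 : ∀ υ, ∀ q ∈ (Ioi 0 ×ˢ univ : Set (ℝ × CSpace ν)),
      ω υ * q.1 * Real.sinh (ω υ * q.1) ≠ 0 :=
    fun υ q hq => mul_ne_zero (mul_pos (hω υ) hq.1).ne' (h0 υ q hq)
  unfold kernel
  simp only [phaseForm_apply]
  refine ContinuousOn.mul (ContinuousOn.mul ?_ ?_) continuousOn_const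
  · refine Complex.continuous_ofReal.comp_continuousOn ?_
    refine continuousOn_finsetSum _ fun g _ => continuousOn_finsetProd _ fun p _ =>
      continuousOn_finsetSum _ fun υ _ => ?_
    refine ContinuousOn.mul (ContinuousOn.mul ?_ continuousOn_const) continuousOn_const
    exact ContinuousOn.div (by fun_prop) (by fun_prop) (h1 υ)
  · refine Complex.continuous_exp.comp_continuousOn (ContinuousOn.mul continuousOn_const ?_)
    refine continuousOn_finsetSum _ fun j _ => continuousOn_finsetSum _ fun υ _ => ?_
    refine ContinuousOn.mul (Complex.continuous_ofReal.comp_continuousOn ?_) (by fun_prop)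
    refine ContinuousOn.mul ?_ continuousOn_const
    unfold pathFactor
    exact ContinuousOn.div (by fun_prop) (by fun_prop) (h0 υ)

/-- The product of Lebesgue measure on the simplex and on the momenta. -/
noncomputable def kernelMeasure (ν m : ℕ) :
    Measure ((Fin (m + 1) → ℝ) × (Fin (m + 1) → RSpace ν)) :=
  (volume.restrict (openSimplex (m + 1))).prod volume

theorem ae_kernelMeasure : ∀ᵐ p ∂(kernelMeasure ν m), p.1 ∈ openSimplex (m + 1) :=
  Measure.quasiMeasurePreserving_fst.ae
    (ae_restrict_mem (isOpen_openSimplex (m + 1)).measurableSet)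

theorem integrable_kernelMeasure_majorant {R : ℝ} (C : ℝ)
    (hexp : Integrable (fun ξ : RSpace ν => Real.exp (R * ‖ξ‖) * ‖ρ ξ‖)) :
    Integrable (fun p : (Fin (m + 1) → ℝ) × (Fin (m + 1) → RSpace ν) => C * majorant ρ R p.2)
      (kernelMeasure ν m) :=
  ((integrable_majorant hexp).const_mul C).comp_snd _

variable (hω : ∀ υ, 0 < ω υ) (hρ : Continuous ρ)
  (hexp : ∀ R : ℝ, 0 < R → Integrable (fun ξ : RSpace ν => Real.exp (R * ‖ξ‖) * ‖ρ ξ‖))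

include hω hρ hexp

theorem integrable_kernel (ht : 0 < t) {z : CSpace ν} (hz : z ∈ tube ν 3) :
    Integrable (fun p => kernel ω ρ t z p.1 p.2) (kernelMeasure ν m) :=
  (integrable_kernelMeasure_majorant _ (hexp 5 (by norm_num))).mono'
    (continuous_kernel hρ t z).aestronglyMeasurable
    (ae_kernelMeasure.mono fun _ hp => norm_kernel_le hω ht hp _ hz)

theorem Q_self_eq (ht : 0 < t) {z : CSpace ν} (hz : z ∈ tube ν 3) :
    Q ω ρ (m + 1) t z z = (-2) ^ m * ∫ p, kernel ω ρ t z p.1 p.2 ∂(kernelMeasure ν m) := by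
  rw [Q, Nat.add_sub_cancel]
  congr 1
  have hint : ∀ g ∈ trees (m + 1), Integrable
      (fun p : (Fin (m + 1) → ℝ) × (Fin (m + 1) → RSpace ν) =>
        (treeWeight ω t g p.1 p.2 : ℂ) *
        Complex.exp (Complex.I * phaseForm ω t p.1 p.2 z) * ∏ j, ρ (p.2 j))
      (kernelMeasure ν m) := by
    intro g hg
    refine (integrable_kernelMeasure_majorant m.factorial (hexp 5 (by norm_num))).mono' ?_ ?_
    · have h1 := continuous_treeWeight (ω := ω) (m := m + 1) t g
      have h2 := continuous_phaseForm (ω := ω) (m := m + 1) t z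
      exact (by fun_prop : Continuous _).aestronglyMeasurable
    · exact ae_kernelMeasure.mono fun p hp => norm_mul_exp_mul_prod_le hω ht hp _ hz
        (abs_treeWeight_le_exp hω ht hp hg p.2)
  have hk : ∀ p : (Fin (m + 1) → ℝ) × (Fin (m + 1) → RSpace ν), kernel ω ρ t z p.1 p.2 =
      ∑ g ∈ trees (m + 1), (treeWeight ω t g p.1 p.2 : ℂ) *
        Complex.exp (Complex.I * phaseForm ω t p.1 p.2 z) * ∏ j, ρ (p.2 j) := by
    intro p
    rw [kernel, treeSum]
    push_cast
    rw [Finset.sum_mul, Finset.sum_mul]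
  simp only [hk]
  rw [integral_finsetSum _ hint]
  refine Finset.sum_congr rfl fun g hg => ?_
  simp only [sum_path_mul_eq_phaseForm]
  exact (integral_prod _ (hint g hg)).symm

theorem hasFDerivAt_Q_self (ht : 0 < t) {z : CSpace ν} (hz : z ∈ tube ν 3) :
    HasFDerivAt (fun z => Q ω ρ (m + 1) t z z)
      (((-2 : ℂ) ^ m) • ∫ p, (kernel ω ρ t z p.1 p.2 * Complex.I) • phaseForm ω t p.1 p.2
        ∂(kernelMeasure ν m)) z := by
  have hnhds : tube ν 3 ∈ 𝓝 z := (isOpen_tube 3).mem_nhds hz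
  have h := hasFDerivAt_integral_of_dominated_of_fderiv_le (𝕜 := ℂ) (μ := kernelMeasure ν m)
    (F := fun z p => kernel ω ρ t z p.1 p.2)
    (F' := fun z p => (kernel ω ρ t z p.1 p.2 * Complex.I) • phaseForm ω t p.1 p.2) (x₀ := z)
    (bound := fun p => m.factorial * majorant ρ 6 p.2) hnhds
    (Eventually.of_forall fun w => (continuous_kernel hρ t w).aestronglyMeasurable)
    (integrable_kernel hω hρ hexp ht hz) ?_ ?_
    (integrable_kernelMeasure_majorant _ (hexp 6 (by norm_num))) ?_
  · refine ((h.const_mul ((-2 : ℂ) ^ m)).congr_of_eventuallyEq ?_)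
    filter_upwards [hnhds] with w hw
    exact Q_self_eq hω hρ hexp ht hw
  · refine Continuous.aestronglyMeasurable (Continuous.smul
      ((continuous_kernel hρ t z).mul continuous_const) ?_)
    unfold phaseForm
    refine continuous_finsetSum _ fun j _ => continuous_finsetSum _ fun υ _ => ?_
    refine Continuous.smul (Complex.continuous_ofReal.comp (Continuous.mul ?_ (by fun_prop)))
      continuous_const
    exact (continuous_pathFactor t υ).comp (by fun_prop)
  · refine ae_kernelMeasure.mono fun p hp w hw => ?_
    rw [norm_smul, norm_mul, Complex.norm_I, mul_one]
    have h1 := norm_kernel_le (ρ := ρ) hω ht hp p.2 hw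
    have h2 := norm_phaseForm_le hω ht hp p.2
    have h3 := sum_mul_majorant_le (ρ := ρ) p.2 rfl
    calc _ ≤ m.factorial * majorant ρ 5 p.2 * ∑ j, ‖p.2 j‖ :=
          mul_le_mul h1 h2 (norm_nonneg _) ((norm_nonneg _).trans h1)
      _ = m.factorial * ((∑ j, ‖p.2 j‖) * majorant ρ 5 p.2) := by ring
      _ ≤ _ := mul_le_mul_of_nonneg_left h3 (Nat.cast_nonneg _)
  · refine Eventually.of_forall fun p w _ => ?_
    have h1 := (((phaseForm ω t p.1 p.2).hasFDerivAt (x := w)).const_mul Complex.I).cexp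
    have h2 := (h1.const_mul (treeSum ω t p.1 p.2 : ℂ)).mul_const (∏ j, ρ (p.2 j))
    refine h2.congr_fderiv ?_
    ext v
    simp [kernel]
    ring

theorem continuousOn_Q_self {T : ℝ} :
    ContinuousOn (fun q : ℝ × CSpace ν => Q ω ρ (m + 1) q.1 q.2 q.2) (Ioo 0 T ×ˢ tube ν 3) := by
  have h : ContinuousOn (fun q : ℝ × CSpace ν =>
      (-2 : ℂ) ^ m * ∫ p, kernel ω ρ q.1 q.2 p.1 p.2 ∂(kernelMeasure ν m))
      (Ioo 0 T ×ˢ tube ν 3) := by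
    refine ContinuousOn.mul continuousOn_const ?_
    refine continuousOn_of_dominated (μ := kernelMeasure ν m)
      (F := fun (q : ℝ × CSpace ν) p => kernel ω ρ q.1 q.2 p.1 p.2)
      (bound := fun p => m.factorial * majorant ρ 5 p.2) ?_ ?_
      (integrable_kernelMeasure_majorant _ (hexp 5 (by norm_num))) ?_
    · exact fun q _ => (continuous_kernel hρ q.1 q.2).aestronglyMeasurable
    · rintro ⟨t, z⟩ ⟨ht, hz⟩
      exact ae_kernelMeasure.mono fun p hp => norm_kernel_le hω ht.1 hp p.2 hz
    · refine Eventually.of_forall fun p => (continuousOn_kernel hω p.1 p.2).mono ?_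
      exact prod_mono (fun x hx => hx.1) (subset_univ _)
  exact h.congr fun q hq => Q_self_eq hω hρ hexp hq.1.1 hq.2

end Kernel

/-! ### Integration by parts and the bounds on `Q_m`. -/

section Bounds

open MeasureTheory Set Filter Topology

variable {ν m : ℕ} {ω : Fin ν → ℝ} {ρ : RSpace ν → ℂ} {t : ℝ}

theorem norm_mul_exp_le_weightM' (ξ : RSpace ν) :
    Real.exp (5 * ‖ξ‖) * ‖ρ ξ‖ ≤ weightM' ρ ξ := by
  rw [weightM', mul_comm]
  exact mul_le_mul_of_nonneg_right (le_max_left _ _) (Real.exp_pos _).le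

theorem weightM'_nonneg (ξ : RSpace ν) : 0 ≤ weightM' ρ ξ :=
  le_trans (by positivity) (norm_mul_exp_le_weightM' ξ)

/-- The dominating function in which the component of the vertex `0` carries the derivative. -/
noncomputable def rootMajorant (ρ : RSpace ν → ℂ) (ξ : Fin (m + 1) → RSpace ν) : ℝ :=
  weightM' ρ (ξ 0) * ∏ j : Fin m, Real.exp (5 * ‖ξ j.succ‖) * ‖ρ (ξ j.succ)‖

theorem rootMajorant_eq (ξ : Fin (m + 1) → RSpace ν) :
    rootMajorant ρ ξ = Real.exp (5 * ∑ j, ‖ξ j‖) *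
      (max ‖ρ (ξ 0)‖ (⨆ j : Fin ν, ‖fderiv ℝ ρ (ξ 0) (EuclideanSpace.single j 1)‖) *
        ‖∏ j : Fin m, ρ (ξ j.succ)‖) := by
  rw [rootMajorant, Finset.prod_mul_distrib, Fin.sum_univ_succ, mul_add, Real.exp_add,
    Finset.mul_sum, Real.exp_sum, norm_prod, weightM']
  ring

theorem majorant_le_rootMajorant (ξ : Fin (m + 1) → RSpace ν) :
    majorant ρ 5 ξ ≤ rootMajorant ρ ξ := by
  rw [majorant, rootMajorant, Fin.prod_univ_succ]
  exact mul_le_mul_of_nonneg_right (norm_mul_exp_le_weightM' _)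
    (Finset.prod_nonneg fun _ _ => by positivity)

theorem rootMajorant_eq_prod (ξ : Fin (m + 1) → RSpace ν) :
    rootMajorant ρ ξ = ∏ j, (Fin.cons (weightM' ρ)
      (fun _ (ξ : RSpace ν) => Real.exp (5 * ‖ξ‖) * ‖ρ ξ‖) :
        Fin (m + 1) → RSpace ν → ℝ) j (ξ j) := by
  rw [Fin.prod_univ_succ]
  simp [rootMajorant]

theorem integral_rootMajorant :
    ∫ ξ : Fin (m + 1) → RSpace ν, rootMajorant ρ ξ = normM' ρ * normM ρ ^ m := by
  simp only [rootMajorant_eq_prod]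
  rw [integral_fintype_prod_volume_eq_prod (fun j => (Fin.cons (weightM' ρ)
      (fun _ (ξ : RSpace ν) => Real.exp (5 * ‖ξ‖) * ‖ρ ξ‖) :
        Fin (m + 1) → RSpace ν → ℝ) j), Fin.prod_univ_succ]
  simp [normM', normM]

theorem integrable_rootMajorant (hM' : Integrable (weightM' ρ))
    (hexp : Integrable (fun ξ : RSpace ν => Real.exp (5 * ‖ξ‖) * ‖ρ ξ‖)) :
    Integrable (rootMajorant ρ : (Fin (m + 1) → RSpace ν) → ℝ) := by
  simp only [funext rootMajorant_eq_prod]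
  refine Integrable.fintype_prod (f := (Fin.cons (weightM' ρ)
      (fun _ (ξ : RSpace ν) => Real.exp (5 * ‖ξ‖) * ‖ρ ξ‖) :
        Fin (m + 1) → RSpace ν → ℝ)) fun j => ?_
  refine Fin.cases ?_ (fun j => ?_) j
  · simpa using hM'
  · simpa using hexp

theorem norm_integral_le_rootMajorant (hM' : Integrable (weightM' ρ))
    (hexp : Integrable (fun ξ : RSpace ν => Real.exp (5 * ‖ξ‖) * ‖ρ ξ‖)) {K : ℝ}
    {F : (Fin (m + 1) → RSpace ν) → ℂ} (hF : ∀ ξ, ‖F ξ‖ ≤ K * rootMajorant ρ ξ) :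
    ‖∫ ξ, F ξ‖ ≤ K * (normM' ρ * normM ρ ^ m) := by
  rw [← integral_rootMajorant, ← integral_const_mul]
  exact norm_integral_le_of_norm_le ((integrable_rootMajorant hM' hexp).const_mul K)
    (Eventually.of_forall hF)

theorem normM_nonneg : 0 ≤ normM ρ := integral_nonneg fun _ => by positivity

theorem normM'_nonneg : 0 ≤ normM' ρ := integral_nonneg weightM'_nonneg

/-- The part of the integrand of `Q_{m+1}` that is differentiated when integrating by parts. -/
noncomputable def amplitude (ω : Fin ν → ℝ) (ρ : RSpace ν → ℂ) (t : ℝ) (s : Fin (m + 1) → ℝ)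
    (ξ : Fin (m + 1) → RSpace ν) : ℂ :=
  (treeSum ω t s ξ : ℂ) * ∏ j, ρ (ξ j)

/-- The derivative of the amplitude when `ξ_0` moves in the direction `e`. -/
noncomputable def amplitudeDeriv (ω : Fin ν → ℝ) (ρ : RSpace ν → ℂ) (t : ℝ) (s : Fin (m + 1) → ℝ)
    (e : RSpace ν) (ξ : Fin (m + 1) → RSpace ν) : ℂ :=
  ((treeSumDeriv ω t s e ξ : ℂ) * ρ (ξ 0) + treeSum ω t s ξ * fderiv ℝ ρ (ξ 0) e) *
    ∏ j : Fin m, ρ (ξ j.succ)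

theorem hasLineDerivAt_amplitude (hρ : Differentiable ℝ ρ) (s : Fin (m + 1) → ℝ) (e : RSpace ν)
    (ξ : Fin (m + 1) → RSpace ν) :
    HasLineDerivAt ℝ (amplitude ω ρ t s) (amplitudeDeriv ω ρ t s e ξ) ξ (rootDir e) := by
  have h1 : HasDerivAt (fun τ : ℝ => ((treeSum ω t s (ξ + τ • rootDir e) : ℝ) : ℂ))
      (treeSumDeriv ω t s e ξ) 0 := (hasDerivAt_treeSum s e ξ).ofReal_comp
  have h2 : HasDerivAt (fun τ : ℝ => ρ (ξ 0 + τ • e)) (fderiv ℝ ρ (ξ 0) e) 0 := by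
    simpa [HasLineDerivAt] using (hρ (ξ 0)).hasFDerivAt.hasLineDerivAt e
  have h3 := (h1.mul h2).mul_const (∏ j : Fin m, ρ (ξ j.succ))
  rw [HasLineDerivAt]
  convert! h3 using 1
  · funext τ
    rw [amplitude, Fin.prod_univ_succ]
    simp [rootDir_of_ne, mul_assoc]
  · simp [amplitudeDeriv]

theorem hasDerivAt_exp_affine (a b : ℂ) :
    HasDerivAt (fun τ : ℝ => Complex.exp (Complex.I * (a + τ * b)))
      (Complex.exp (Complex.I * a) * (Complex.I * b)) 0 := by
  have h : HasDerivAt (fun w : ℂ => Complex.exp (Complex.I * (a + w * b)))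
      (Complex.exp (Complex.I * (a + ((0 : ℝ) : ℂ) * b)) * (Complex.I * (1 * b)))
      ((0 : ℝ) : ℂ) :=
    ((((hasDerivAt_id' ((0 : ℝ) : ℂ)).mul_const b).const_add a).const_mul Complex.I).cexp
  simpa using h.comp_ofReal

theorem hasLineDerivAt_exp_phaseForm (s : Fin (m + 1) → ℝ) (ξ : Fin (m + 1) → RSpace ν)
    (z : CSpace ν) (υ : Fin ν) :
    HasLineDerivAt ℝ (fun ξ => Complex.exp (Complex.I * phaseForm ω t s ξ z))
      (Complex.exp (Complex.I * phaseForm ω t s ξ z) *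
        (Complex.I * (pathFactor ω t (s 0) υ * z υ))) ξ
      (rootDir (EuclideanSpace.single υ 1)) := by
  have h0 : ∀ τ : ℝ, phaseForm ω t s (ξ + τ • rootDir (EuclideanSpace.single υ 1)) z =
      phaseForm ω t s ξ z + τ * (pathFactor ω t (s 0) υ * z υ) := by
    intro τ
    rw [phaseForm_apply, phaseForm_apply, Fin.sum_univ_succ, Fin.sum_univ_succ]
    simp only [Pi.add_apply, Pi.smul_apply, rootDir_zero, PiLp.add_apply, PiLp.smul_apply,
      PiLp.single_apply, smul_eq_mul, rootDir_of_ne _ (Fin.succ_ne_zero _), smul_zero, add_zero]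
    have : ∀ i, ((pathFactor ω t (s 0) i * (ξ 0 i + τ * if i = υ then 1 else 0) : ℝ) : ℂ) * z i =
        ((pathFactor ω t (s 0) i * ξ 0 i : ℝ) : ℂ) * z i +
          if i = υ then τ * (pathFactor ω t (s 0) i * z i) else 0 := by
      intro i
      split_ifs <;> push_cast <;> ring
    simp only [this, Finset.sum_add_distrib, Finset.sum_ite_eq', Finset.mem_univ, if_true]
    ring
  rw [HasLineDerivAt]
  simp only [h0]
  exact hasDerivAt_exp_affine _ _

theorem continuous_amplitude (hρ : Continuous ρ) (s : Fin (m + 1) → ℝ) :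
    Continuous (amplitude ω ρ t s) := by
  have h0 : Continuous fun ξ : Fin (m + 1) → RSpace ν => (s, ξ) := by fun_prop
  have h1 := Continuous.comp (continuous_treeSum (ω := ω) (m := m) t) h0
  simp only [Function.comp_def] at h1
  unfold amplitude
  fun_prop

theorem kernel_eq (z : CSpace ν) (s : Fin (m + 1) → ℝ) (ξ : Fin (m + 1) → RSpace ν) :
    kernel ω ρ t z s ξ =
      amplitude ω ρ t s ξ * Complex.exp (Complex.I * phaseForm ω t s ξ z) := by
  rw [kernel, amplitude]; ring

/-- Differentiating the tree sum contributes `m · m!` and differentiating the density `m!`. Together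
they make `(m+1)!`, exactly what the simplex of dimension `m + 1` cancels. -/
theorem norm_amplitudeDeriv_mul_exp_le (hω : ∀ υ, 0 < ω υ) (ht : 0 < t) {s : Fin (m + 1) → ℝ}
    (hs : s ∈ openSimplex (m + 1)) {z : CSpace ν} (hz : z ∈ tube ν 3) (υ : Fin ν)
    (ξ : Fin (m + 1) → RSpace ν) :
    ‖amplitudeDeriv ω ρ t s (EuclideanSpace.single υ 1) ξ *
      Complex.exp (Complex.I * phaseForm ω t s ξ z)‖ ≤
      (m + 1).factorial * rootMajorant ρ ξ := by
  have h1 := abs_treeSumDeriv_le hω ht hs (e := EuclideanSpace.single υ 1) (by simp) ξ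
  have h2 := abs_treeSum_le hω ht hs ξ
  have h3 := norm_exp_phaseForm_le hω ht hs ξ hz
  rw [rootMajorant_eq]
  set D := max ‖ρ (ξ 0)‖ (⨆ j : Fin ν, ‖fderiv ℝ ρ (ξ 0) (EuclideanSpace.single j 1)‖)
  have hD1 : ‖ρ (ξ 0)‖ ≤ D := le_max_left _ _
  have hD2 : ‖fderiv ℝ ρ (ξ 0) (EuclideanSpace.single υ 1)‖ ≤ D :=
    (le_ciSup (f := fun j : Fin ν => ‖fderiv ℝ ρ (ξ 0) (EuclideanSpace.single j 1)‖)
      (Set.finite_range _).bddAbove υ).trans (le_max_right _ _)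
  rw [amplitudeDeriv, norm_mul, norm_mul]
  have h4 : ‖(treeSumDeriv ω t s (EuclideanSpace.single υ 1) ξ : ℂ) * ρ (ξ 0) +
      treeSum ω t s ξ * fderiv ℝ ρ (ξ 0) (EuclideanSpace.single υ 1)‖ ≤
      m * (m.factorial * Real.exp (2 * ∑ j, ‖ξ j‖)) * D +
        m.factorial * Real.exp (2 * ∑ j, ‖ξ j‖) * D := by
    refine (norm_add_le _ _).trans ?_
    rw [norm_mul, norm_mul, Complex.norm_real, Complex.norm_real, Real.norm_eq_abs,
      Real.norm_eq_abs]
    gcongr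
  calc _ ≤ (m * (m.factorial * Real.exp (2 * ∑ j, ‖ξ j‖)) * D +
        m.factorial * Real.exp (2 * ∑ j, ‖ξ j‖) * D) * ‖∏ j : Fin m, ρ (ξ j.succ)‖ *
        Real.exp (3 * ∑ j, ‖ξ j‖) := by gcongr
    _ = _ := by
      rw [show 5 * ∑ j, ‖ξ j‖ = 2 * ∑ j, ‖ξ j‖ + 3 * ∑ j, ‖ξ j‖ by ring, Real.exp_add,
        Nat.factorial_succ]
      push_cast
      ring

section Estimates

variable (hω : ∀ υ, 0 < ω υ) (hρ : Differentiable ℝ ρ)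
  (hexp : ∀ R : ℝ, 0 < R → Integrable (fun ξ : RSpace ν => Real.exp (R * ‖ξ‖) * ‖ρ ξ‖))

include hω hρ hexp

theorem integrable_kernel_right (ht : 0 < t) {s : Fin (m + 1) → ℝ}
    (hs : s ∈ openSimplex (m + 1)) {z : CSpace ν} (hz : z ∈ tube ν 3) :
    Integrable fun ξ => kernel ω ρ t z s ξ := by
  have h0 : Continuous fun ξ : Fin (m + 1) → RSpace ν => (s, ξ) := by fun_prop
  have h1 := Continuous.comp (continuous_kernel (ω := ω) (m := m) hρ.continuous t z) h0
  simp only [Function.comp_def] at h1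
  exact ((integrable_majorant (hexp 5 (by norm_num))).const_mul (m.factorial : ℝ)).mono'
    h1.aestronglyMeasurable (Eventually.of_forall fun ξ => norm_kernel_le hω ht hs ξ hz)

theorem Q_self_eq_setIntegral (ht : 0 < t) {z : CSpace ν} (hz : z ∈ tube ν 3) :
    Q ω ρ (m + 1) t z z =
      (-2) ^ m * ∫ s in openSimplex (m + 1), ∫ ξ, kernel ω ρ t z s ξ := by
  rw [Q_self_eq hω hρ.continuous hexp ht hz]
  congr 1
  exact integral_prod _ (integrable_kernel hω hρ.continuous hexp ht hz)

/-- Moving `ξ 0` along `e_υ` multiplies the exponential by a constant proportional to `z υ`.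
Integrating by parts shifts this derivative to the amplitude, and only the density at the root is
differentiated. -/
theorem coord_mul_integral_kernel (hM' : Integrable (weightM' ρ)) (ht : 0 < t)
    {s : Fin (m + 1) → ℝ} (hs : s ∈ openSimplex (m + 1)) {z : CSpace ν} (hz : z ∈ tube ν 3)
    (υ : Fin ν) :
    (∫ ξ, kernel ω ρ t z s ξ) * (Complex.I * (pathFactor ω t (s 0) υ * z υ)) =
      -∫ ξ, amplitudeDeriv ω ρ t s (EuclideanSpace.single υ 1) ξ *
        Complex.exp (Complex.I * phaseForm ω t s ξ z) := by
  have hk := integrable_kernel_right hω hρ hexp ht hs hz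
  simp only [kernel_eq] at hk ⊢
  have hcont : Continuous fun ξ => Complex.exp (Complex.I * phaseForm ω t s ξ z) := by
    have := (continuous_phaseForm (ω := ω) (m := m + 1) t z).comp
      (by fun_prop : Continuous fun ξ => (s, ξ))
    simp only [Function.comp_def] at this
    fun_prop
  have h := integral_bilinear_hasLineDerivAt_right_eq_neg_left_of_integrable
    (μ := (volume : Measure (Fin (m + 1) → RSpace ν))) (B := ContinuousLinearMap.mul ℝ ℂ)
    (f := amplitude ω ρ t s)
    (f' := amplitudeDeriv ω ρ t s (EuclideanSpace.single υ 1))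
    (g := fun ξ => Complex.exp (Complex.I * phaseForm ω t s ξ z))
    (g' := fun ξ => Complex.exp (Complex.I * phaseForm ω t s ξ z) *
        (Complex.I * (pathFactor ω t (s 0) υ * z υ)))
    (v := rootDir (EuclideanSpace.single υ 1)) ?_ ?_ hk
    (fun ξ _ => hasLineDerivAt_amplitude hρ s _ ξ)
    (fun ξ _ => hasLineDerivAt_exp_phaseForm s ξ z υ)
  · simp only [ContinuousLinearMap.mul_apply'] at h
    rw [← h, ← integral_mul_const]
    simp only [mul_assoc]
  · have hmeas : AEStronglyMeasurable (amplitudeDeriv ω ρ t s (EuclideanSpace.single υ 1)) := by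
      have h1 := measurable_lineDeriv (𝕜 := ℝ) (v := rootDir (EuclideanSpace.single υ 1))
        (continuous_amplitude (ω := ω) (t := t) hρ.continuous s)
      have h2 : (fun ξ => lineDeriv ℝ (amplitude ω ρ t s) ξ
          (rootDir (EuclideanSpace.single υ 1))) =
          amplitudeDeriv ω ρ t s (EuclideanSpace.single υ 1) :=
        funext fun ξ => (hasLineDerivAt_amplitude hρ s _ ξ).lineDeriv
      rw [h2] at h1
      exact h1.aestronglyMeasurable
    exact ((integrable_rootMajorant hM' (hexp 5 (by norm_num))).const_mul
      ((m + 1).factorial : ℝ)).mono' (hmeas.mul hcont.aestronglyMeasurable)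
      (Eventually.of_forall fun ξ => norm_amplitudeDeriv_mul_exp_le hω ht hs hz υ ξ)
  · have := hk.mul_const (Complex.I * (pathFactor ω t (s 0) υ * z υ))
    simpa only [ContinuousLinearMap.mul_apply', mul_assoc] using this

/-- The factorial of the tree sum is cancelled by the simplex. One factor `M_μ` is weakened to
`M'_μ` so that this bound and the one weighted by a coordinate have the same form. -/
theorem norm_Q_self_le (hM' : Integrable (weightM' ρ)) (ht : 0 < t) {z : CSpace ν}
    (hz : z ∈ tube ν 3) :
    ‖Q ω ρ (m + 1) t z z‖ ≤ 2 ^ m * (normM' ρ * normM ρ ^ m) := by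
  have h0 : 0 ≤ normM' ρ * normM ρ ^ m := mul_nonneg normM'_nonneg (pow_nonneg normM_nonneg m)
  rw [Q_self_eq_setIntegral hω hρ hexp ht hz, norm_mul, norm_pow, norm_neg, Complex.norm_ofNat]
  refine mul_le_mul_of_nonneg_left ?_ (by positivity)
  have hf : (0 : ℝ) < (m + 1).factorial := by exact_mod_cast (m + 1).factorial_pos
  have hle : (m.factorial : ℝ) ≤ (m + 1).factorial := by
    exact_mod_cast Nat.factorial_le (Nat.le_succ m)
  refine (norm_setIntegral_openSimplex_le (C := (m + 1).factorial * (normM' ρ * normM ρ ^ m))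
    (fun s hs => ?_) (by positivity)).trans_eq (by field_simp)
  refine norm_integral_le_rootMajorant hM' (hexp 5 (by norm_num)) fun ξ => ?_
  refine (norm_kernel_le hω ht hs ξ hz).trans ?_
  exact mul_le_mul hle (majorant_le_rootMajorant ξ) (majorant_nonneg _ _) hf.le

theorem norm_coord_mul_Q_self_le (hM' : Integrable (weightM' ρ)) (ht : 0 < t) {z : CSpace ν}
    (hz : z ∈ tube ν 3) (υ : Fin ν) {c : ℝ} (hc : Real.cosh (ω υ * t / 2) ≤ c) :
    ‖z υ‖ * ‖Q ω ρ (m + 1) t z z‖ ≤ 2 ^ m * (c * (normM' ρ * normM ρ ^ m)) := by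
  have h0 : 0 ≤ normM' ρ * normM ρ ^ m := mul_nonneg normM'_nonneg (pow_nonneg normM_nonneg m)
  have hc0 : 0 ≤ c := (Real.cosh_pos _).le.trans hc
  have hωt := mul_pos (hω υ) ht
  rw [← norm_mul, Q_self_eq_setIntegral hω hρ hexp ht hz, mul_left_comm, norm_mul, norm_pow,
    norm_neg, Complex.norm_ofNat, ← integral_const_mul]
  refine mul_le_mul_of_nonneg_left ?_ (by positivity)
  have hf : (0 : ℝ) < (m + 1).factorial := by exact_mod_cast (m + 1).factorial_pos
  refine (norm_setIntegral_openSimplex_le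
    (C := (m + 1).factorial * (c * (normM' ρ * normM ρ ^ m)))
    (fun s hs => ?_) (by positivity)).trans_eq (by field_simp)
  have h1 := norm_integral_le_rootMajorant hM' (hexp 5 (by norm_num)) fun ξ =>
    norm_amplitudeDeriv_mul_exp_le hω ht hs hz υ ξ
  rw [← norm_neg, ← coord_mul_integral_kernel hω hρ hexp hM' ht hs hz υ, norm_mul, norm_mul,
    norm_mul, Complex.norm_I, one_mul, Complex.norm_real, Real.norm_eq_abs,
    abs_of_pos (pathFactor_pos hωt)] at h1
  rw [norm_mul]
  have h2 := one_le_cosh_mul_pathFactor (s := s 0) hωt hc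
  calc _ ≤ (c * pathFactor ω t (s 0) υ) * (‖z υ‖ * ‖∫ ξ, kernel ω ρ t z s ξ‖) :=
        le_mul_of_one_le_left (by positivity) h2
    _ = c * (‖∫ ξ, kernel ω ρ t z s ξ‖ * (pathFactor ω t (s 0) υ * ‖z υ‖)) := by ring
    _ ≤ c * ((m + 1).factorial * (normM' ρ * normM ρ ^ m)) := by gcongr
    _ = _ := by ring

end Estimates

end Bounds

/-! ### Vanishing of the value and of the gradient at the origin. -/

section Vanishing

open MeasureTheory Set Filter Topology

variable {ν m : ℕ} {ω : Fin ν → ℝ} {ρ : RSpace ν → ℂ} {t : ℝ}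

/-- Fubini with the variable `k` integrated first; a non-integrable `H` has integral zero by
convention. -/
theorem integral_eq_zero_of_update {X : Type*} [MeasureSpace X] [SigmaFinite (volume : Measure X)]
    {H : (Fin (m + 1) → X) → ℂ} (k : Fin (m + 1))
    (h : ∀ ξ, ∫ x, H (Function.update ξ k x) = 0) : ∫ ξ, H ξ = 0 := by
  by_cases hH : Integrable H
  · have hmp := (volume_preserving_piFinSuccAbove (fun _ : Fin (m + 1) => X) k).symm
    have hH' := (hmp.integrable_comp_emb (MeasurableEquiv.measurableEmbedding _)).2 hH
    rw [← hmp.integral_comp']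
    rw [Measure.volume_eq_prod] at hH'
    rw [Measure.volume_eq_prod, integral_prod_symm (fun p => H _) hH']
    refine integral_eq_zero_of_ae (Eventually.of_forall fun y => ?_)
    by_cases hX : Nonempty X
    · obtain ⟨x₀⟩ := hX
      have h1 := h (k.insertNth (α := fun _ => X) x₀ y)
      simp only [Fin.update_insertNth] at h1
      exact h1
    · rw [not_nonempty_iff] at hX
      exact integral_of_isEmpty
  · exact integral_undef hH

theorem edgeTerm_left (s : Fin m → ℝ) (p : Fin m × Fin m) (y : RSpace ν) :
    ∃ c : Fin ν → ℝ, ∀ x, edgeTerm ω t s p x y = ∑ υ, c υ * x υ :=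
  ⟨fun υ => Real.sinh (ω υ * t * s p.1) * Real.sinh (ω υ * t * (1 - s p.2)) /
      (ω υ * t * Real.sinh (ω υ * t)) * y υ, fun x => Finset.sum_congr rfl fun υ _ => by ring⟩

theorem edgeTerm_right (s : Fin m → ℝ) (p : Fin m × Fin m) (y : RSpace ν) :
    ∃ c : Fin ν → ℝ, ∀ x, edgeTerm ω t s p y x = ∑ υ, c υ * x υ :=
  ⟨fun υ => Real.sinh (ω υ * t * s p.1) * Real.sinh (ω υ * t * (1 - s p.2)) /
      (ω υ * t * Real.sinh (ω υ * t)) * y υ, fun x => Finset.sum_congr rfl fun υ _ => by ring⟩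

/-- The tree weight is linear in the momentum at a leaf. -/
theorem treeWeight_update_leaf {g : SimpleGraph (Fin m)} {k l : Fin m} (hkl : g.Adj k l)
    (hleaf : ∀ l', g.Adj k l' → l' = l) (s : Fin m → ℝ) (ξ : Fin m → RSpace ν) :
    ∃ c : Fin ν → ℝ, ∀ x, treeWeight ω t g s (Function.update ξ k x) = ∑ υ, c υ * x υ := by
  classical
  -- If `e` is the only edge meeting the leaf, all other factors are constant in its momentum. The
  -- two cases below differ only in which endpoint of `e` is the leaf.
  have key : ∀ e ∈ edges g, (∀ q ∈ (edges g).erase e, q.1 ≠ k ∧ q.2 ≠ k) →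
      (∃ c : Fin ν → ℝ, ∀ x, edgeTerm ω t s e (Function.update ξ k x e.1)
        (Function.update ξ k x e.2) = ∑ υ, c υ * x υ) →
      ∃ c : Fin ν → ℝ, ∀ x, treeWeight ω t g s (Function.update ξ k x) = ∑ υ, c υ * x υ := by
    rintro e he hq ⟨c, hc⟩
    refine ⟨fun υ => c υ * ∏ q ∈ (edges g).erase e, edgeTerm ω t s q (ξ q.1) (ξ q.2),
      fun x => ?_⟩
    rw [treeWeight_eq, ← Finset.mul_prod_erase _ _ he, hc, Finset.sum_mul]
    have : ∏ q ∈ (edges g).erase e, edgeTerm ω t s q (Function.update ξ k x q.1)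
        (Function.update ξ k x q.2) =
        ∏ q ∈ (edges g).erase e, edgeTerm ω t s q (ξ q.1) (ξ q.2) :=
      Finset.prod_congr rfl fun q hq' => by
        rw [Function.update_of_ne (hq q hq').1, Function.update_of_ne (hq q hq').2]
    rw [this]
    exact Finset.sum_congr rfl fun υ _ => by ring
  have hne : k ≠ l := hkl.ne
  rcases lt_or_gt_of_ne hne with hlt | hlt
  · refine key (k, l) (mem_edges.2 ⟨hlt, hkl⟩) ?_ ?_
    · rintro ⟨a, b⟩ hq
      obtain ⟨hq1, hq2⟩ := Finset.mem_erase.1 hq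
      obtain ⟨hab, hadj⟩ := mem_edges.1 hq2
      change a < b at hab
      change g.Adj a b at hadj
      change a ≠ k ∧ b ≠ k
      refine ⟨?_, ?_⟩
      · rintro rfl
        exact hq1 (by rw [hleaf _ hadj])
      · rintro rfl
        have := hleaf _ hadj.symm
        omega
    · obtain ⟨c, hc⟩ := edgeTerm_left (ω := ω) (t := t) s (k, l) (ξ l)
      exact ⟨c, fun x => by simpa [Function.update_of_ne hne.symm] using hc x⟩
  · refine key (l, k) (mem_edges.2 ⟨hlt, hkl.symm⟩) ?_ ?_
    · rintro ⟨a, b⟩ hq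
      obtain ⟨hq1, hq2⟩ := Finset.mem_erase.1 hq
      obtain ⟨hab, hadj⟩ := mem_edges.1 hq2
      change a < b at hab
      change g.Adj a b at hadj
      change a ≠ k ∧ b ≠ k
      refine ⟨?_, ?_⟩
      · rintro rfl
        have := hleaf _ hadj
        omega
      · rintro rfl
        exact hq1 (by rw [hleaf _ hadj.symm])
    · obtain ⟨c, hc⟩ := edgeTerm_right (ω := ω) (t := t) s (l, k) (ξ l)
      exact ⟨c, fun x => by simpa [Function.update_of_ne hne.symm] using hc x⟩

theorem prod_update_apply (ξ : Fin m → RSpace ν) (k : Fin m) (x : RSpace ν) :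
    ∏ i, ρ (Function.update ξ k x i) = ρ x * ∏ i ∈ Finset.univ.erase k, ρ (ξ i) := by
  classical
  rw [← Finset.mul_prod_erase _ _ (Finset.mem_univ k), Function.update_self]
  congr 1
  exact Finset.prod_congr rfl fun i hi => by
    rw [Function.update_of_ne (Finset.ne_of_mem_erase hi)]

theorem integrable_coord_mul (hρ : Continuous ρ)
    (hexp : Integrable (fun ξ : RSpace ν => Real.exp (5 * ‖ξ‖) * ‖ρ ξ‖)) (υ : Fin ν) :
    Integrable fun ξ : RSpace ν => (ξ υ : ℂ) * ρ ξ := by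
  refine hexp.mono' (by fun_prop) (Eventually.of_forall fun ξ => ?_)
  rw [norm_mul, Complex.norm_real]
  refine mul_le_mul_of_nonneg_right ?_ (norm_nonneg _)
  have h1 := PiLp.norm_apply_le ξ υ
  have h2 := Real.add_one_le_exp (5 * ‖ξ‖)
  linarith [norm_nonneg ξ]

/-- A tree with at least two vertices has a leaf `k ≠ j`; the integrand is linear in `ξ k`, so the
first moments of `ρ` annihilate it. For a single vertex the hypothesis on `p` is what is needed.
Taking `p = 1` gives the value at the origin, and a coordinate gives the gradient. -/
theorem integral_treeWeight_mul_eq_zero (hρ : Continuous ρ)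
    (hexp : Integrable (fun ξ : RSpace ν => Real.exp (5 * ‖ξ‖) * ‖ρ ξ‖))
    (hgrad : ∀ υ : Fin ν, ∫ ξ : RSpace ν, (ξ υ : ℂ) * ρ ξ = 0)
    {g : SimpleGraph (Fin (m + 1))} (hg : g.IsTree) (s : Fin (m + 1) → ℝ) (j : Fin (m + 1))
    {p : RSpace ν → ℂ} (hp : ∫ x, p x * ρ x = 0) :
    ∫ ξ, (treeWeight ω t g s ξ : ℂ) * p (ξ j) * ∏ i, ρ (ξ i) = 0 := by
  classical
  cases m with
  | zero =>
    have he : edges g = ∅ := by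
      rw [← Finset.card_eq_zero, card_edges_of_isTree hg]
    refine integral_eq_zero_of_update j fun ξ => ?_
    simp only [treeWeight_eq, he, Finset.prod_empty, Function.update_self, prod_update_apply]
    simp only [← mul_assoc, integral_mul_const, Complex.ofReal_one, one_mul, hp, zero_mul]
  | succ m =>
    obtain ⟨k, hkj, l, hkl, hleaf⟩ := exists_leaf_ne hg j
    refine integral_eq_zero_of_update k fun ξ => ?_
    obtain ⟨c, hc⟩ := treeWeight_update_leaf (ω := ω) (t := t) hkl hleaf s ξ
    simp only [hc, Function.update_of_ne hkj.symm, prod_update_apply]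
    have : ∀ x : RSpace ν, ((∑ υ, c υ * x υ : ℝ) : ℂ) * p (ξ j) *
        (ρ x * ∏ i ∈ Finset.univ.erase k, ρ (ξ i)) =
        (∑ υ, (c υ : ℂ) * ((x υ : ℂ) * ρ x)) *
          (p (ξ j) * ∏ i ∈ Finset.univ.erase k, ρ (ξ i)) := by
      intro x
      simp only [← mul_assoc, ← Finset.sum_mul]
      push_cast
      ring
    simp only [this]
    rw [integral_mul_const, integral_finsetSum _ fun υ _ =>
      (integrable_coord_mul hρ hexp υ).const_mul _]
    simp [integral_const_mul, hgrad]

theorem kernel_zero (s : Fin (m + 1) → ℝ) (ξ : Fin (m + 1) → RSpace ν) :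
    kernel ω ρ t 0 s ξ = ∑ g ∈ trees (m + 1), (treeWeight ω t g s ξ : ℂ) * ∏ i, ρ (ξ i) := by
  rw [kernel, treeSum, map_zero, mul_zero, Complex.exp_zero, mul_one, ← Finset.sum_mul]
  push_cast
  rfl

variable (hω : ∀ υ, 0 < ω υ) (hρ : Continuous ρ)
  (hexp : ∀ R : ℝ, 0 < R → Integrable (fun ξ : RSpace ν => Real.exp (R * ‖ξ‖) * ‖ρ ξ‖))
  (hgrad : ∀ υ : Fin ν, ∫ ξ : RSpace ν, (ξ υ : ℂ) * ρ ξ = 0)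

include hω hρ hexp in
theorem integrable_treeWeight_coord (ht : 0 < t) {s : Fin (m + 1) → ℝ}
    (hs : s ∈ openSimplex (m + 1)) {g : SimpleGraph (Fin (m + 1))} (hg : g ∈ trees (m + 1))
    (j : Fin (m + 1)) (υ : Fin ν) :
    Integrable fun ξ : Fin (m + 1) → RSpace ν =>
      (treeWeight ω t g s ξ : ℂ) * (ξ j υ : ℂ) * ∏ i, ρ (ξ i) := by
  have h0 : Continuous fun ξ : Fin (m + 1) → RSpace ν => (s, ξ) := by fun_prop
  have h1 := Continuous.comp (continuous_treeWeight (ω := ω) t g) h0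
  simp only [Function.comp_def] at h1
  refine ((integrable_majorant (hexp 3 (by norm_num))).const_mul (m.factorial : ℝ)).mono'
    (Continuous.aestronglyMeasurable (by fun_prop)) (Eventually.of_forall fun ξ => ?_)
  have h2 := abs_treeWeight_le_exp hω ht hs hg ξ
  have h3 : |ξ j υ| ≤ Real.exp (∑ j, ‖ξ j‖) := by
    have h4 : ‖ξ j‖ ≤ ∑ j, ‖ξ j‖ :=
      Finset.single_le_sum (f := fun j => ‖ξ j‖) (fun _ _ => norm_nonneg _) (Finset.mem_univ j)
    have h5 := PiLp.norm_apply_le (ξ j) υ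
    rw [Real.norm_eq_abs] at h5
    linarith [Real.add_one_le_exp (∑ j, ‖ξ j‖)]
  rw [norm_mul, norm_mul, Complex.norm_real, Complex.norm_real, Real.norm_eq_abs,
    Real.norm_eq_abs, majorant_eq]
  calc _ ≤ m.factorial * Real.exp (2 * ∑ j, ‖ξ j‖) * Real.exp (∑ j, ‖ξ j‖) *
        ‖∏ i, ρ (ξ i)‖ := by gcongr
    _ = _ := by
      rw [show 3 * ∑ j, ‖ξ j‖ = 2 * ∑ j, ‖ξ j‖ + ∑ j, ‖ξ j‖ by ring, Real.exp_add]
      ring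

include hρ hexp hgrad in
theorem Q_zero_zero (hzero : ∫ ξ : RSpace ν, ρ ξ = 0) : Q ω ρ (m + 1) t 0 0 = 0 := by
  rw [Q, Finset.sum_eq_zero, mul_zero]
  intro g hg
  refine integral_eq_zero_of_ae (Eventually.of_forall fun s => ?_)
  have h := integral_treeWeight_mul_eq_zero (ω := ω) (t := t) hρ (hexp 5 (by norm_num)) hgrad
    (mem_trees.1 hg) s 0 (p := fun _ => 1) (by simpa using hzero)
  simpa [sum_path_mul_eq_phaseForm] using h

include hω hρ hexp hgrad in
theorem integral_kernel_zero_mul_phaseForm (ht : 0 < t) {s : Fin (m + 1) → ℝ}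
    (hs : s ∈ openSimplex (m + 1)) (v : CSpace ν) :
    ∫ ξ, kernel ω ρ t 0 s ξ * phaseForm ω t s ξ v = 0 := by
  have h : ∀ ξ : Fin (m + 1) → RSpace ν, kernel ω ρ t 0 s ξ * phaseForm ω t s ξ v =
      ∑ g ∈ trees (m + 1), ∑ j, ∑ υ, ((treeWeight ω t g s ξ : ℂ) * (ξ j υ : ℂ) *
        ∏ i, ρ (ξ i)) * (pathFactor ω t (s j) υ * v υ) := by
    intro ξ
    rw [kernel_zero, phaseForm_apply, Finset.sum_mul]
    refine Finset.sum_congr rfl fun g _ => ?_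
    rw [Finset.mul_sum]
    refine Finset.sum_congr rfl fun j _ => ?_
    rw [Finset.mul_sum]
    refine Finset.sum_congr rfl fun υ _ => ?_
    push_cast
    ring
  have hint := fun g hg j υ =>
    (integrable_treeWeight_coord (g := g) hω hρ hexp ht hs hg j υ).mul_const
      (pathFactor ω t (s j) υ * v υ : ℂ)
  simp only [h]
  rw [integral_finsetSum _ fun g hg => integrable_finsetSum _ fun j _ =>
    integrable_finsetSum _ fun υ _ => hint g hg j υ]
  refine Finset.sum_eq_zero fun g hg => ?_
  rw [integral_finsetSum _ fun j _ => integrable_finsetSum _ fun υ _ => hint g hg j υ]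
  refine Finset.sum_eq_zero fun j _ => ?_
  rw [integral_finsetSum _ fun υ _ => hint g hg j υ]
  refine Finset.sum_eq_zero fun υ _ => ?_
  rw [integral_mul_const, integral_treeWeight_mul_eq_zero hρ (hexp 5 (by norm_num)) hgrad
    (mem_trees.1 hg) s j (p := fun x => (x υ : ℂ)) (hgrad υ), zero_mul]

include hω hρ hexp hgrad in
theorem hasFDerivAt_Q_self_zero (ht : 0 < t) :
    HasFDerivAt (fun z => Q ω ρ (m + 1) t z z) (0 : CSpace ν →L[ℂ] ℂ) 0 := by
  have hz : (0 : CSpace ν) ∈ tube ν 3 := mem_tube_of_im_eq_zero (by norm_num) (by simp)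
  refine (hasFDerivAt_Q_self hω hρ hexp ht hz).congr_fderiv ?_
  by_cases hI : Integrable (fun p : (Fin (m + 1) → ℝ) × (Fin (m + 1) → RSpace ν) =>
    (kernel ω ρ t 0 p.1 p.2 * Complex.I) • phaseForm ω t p.1 p.2) (kernelMeasure ν m)
  · ext1 v
    rw [smul_apply, ContinuousLinearMap.integral_apply hI, kernelMeasure,
      integral_prod _ (hI.apply_continuousLinearMap v), setIntegral_eq_zero_of_forall_eq_zero,
      smul_zero, zero_apply]
    intro s hs
    have h : ∀ ξ, ((kernel ω ρ t 0 s ξ * Complex.I) • phaseForm ω t s ξ) v =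
        (kernel ω ρ t 0 s ξ * phaseForm ω t s ξ v) * Complex.I := by
      intro ξ
      rw [smul_apply, smul_eq_mul]
      ring
    simp only [h]
    rw [integral_mul_const, integral_kernel_zero_mul_phaseForm hω hρ hexp hgrad ht hs, zero_mul]
  -- A non-integrable integrand has integral zero by default, which is the required derivative.
  · rw [integral_undef hI]
    ext v
    simp

end Vanishing

/-! ### Reality on real vectors. -/

section Reality

open MeasureTheory Set

variable {ν m : ℕ} {ω : Fin ν → ℝ} {ρ : RSpace ν → ℂ} {t : ℝ}

theorem treeSum_neg (s : Fin (m + 1) → ℝ) (ξ : Fin (m + 1) → RSpace ν) :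
    treeSum ω t s (-ξ) = treeSum ω t s ξ := by
  refine Finset.sum_congr rfl fun g _ => Finset.prod_congr rfl fun p _ =>
    Finset.sum_congr rfl fun υ _ => ?_
  simp

theorem conj_kernel (hreal : ∀ ξ, (starRingEnd ℂ) (ρ ξ) = ρ (-ξ)) {z : CSpace ν}
    (hz : z ∈ realVectors ν) (s : Fin (m + 1) → ℝ) (ξ : Fin (m + 1) → RSpace ν) :
    (starRingEnd ℂ) (kernel ω ρ t z s ξ) = kernel ω ρ t z s (-ξ) := by
  have h : (starRingEnd ℂ) (Complex.I * phaseForm ω t s ξ z) =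
      Complex.I * phaseForm ω t s (-ξ) z := by
    rw [phaseForm_apply, phaseForm_apply]
    simp only [map_mul, map_sum, Complex.conj_I, Complex.conj_ofReal,
      fun υ => Complex.conj_eq_iff_im.2 (mem_realVectors.1 hz υ)]
    simp
  rw [kernel, kernel, treeSum_neg, map_mul, map_mul, map_prod, Complex.conj_ofReal,
    ← Complex.exp_conj, h]
  simp only [hreal, Pi.neg_apply]

/-- Conjugation amounts to `ξ ↦ -ξ`: tree weights are even because every edge factor is bilinear,
the density is Hermitian, and Lebesgue measure is invariant under reflection. -/
theorem im_Q_self_eq_zero (hω : ∀ υ, 0 < ω υ) (hρ : Differentiable ℝ ρ)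
    (hexp : ∀ R : ℝ, 0 < R → Integrable (fun ξ : RSpace ν => Real.exp (R * ‖ξ‖) * ‖ρ ξ‖))
    (hreal : ∀ ξ, (starRingEnd ℂ) (ρ ξ) = ρ (-ξ)) (ht : 0 < t) {z : CSpace ν}
    (hz : z ∈ realVectors ν) : (Q ω ρ (m + 1) t z z).im = 0 := by
  have hz3 : z ∈ tube ν 3 := mem_tube_of_im_eq_zero (by norm_num) (mem_realVectors.1 hz)
  have : (volume : Measure (Fin (m + 1) → RSpace ν)).IsNegInvariant := by
    have : (volume : Measure (RSpace ν)).IsNegInvariant := inferInstance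
    infer_instance
  rw [← Complex.conj_eq_iff_im, Q_self_eq_setIntegral hω hρ hexp ht hz3, map_mul, map_pow,
    ← integral_conj]
  simp only [← integral_conj, conj_kernel hreal hz, map_neg, Complex.conj_ofNat]
  congr 2
  funext s
  exact integral_neg_eq_self (fun ξ => kernel ω ρ t z s ξ) volume

end Reality

/-! ### Summation of the series for `φ`. -/

section Series

open MeasureTheory Set Filter Topology Metric

/-- A dominated series of holomorphic functions may be differentiated termwise. -/
theorem hasFDerivAt_tsum_of_differentiableOn {E : Type*} [NormedAddCommGroup E] [NormedSpace ℂ E]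
    {V : Set E} {f : ℕ → E → ℂ} {u : ℕ → ℝ} (hV : IsOpen V)
    (hd : ∀ m, DifferentiableOn ℂ (f m) V) (hb : ∀ m, ∀ z ∈ V, ‖f m z‖ ≤ u m)
    (hu : Summable u) {z : E} (hz : z ∈ V) :
    HasFDerivAt (fun y => ∑' m, f m y) (∑' m, fderiv ℂ (f m) z) z := by
  -- The real structure is needed only for the convexity, hence connectedness, of balls.
  let _ : NormedSpace ℝ E := NormedSpace.restrictScalars ℝ ℂ E
  obtain ⟨ε, hε, hball⟩ := Metric.isOpen_iff.1 hV z hz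
  have hsub : ∀ x ∈ ball z (ε / 2), closedBall x (ε / 4) ⊆ V := by
    intro x hx y hy
    refine hball ?_
    rw [mem_ball] at *
    rw [mem_closedBall] at hy
    linarith [dist_triangle y x z]
  have hat : ∀ m, ∀ w ∈ V, DifferentiableAt ℂ (f m) w := fun m w hw =>
    (hd m).differentiableAt (hV.mem_nhds hw)
  have hz' : z ∈ ball z (ε / 2) := mem_ball_self (by positivity)
  refine hasFDerivAt_tsum_of_isPreconnected (u := fun m => u m / (ε / 4)) (hu.div_const _)
    isOpen_ball (convex_ball z (ε / 2)).isPreconnected (fun m x hx => ?_) (fun m x hx => ?_) hz'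
    (Summable.of_norm_bounded hu fun m => hb m z hz) hz'
  · exact (hat m x (hsub x hx (mem_closedBall_self (by positivity)))).hasFDerivAt
  · exact norm_fderiv_le_of_closedBall (by positivity) (fun w hw => hat m w (hsub x hx hw))
      fun w hw => hb m w (hsub x hx hw)

variable {ν : ℕ} {ω : Fin ν → ℝ} {ρ : RSpace ν → ℂ} {t T : ℝ}

/-- Since `2t² ≤ 4T²`, the terms are dominated by a geometric series whose ratio does not depend on
`t`. -/
theorem two_pow_mul_le (ht : t ∈ Ioo 0 T) (m : ℕ) {a : ℝ} (ha : 0 ≤ a) :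
    t ^ (2 * m) * (2 ^ m * (a * normM ρ ^ m)) ≤ a * (4 * T ^ 2 * normM ρ) ^ m := by
  have hM := normM_nonneg (ρ := ρ)
  have h1 : t ^ 2 * 2 * normM ρ ≤ 4 * T ^ 2 * normM ρ := by
    have : t ^ 2 ≤ T ^ 2 := pow_le_pow_left₀ ht.1.le ht.2.le 2
    have : t ^ 2 * 2 ≤ 4 * T ^ 2 := by nlinarith [sq_nonneg T]
    gcongr
  calc _ = a * (t ^ 2 * 2 * normM ρ) ^ m := by rw [pow_mul, mul_pow, mul_pow]; ring
    _ ≤ _ := by gcongr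

/-- The bound `M'_μ / (1 - 4 T² M_μ)` for `φ`. -/
noncomputable def varphiBound (ρ : RSpace ν → ℂ) (T : ℝ) : ℝ :=
  normM' ρ / (1 - 4 * T ^ 2 * normM ρ)

variable (hω : ∀ υ, 0 < ω υ) (hρ : Differentiable ℝ ρ)
  (hexp : ∀ R : ℝ, 0 < R → Integrable (fun ξ : RSpace ν => Real.exp (R * ‖ξ‖) * ‖ρ ξ‖))
  (hM' : Integrable (weightM' ρ)) (hTM : 4 * T ^ 2 * normM ρ < 1)

theorem hasSum_geometric_varphiBound (hTM : 4 * T ^ 2 * normM ρ < 1) (a : ℝ) :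
    HasSum (fun m : ℕ => a * normM' ρ * (4 * T ^ 2 * normM ρ) ^ m) (a * varphiBound ρ T) := by
  have hM := normM_nonneg (ρ := ρ)
  have := (hasSum_geometric_of_lt_one (by positivity) hTM).mul_left (a * normM' ρ)
  rwa [← div_eq_mul_inv, mul_div_assoc] at this

include hω hρ hexp hM'

theorem norm_varphiTerm_le (ht : t ∈ Ioo 0 T) {z : CSpace ν} (hz : z ∈ tube ν 3) (m : ℕ) :
    ‖varphiTerm ω ρ t z z m‖ ≤ 1 * normM' ρ * (4 * T ^ 2 * normM ρ) ^ m := by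
  rw [varphiTerm, norm_mul, norm_pow, Complex.norm_real, Real.norm_eq_abs, abs_of_pos ht.1, one_mul]
  exact (mul_le_mul_of_nonneg_left (norm_Q_self_le hω hρ hexp hM' ht.1 hz)
    (pow_nonneg ht.1.le _)).trans (two_pow_mul_le ht m normM'_nonneg)

theorem norm_coord_mul_varphiTerm_le (ht : t ∈ Ioo 0 T) {z : CSpace ν} (hz : z ∈ tube ν 3)
    (υ : Fin ν) {c : ℝ} (hc : Real.cosh (ω υ * t / 2) ≤ c) (m : ℕ) :
    ‖z υ * varphiTerm ω ρ t z z m‖ ≤ c * normM' ρ * (4 * T ^ 2 * normM ρ) ^ m := by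
  have hc0 : 0 ≤ c := (Real.cosh_pos _).le.trans hc
  rw [varphiTerm, mul_left_comm, norm_mul, norm_pow, Complex.norm_real, Real.norm_eq_abs,
    abs_of_pos ht.1, norm_mul]
  refine (mul_le_mul_of_nonneg_left (norm_coord_mul_Q_self_le hω hρ hexp hM' ht.1 hz υ hc)
    (pow_nonneg ht.1.le _)).trans ?_
  rw [← mul_assoc c]
  exact two_pow_mul_le ht m (mul_nonneg hc0 normM'_nonneg)

include hTM

theorem summable_varphiTerm (ht : t ∈ Ioo 0 T) {z : CSpace ν} (hz : z ∈ tube ν 3) :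
    Summable (varphiTerm ω ρ t z z) :=
  Summable.of_norm_bounded (hasSum_geometric_varphiBound hTM 1).summable
    (norm_varphiTerm_le hω hρ hexp hM' ht hz)

theorem norm_varphi_le (ht : t ∈ Ioo 0 T) {z : CSpace ν} (hz : z ∈ tube ν 3) :
    ‖varphi ω ρ t z z‖ ≤ varphiBound ρ T := by
  have := tsum_of_norm_bounded (hasSum_geometric_varphiBound hTM 1)
    (norm_varphiTerm_le hω hρ hexp hM' ht hz)
  rwa [one_mul] at this

theorem norm_coord_mul_varphi_le (ht : t ∈ Ioo 0 T) {z : CSpace ν} (hz : z ∈ tube ν 3)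
    (υ : Fin ν) {c : ℝ} (hc : Real.cosh (ω υ * t / 2) ≤ c) :
    ‖z υ‖ * ‖varphi ω ρ t z z‖ ≤ c * varphiBound ρ T := by
  rw [← norm_mul, varphi, ← tsum_mul_left]
  exact tsum_of_norm_bounded (hasSum_geometric_varphiBound hTM c)
    (norm_coord_mul_varphiTerm_le hω hρ hexp hM' ht hz υ hc)

theorem hasFDerivAt_varphi (ht : t ∈ Ioo 0 T) {z : CSpace ν} (hz : z ∈ tube ν 3) :
    HasFDerivAt (fun z => varphi ω ρ t z z)
      (∑' m, fderiv ℂ (fun z => varphiTerm ω ρ t z z m) z) z :=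
  hasFDerivAt_tsum_of_differentiableOn (f := fun m z => varphiTerm ω ρ t z z m) (isOpen_tube 3)
    (fun m _ hw => ((hasFDerivAt_Q_self hω hρ.continuous hexp ht.1 hw).const_mul
      ((t : ℂ) ^ (2 * m))).differentiableAt.differentiableWithinAt)
    (fun m _ hw => norm_varphiTerm_le hω hρ hexp hM' ht hw m)
    (hasSum_geometric_varphiBound hTM 1).summable hz

theorem fderiv_varphi_zero (ht : t ∈ Ioo 0 T)
    (hgrad : ∀ υ : Fin ν, ∫ ξ : RSpace ν, (ξ υ : ℂ) * ρ ξ = 0) :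
    fderiv ℂ (fun z => varphi ω ρ t z z) 0 = 0 := by
  rw [(hasFDerivAt_varphi hω hρ hexp hM' hTM ht
    (mem_tube_of_im_eq_zero (by norm_num) (by simp))).fderiv]
  have : ∀ m, fderiv ℂ (fun z => varphiTerm ω ρ t z z m) 0 = 0 := fun m => by
    have h := (hasFDerivAt_Q_self_zero (m := m) hω hρ.continuous hexp hgrad ht.1).const_mul
      ((t : ℂ) ^ (2 * m))
    have h0 : ((t : ℂ) ^ (2 * m)) • (0 : CSpace ν →L[ℂ] ℂ) = 0 := by ext; simp
    exact h.fderiv.trans h0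
  simp only [this, tsum_zero]

omit hω hM' hTM in
theorem varphi_zero (hgrad : ∀ υ : Fin ν, ∫ ξ : RSpace ν, (ξ υ : ℂ) * ρ ξ = 0)
    (hzero : ∫ ξ : RSpace ν, ρ ξ = 0) : varphi ω ρ t 0 0 = 0 := by
  simp only [varphi, varphiTerm, Q_zero_zero hρ.continuous hexp hgrad hzero, mul_zero, tsum_zero]

theorem continuousOn_varphi :
    ContinuousOn (fun q : ℝ × CSpace ν => varphi ω ρ q.1 q.2 q.2) (Ioo 0 T ×ˢ tube ν 3) := by
  refine continuousOn_tsum (fun m => ?_) (hasSum_geometric_varphiBound hTM 1).summable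
    (fun m q hq => norm_varphiTerm_le hω hρ hexp hM' hq.1 hq.2 m)
  exact ContinuousOn.mul (by fun_prop) (continuousOn_Q_self hω hρ.continuous hexp)

omit hM' hTM in
theorem im_varphi_eq_zero (hreal : ∀ ξ, (starRingEnd ℂ) (ρ ξ) = ρ (-ξ)) (ht : t ∈ Ioo 0 T)
    {z : CSpace ν} (hz : z ∈ realVectors ν) : (varphi ω ρ t z z).im = 0 := by
  rw [← Complex.conj_eq_iff_im, varphi, Complex.conj_tsum]
  refine tsum_congr fun m => ?_
  rw [varphiTerm, map_mul, map_pow, Complex.conj_ofReal,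
    Complex.conj_eq_iff_im.2 (im_Q_self_eq_zero hω hρ hexp hreal ht.1 hz)]

end Series

/-! ### The diagonal form, its inverse and the phase. -/

section Quadratic

open Set Filter Topology

variable {ν : ℕ} {ω : Fin ν → ℝ} {t T : ℝ}

/-- The diagonal entries `½ ω_υ th(ω_υ t / 2)` of `D_ω²`. -/
noncomputable def quadCoeff (ω : Fin ν → ℝ) (t : ℝ) (υ : Fin ν) : ℝ :=
  1 / 2 * (ω υ * Real.tanh (ω υ * t / 2))

theorem tanh_pos {u : ℝ} (hu : 0 < u) : 0 < Real.tanh u := by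
  rw [Real.tanh_eq_sinh_div_cosh]
  exact div_pos (Real.sinh_pos_iff.2 hu) (Real.cosh_pos u)

theorem quadCoeff_pos (hω : ∀ υ, 0 < ω υ) (ht : 0 < t) (υ : Fin ν) : 0 < quadCoeff ω t υ := by
  have h := hω υ
  have : 0 < Real.tanh (ω υ * t / 2) := tanh_pos (by positivity)
  unfold quadCoeff
  positivity

/-- The quadratic form `∑_υ d_υ u_υ v_υ` with `d_υ = ½ ω_υ th(ω_υ t / 2)`. -/
noncomputable def quadForm (ω : Fin ν → ℝ) (t : ℝ) : CSpace ν →L[ℂ] CSpace ν →L[ℂ] ℂ :=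
  ∑ υ, (EuclideanSpace.proj υ : CSpace ν →L[ℂ] ℂ).smulRight
    ((quadCoeff ω t υ : ℂ) • (EuclideanSpace.proj υ : CSpace ν →L[ℂ] ℂ))

theorem quadForm_apply (u v : CSpace ν) :
    quadForm ω t u v = ∑ υ, (quadCoeff ω t υ : ℂ) * (u υ * v υ) := by
  rw [quadForm, sum_apply, sum_apply]
  refine Finset.sum_congr rfl fun υ _ => ?_
  simp
  ring

theorem quadForm_symm (u v : CSpace ν) : quadForm ω t u v = quadForm ω t v u := by
  rw [quadForm_apply, quadForm_apply]
  exact Finset.sum_congr rfl fun υ _ => by ring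

/-- The map from linear forms to vectors which is `t` times the inverse of the quadratic form. -/
noncomputable def quadInv (ω : Fin ν → ℝ) (t : ℝ) : (CSpace ν →L[ℂ] ℂ) →L[ℂ] CSpace ν :=
  ∑ υ, ((t / quadCoeff ω t υ : ℝ) : ℂ) •
    (ContinuousLinearMap.apply ℂ ℂ (EuclideanSpace.single υ (1 : ℂ) : CSpace ν)).smulRight
      (EuclideanSpace.single υ (1 : ℂ) : CSpace ν)

theorem quadInv_apply (ℓ : CSpace ν →L[ℂ] ℂ) (υ : Fin ν) :
    quadInv ω t ℓ υ =
      ((t / quadCoeff ω t υ : ℝ) : ℂ) * ℓ (EuclideanSpace.single υ (1 : ℂ)) := by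
  rw [quadInv, sum_apply, WithLp.ofLp_sum, Finset.sum_apply, Finset.sum_eq_single υ]
  · simp
  · intro b _ hb
    simp [hb.symm]
  · simp

theorem sum_coord_mul_single (ℓ : CSpace ν →L[ℂ] ℂ) (v : CSpace ν) :
    ℓ v = ∑ υ, ℓ (EuclideanSpace.single υ (1 : ℂ)) * v υ := by
  have h : v = ∑ υ, v υ • (EuclideanSpace.single υ (1 : ℂ) : CSpace ν) := by
    ext i
    rw [WithLp.ofLp_sum, Finset.sum_apply, Finset.sum_eq_single i]
    · simp
    · intro b _ hb
      simp [hb.symm]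
    · simp
  conv_lhs => rw [h]
  rw [map_sum]
  exact Finset.sum_congr rfl fun υ _ => by rw [map_smul, smul_eq_mul, mul_comm]

theorem quadForm_quadInv (hω : ∀ υ, 0 < ω υ) (ht : 0 < t) (ℓ : CSpace ν →L[ℂ] ℂ)
    (v : CSpace ν) : quadForm ω t (quadInv ω t ℓ) v = t * ℓ v := by
  rw [quadForm_apply, sum_coord_mul_single ℓ v, Finset.mul_sum]
  refine Finset.sum_congr rfl fun υ _ => ?_
  have h : (quadCoeff ω t υ : ℂ) ≠ 0 := by exact_mod_cast (quadCoeff_pos hω ht υ).ne'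
  rw [quadInv_apply]
  push_cast
  field_simp

/-- With `u = ω_υ t / 2`, the inequality `u ≤ (1 + u) th u` balances the factor `t` against the
degeneracy of the form as `t → 0`. -/
theorem div_quadCoeff_le (hω : ∀ υ, 0 < ω υ) (ht : 0 < t) (υ : Fin ν) :
    t / quadCoeff ω t υ ≤ 4 / ω υ ^ 2 * (1 + ω υ * t / 2) := by
  have h := hω υ
  rw [div_le_iff₀ (quadCoeff_pos hω ht υ), quadCoeff]
  set u := ω υ * t / 2 with hu
  have hu0 : 0 < u := by positivity
  have h1 := mul_cosh_le hu0.le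
  have h2 : u ≤ (1 + u) * Real.tanh u := by
    rw [Real.tanh_eq_sinh_div_cosh, ← mul_div_assoc, le_div_iff₀ (Real.cosh_pos u)]
    exact h1
  have h3 : t = 2 / ω υ * u := by rw [hu]; field_simp
  calc t = 2 / ω υ * u := h3
    _ ≤ 2 / ω υ * ((1 + u) * Real.tanh u) := by gcongr
    _ = _ := by field_simp; ring

/-- The Euclidean norm is bounded by the sum of the coordinates; the resulting factor `ν` is covered
by the power `ν^{5/2}` in the smallness condition. -/
theorem norm_quadInv_le (hω : ∀ υ, 0 < ω υ) (ht : 0 < t) {c : ℝ}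
    (hc : ∀ υ, t / quadCoeff ω t υ ≤ c) : ‖quadInv ω t‖ ≤ ν * c := by
  rcases Nat.eq_zero_or_pos ν with rfl | hν
  · have : quadInv ω t = 0 := by simp [quadInv]
    rw [this]
    simp
  have hc0 : 0 ≤ c := (div_pos ht (quadCoeff_pos hω ht ⟨0, hν⟩)).le.trans (hc _)
  refine ContinuousLinearMap.opNorm_le_bound _ (by positivity) fun ℓ => ?_
  refine (norm_le_sum_norm_coord _).trans ?_
  calc _ ≤ ∑ _υ : Fin ν, c * ‖ℓ‖ := by
        refine Finset.sum_le_sum fun υ _ => ?_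
        rw [quadInv_apply, norm_mul, Complex.norm_real, Real.norm_eq_abs,
          abs_of_pos (div_pos ht (quadCoeff_pos hω ht υ))]
        refine mul_le_mul (hc υ) ?_ (norm_nonneg _) hc0
        simpa using ℓ.le_opNorm (EuclideanSpace.single υ (1 : ℂ))
    _ = _ := by
        rw [Finset.sum_const, Finset.card_univ, Fintype.card_fin, nsmul_eq_mul, mul_assoc]

theorem continuousOn_sum_smul_const {ι F : Type*} [NormedAddCommGroup F] [NormedSpace ℂ F]
    {s : Finset ι} {I : Set ℝ} {c : ι → ℝ → ℂ} (A : ι → F) (hc : ∀ i, ContinuousOn (c i) I) :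
    ContinuousOn (fun t => ∑ i ∈ s, c i t • A i) I :=
  continuousOn_finsetSum _ fun i _ => (hc i).smul continuousOn_const

theorem continuousOn_div_quadCoeff (hω : ∀ υ, 0 < ω υ) (υ : Fin ν) :
    ContinuousOn (fun t => ((t / quadCoeff ω t υ : ℝ) : ℂ)) (Ioo 0 T) := by
  refine Complex.continuous_ofReal.comp_continuousOn (ContinuousOn.div continuousOn_id ?_
    fun t ht => (quadCoeff_pos hω ht.1 υ).ne')
  unfold quadCoeff
  simp only [Real.tanh_eq_sinh_div_cosh]
  refine ContinuousOn.mul continuousOn_const (ContinuousOn.mul continuousOn_const ?_)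
  exact ContinuousOn.div (by fun_prop) (by fun_prop) fun t _ => (Real.cosh_pos _).ne'

set_option maxSynthPendingDepth 3 in
theorem continuousOn_quadInv (hω : ∀ υ, 0 < ω υ) : ContinuousOn (quadInv ω) (Ioo 0 T) :=
  continuousOn_sum_smul_const
    (c := fun υ t => ((t / quadCoeff ω t υ : ℝ) : ℂ)) _ (continuousOn_div_quadCoeff hω)

theorem quadInv_mem_realVectors {ℓ : CSpace ν →L[ℂ] ℂ}
    (h : ∀ v ∈ realVectors ν, (ℓ v).im = 0) : quadInv ω t ℓ ∈ realVectors ν := by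
  intro υ
  rw [quadInv_apply, Complex.im_ofReal_mul, h, mul_zero]
  intro j
  rw [PiLp.single_apply]
  split_ifs <;> simp

theorem dotProduct_Dmat_mulVec (hω : ∀ υ, 0 < ω υ) (ht : 0 < t) (v : CSpace ν) :
    (Dmat ω t).mulVec (WithLp.ofLp v) ⬝ᵥ (Dmat ω t).mulVec (WithLp.ofLp v) =
      quadForm ω t v v := by
  rw [quadForm_apply, dotProduct]
  refine Finset.sum_congr rfl fun υ _ => ?_
  rw [Dmat, Matrix.mulVec_diagonal, mul_mul_mul_comm, ← Complex.ofReal_mul]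
  congr 2
  have h := hω υ
  have h1 : 0 ≤ Real.tanh (ω υ * t / 2) := (tanh_pos (by positivity)).le
  rw [quadCoeff, mul_mul_mul_comm, mul_mul_mul_comm (Real.sqrt (ω υ)), Real.mul_self_sqrt h.le,
    Real.mul_self_sqrt h1, div_mul_div_comm, Real.mul_self_sqrt (by norm_num), one_mul]

/-- The half-angle identity `(ch τ - 1) / sh τ = th(τ/2)`, coordinate by coordinate. -/
theorem phase_self (hω : ∀ υ, 0 < ω υ) (ht : 0 < t) (ρ : RSpace ν → ℂ) (x : CSpace ν) :
    phase ω ρ t x x = quadForm ω t x x - t * varphi ω ρ t x x := by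
  rw [phase, quadForm_apply, Finset.mul_sum]
  congr 1
  refine Finset.sum_congr rfl fun υ _ => ?_
  have h := hω υ
  have hs : 0 < Real.sinh (ω υ * t / 2) := Real.sinh_pos_iff.2 (by positivity)
  have hc := Real.cosh_pos (ω υ * t / 2)
  have key : 1 / 4 * (ω υ / Real.sinh (ω υ * t) * (2 * Real.cosh (ω υ * t) - 2)) =
      quadCoeff ω t υ := by
    rw [quadCoeff, Real.tanh_eq_sinh_div_cosh, show ω υ * t = 2 * (ω υ * t / 2) by ring,
      Real.sinh_two_mul, Real.cosh_two_mul, Real.cosh_sq,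
      show 2 * (ω υ * t / 2) / 2 = ω υ * t / 2 by ring]
    field_simp
    ring
  rw [← key]
  push_cast
  ring

end Quadratic

/-! ### Uniform convergence on compact sets. -/

section Uniform

open Set Filter Topology

/-- Joint continuity gives locally uniform continuity in the parameter. -/
theorem tendstoUniformlyOn_of_continuousOn {X E : Type*} [TopologicalSpace X]
    [UniformSpace E] {I : Set ℝ} {U K : Set X} {Λ : ℝ → X → E} (hI : IsOpen I)
    (hΛ : ContinuousOn (fun p : ℝ × X => Λ p.1 p.2) (I ×ˢ U)) (hK : IsCompact K) (hKU : K ⊆ U)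
    {t₀ : ℝ} (ht₀ : t₀ ∈ I) : TendstoUniformlyOn Λ (Λ t₀) (𝓝 t₀) K := by
  intro v hv
  have h := hK.mem_uniformity_of_prod (f := Λ) (s := I) ?_ ht₀ (symm_le_uniformity hv)
  · obtain ⟨w, hw, h⟩ := h
    rw [hI.nhdsWithin_eq ht₀] at hw
    exact Filter.mem_of_superset hw fun t ht x hx => h t ht x hx
  · exact hΛ.mono (prod_mono Subset.rfl hKU)

end Uniform

/-! ### Bookkeeping of the smallness condition. -/

section Constants

open MeasureTheory Set

variable {ν : ℕ} {ω : Fin ν → ℝ} {ρ : RSpace ν → ℂ} {t T : ℝ}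

theorem omegaFlat_le (ω : Fin ν → ℝ) (υ : Fin ν) : omegaFlat ω ≤ ω υ :=
  ciInf_le (finite_range ω).bddBelow υ

theorem le_omegaSharp (ω : Fin ν → ℝ) (υ : Fin ν) : ω υ ≤ omegaSharp ω :=
  le_ciSup (finite_range ω).bddAbove υ

theorem omegaFlat_pos (hν : 1 ≤ ν) (hω : ∀ υ, 0 < ω υ) : 0 < omegaFlat ω := by
  have : Nonempty (Fin ν) := ⟨⟨0, hν⟩⟩
  obtain ⟨υ, hυ⟩ := exists_eq_ciInf_of_finite (f := ω)
  rw [omegaFlat, ← hυ]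
  exact hω υ

/-- A bound for the inverse of the quadratic form, uniform in `t ∈ ]0,T[`. -/
noncomputable def invBound (ω : Fin ν → ℝ) (T : ℝ) : ℝ :=
  4 / omegaFlat ω ^ 2 * (1 + omegaFlat ω * T)

theorem div_quadCoeff_le_invBound (hν : 1 ≤ ν) (hω : ∀ υ, 0 < ω υ) (ht : t ∈ Ioo 0 T)
    (υ : Fin ν) : t / quadCoeff ω t υ ≤ invBound ω T := by
  have h := hω υ
  have hf := omegaFlat_pos hν hω
  have hle := omegaFlat_le ω υ
  have ht0 := ht.1
  have htT := ht.2
  refine (div_quadCoeff_le hω ht.1 υ).trans ?_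
  rw [invBound, show 4 / ω υ ^ 2 * (1 + ω υ * t / 2) = 4 / ω υ ^ 2 + 4 / ω υ * (t / 2) by
    field_simp, show 4 / omegaFlat ω ^ 2 * (1 + omegaFlat ω * T) =
    4 / omegaFlat ω ^ 2 + 4 / omegaFlat ω * T by field_simp]
  gcongr
  linarith

theorem cosh_le_cosh_omegaSharp (hω : ∀ υ, 0 < ω υ) (ht : t ∈ Ioo 0 T) (υ : Fin ν) :
    Real.cosh (ω υ * t / 2) ≤ Real.cosh (omegaSharp ω * T / 2) := by
  have h := hω υ
  have ht0 := ht.1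
  have htT := ht.2
  have hle := le_omegaSharp ω υ
  have h1 : ω υ * t / 2 ≤ omegaSharp ω * T / 2 := by
    have := h.le.trans hle
    gcongr
  rw [Real.cosh_le_cosh, abs_of_pos (by positivity), abs_of_pos (lt_of_lt_of_le (by positivity) h1)]
  exact h1

/-- Up to the 4 in `invBound`, the left side is the assumed small quantity once `ω_♭ / ω_♭³` is
enlarged to `ω_♯ / ω_♭³`. Then `ν² ≤ ν^{5/2}` and `4 ν^{5/2} α < 1/17`. -/
theorem sq_mul_invBound_mul_le (hν : 1 ≤ ν) {α : ℝ} (hα : 0 < α)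
    (hα' : 34 * (ν : ℝ) ^ (5 / 2 : ℝ) * α < 1 / 2) (hω : ∀ υ, 0 < ω υ) (hT : 0 < T)
    (hTM : 4 * T ^ 2 * normM ρ < 1)
    (hsmall : Real.cosh (omegaSharp ω * T / 2) * (omegaSharp ω * (1 + omegaFlat ω * T) *
      normM' ρ / (omegaFlat ω ^ 3 * (1 - 4 * T ^ 2 * normM ρ))) < α) :
    (ν : ℝ) ^ 2 * invBound ω T * Real.cosh (omegaSharp ω * T / 2) * varphiBound ρ T ≤ 1 / 17 := by
  have hf := omegaFlat_pos hν hω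
  have hfs : omegaFlat ω ≤ omegaSharp ω := (omegaFlat_le ω ⟨0, hν⟩).trans (le_omegaSharp ω _)
  have hr : 0 < 1 - 4 * T ^ 2 * normM ρ := by linarith
  have hM' := normM'_nonneg (ρ := ρ)
  have hC := Real.cosh_pos (omegaSharp ω * T / 2)
  have h1 : invBound ω T * Real.cosh (omegaSharp ω * T / 2) * varphiBound ρ T ≤
      4 * (Real.cosh (omegaSharp ω * T / 2) * (omegaSharp ω * (1 + omegaFlat ω * T) *
      normM' ρ / (omegaFlat ω ^ 3 * (1 - 4 * T ^ 2 * normM ρ)))) := by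
    calc _ = 4 * (Real.cosh (omegaSharp ω * T / 2) * (omegaFlat ω * (1 + omegaFlat ω * T) *
          normM' ρ / (omegaFlat ω ^ 3 * (1 - 4 * T ^ 2 * normM ρ)))) := by
          rw [invBound, varphiBound]
          field_simp
      _ ≤ _ := by gcongr
  have h2 : (ν : ℝ) ^ 2 ≤ (ν : ℝ) ^ (5 / 2 : ℝ) := by
    rw [← Real.rpow_natCast]
    exact Real.rpow_le_rpow_of_exponent_le (by exact_mod_cast hν) (by norm_num)
  have h3 : invBound ω T * Real.cosh (omegaSharp ω * T / 2) * varphiBound ρ T ≤ 4 * α := by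
    linarith
  calc _ = (ν : ℝ) ^ 2 *
        (invBound ω T * Real.cosh (omegaSharp ω * T / 2) * varphiBound ρ T) := by ring
    _ ≤ (ν : ℝ) ^ 2 * (4 * α) := by gcongr
    _ ≤ (ν : ℝ) ^ (5 / 2 : ℝ) * (4 * α) := by gcongr
    _ ≤ 1 / 17 := by linarith

/-- One factor `ν` comes from the norm of the inverse form and the other from summing over the
coordinates of `z`. As `ν` and `ch` are at least 1, each contribution is at most `1/17`, and the
second bound is `1/17 + 2/17`. -/
theorem morse_constants (hν : 1 ≤ ν) {α : ℝ} (hα : 0 < α)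
    (hα' : 34 * (ν : ℝ) ^ (5 / 2 : ℝ) * α < 1 / 2) (hω : ∀ υ, 0 < ω υ) (hT : 0 < T)
    (hTM : 4 * T ^ 2 * normM ρ < 1)
    (hsmall : Real.cosh (omegaSharp ω * T / 2) * (omegaSharp ω * (1 + omegaFlat ω * T) *
      normM' ρ / (omegaFlat ω ^ 3 * (1 - 4 * T ^ 2 * normM ρ))) < α) :
    ν * invBound ω T * varphiBound ρ T ≤ 1 / 17 ∧
      ν * invBound ω T * (ν * (Real.cosh (omegaSharp ω * T / 2) * varphiBound ρ T) +
        2 * varphiBound ρ T) ≤ 3 / 17 := by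
  have h := sq_mul_invBound_mul_le hν hα hα' hω hT hTM hsmall
  have hf := omegaFlat_pos hν hω
  have hν' : (1 : ℝ) ≤ ν := by exact_mod_cast hν
  have hc : 0 ≤ invBound ω T := by unfold invBound; positivity
  have hN : 0 ≤ varphiBound ρ T := div_nonneg normM'_nonneg (by linarith)
  have hC := Real.one_le_cosh (omegaSharp ω * T / 2)
  have h1 : ν * invBound ω T * varphiBound ρ T ≤ 1 / 17 := by
    refine le_trans ?_ h
    calc ν * invBound ω T * varphiBound ρ T
        = ν * invBound ω T * varphiBound ρ T * (1 * 1) := by ring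
      _ ≤ ν * invBound ω T * varphiBound ρ T *
          (ν * Real.cosh (omegaSharp ω * T / 2)) := by gcongr
      _ = _ := by ring
  refine ⟨h1, ?_⟩
  linarith

/-- Width 3 leaves a margin of 2 around the unit tube for Cauchy's estimates. -/
theorem isMorseDomain_tube : IsMorseDomain (tube ν 1) (tube ν 3) where
  isOpen_left := isOpen_tube 1
  isOpen_right := isOpen_tube 3
  smul_mem _ hx _ hs := smul_mem_tube hx hs
  closedBall_subset _ hx := by
    have h := closedBall_subset_tube (r := 2) hx
    norm_num at h
    exact h

end Constants

end SemiclassicalPhase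

/-! ### The global Morse lemma. -/

theorem mainTheorem6 (ν : ℕ) (hν : 1 ≤ ν)
    (α : ℝ) (hα : 0 < α) (hα' : 34 * (ν : ℝ) ^ (5 / 2 : ℝ) * α < 1 / 2)
    (ρ : EuclideanSpace ℝ (Fin ν) → ℂ) (hρ : Differentiable ℝ ρ)
    (hexp : ∀ R : ℝ, 0 < R →
      MeasureTheory.Integrable
        (fun ξ : EuclideanSpace ℝ (Fin ν) => Real.exp (R * ‖ξ‖) * ‖ρ ξ‖))
    (hM' : MeasureTheory.Integrable (SemiclassicalPhase.weightM' ρ))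
    (hreal : ∀ ξ, (starRingEnd ℂ) (ρ ξ) = ρ (-ξ))
    (hgrad : ∀ j : Fin ν, ∫ ξ : EuclideanSpace ℝ (Fin ν), (ξ j : ℂ) * ρ ξ = 0)
    (hzero : ∫ ξ : EuclideanSpace ℝ (Fin ν), ρ ξ = 0)
    (ω : Fin ν → ℝ) (hω : ∀ υ, 0 < ω υ) (T : ℝ) (hT : 0 < T)
    (hTM : 4 * T ^ 2 * SemiclassicalPhase.normM ρ < 1)
    (hsmall :
      Real.cosh (SemiclassicalPhase.omegaSharp ω * T / 2) *
        (SemiclassicalPhase.omegaSharp ω * (1 + SemiclassicalPhase.omegaFlat ω * T) *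
            SemiclassicalPhase.normM' ρ /
          (SemiclassicalPhase.omegaFlat ω ^ 3 *
            (1 - 4 * T ^ 2 * SemiclassicalPhase.normM ρ))) < α) :
    (∀ t ∈ Set.Ioo 0 T, ∀ x ∈ SemiclassicalPhase.tube ν 1,
        Summable (SemiclassicalPhase.varphiTerm ω ρ t x x)) ∧
    ∃ Λ : ℝ → EuclideanSpace ℂ (Fin ν) → EuclideanSpace ℂ (Fin ν),
      SemiclassicalPhase.ContinuousAnalyticFamily T (SemiclassicalPhase.tube ν 1) Λ ∧
      (∀ t ∈ Set.Ioo 0 T, ∀ x : EuclideanSpace ℂ (Fin ν),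
        (∀ j, (x j).im = 0) → ∀ j, (Λ t x j).im = 0) ∧
      (∀ t ∈ Set.Ioo 0 T, ∀ x ∈ SemiclassicalPhase.tube ν 1,
        ‖fderiv ℂ (Λ t) x‖ ≤ 1 / 2) ∧
      (∀ t ∈ Set.Ioo 0 T, ∀ x ∈ SemiclassicalPhase.tube ν 1,
        ∀ θ : Fin ν → ℂ,
          θ = (SemiclassicalPhase.Dmat ω t).mulVec (WithLp.ofLp (x + Λ t x)) →
          SemiclassicalPhase.phase ω ρ t x x = θ ⬝ᵥ θ) := by
  have hD := SemiclassicalPhase.isMorseDomain_tube (ν := ν)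
  have h13 : SemiclassicalPhase.tube ν 1 ⊆ SemiclassicalPhase.tube ν 3 :=
    SemiclassicalPhase.tube_mono (by norm_num)
  refine ⟨fun t ht x hx =>
    SemiclassicalPhase.summable_varphiTerm hω hρ hexp hM' hTM ht (h13 hx), ?_⟩
  have hd : ∀ t ∈ Set.Ioo 0 T, DifferentiableOn ℂ
      (fun z => SemiclassicalPhase.varphi ω ρ t z z) (SemiclassicalPhase.tube ν 3) :=
    fun t ht z hz => (SemiclassicalPhase.hasFDerivAt_varphi hω hρ hexp hM' hTM ht
      hz).differentiableAt.differentiableWithinAt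
  have hN : ∀ t ∈ Set.Ioo 0 T, ∀ z ∈ SemiclassicalPhase.tube ν 3,
      ‖SemiclassicalPhase.varphi ω ρ t z z‖ ≤ SemiclassicalPhase.varphiBound ρ T :=
    fun t ht z hz => SemiclassicalPhase.norm_varphi_le hω hρ hexp hM' hTM ht hz
  have hJ : ∀ t ∈ Set.Ioo 0 T,
      ‖SemiclassicalPhase.quadInv ω t‖ ≤ ν * SemiclassicalPhase.invBound ω T :=
    fun t ht => SemiclassicalPhase.norm_quadInv_le hω ht.1
      (SemiclassicalPhase.div_quadCoeff_le_invBound hν hω ht)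
  -- The bound for `‖z‖` is summed from the bounds for single coordinates, at the price of a factor
  -- `ν`.
  have hB : ∀ t ∈ Set.Ioo 0 T, ∀ z ∈ SemiclassicalPhase.tube ν 3,
      ‖z‖ * ‖SemiclassicalPhase.varphi ω ρ t z z‖ ≤
        ν * (Real.cosh (SemiclassicalPhase.omegaSharp ω * T / 2) *
          SemiclassicalPhase.varphiBound ρ T) := by
    intro t ht z hz
    refine (mul_le_mul_of_nonneg_right (SemiclassicalPhase.norm_le_sum_norm_coord z)
      (norm_nonneg _)).trans ?_
    rw [Finset.sum_mul]
    refine (Finset.sum_le_sum fun υ _ => SemiclassicalPhase.norm_coord_mul_varphi_le hω hρ hexp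
      hM' hTM ht hz υ (SemiclassicalPhase.cosh_le_cosh_omegaSharp hω ht υ)).trans_eq ?_
    rw [Finset.sum_const, Finset.card_univ, Fintype.card_fin, nsmul_eq_mul]
  obtain ⟨hCN, hCB⟩ := SemiclassicalPhase.morse_constants hν hα hα' hω hT hTM hsmall
  have hreals : ∀ u ∈ SemiclassicalPhase.realVectors ν, u ∈ SemiclassicalPhase.tube ν 1 :=
    fun u hu => SemiclassicalPhase.mem_tube_of_im_eq_zero one_pos hu
  -- With this choice `x + Λ(t,x) = (1 - K)^{1/2} x`, where `K` is `t` times the inverse form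
  -- composed with the mean Hessian.
  refine ⟨fun t => SemiclassicalPhase.morseDisplacement (SemiclassicalPhase.quadInv ω t)
    (fun z => SemiclassicalPhase.varphi ω ρ t z z), ⟨fun t ht => ?_, fun t₀ ht₀ K hKU hK => ?_⟩,
    fun t ht x hx => ?_, fun t ht x hx => ?_, ?_⟩
  · exact SemiclassicalPhase.analyticOnNhd_morseDisplacement hD (hd t ht) (hN t ht) (hJ t ht) hCN
  · exact SemiclassicalPhase.tendstoUniformlyOn_of_continuousOn isOpen_Ioo
      (SemiclassicalPhase.continuousOn_uncurry_morseDisplacement hD hd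
        (SemiclassicalPhase.continuousOn_varphi hω hρ hexp hM' hTM) hN hJ
        (SemiclassicalPhase.continuousOn_quadInv hω) hCN) hK hKU ht₀
  · exact SemiclassicalPhase.morseDisplacement_mem SemiclassicalPhase.smul_mem_realVectors
      SemiclassicalPhase.isClosed_realVectors hreals hD (hd t ht) (hN t ht) (hJ t ht) hCN
      (fun w hw => SemiclassicalPhase.im_varphi_eq_zero hω hρ hexp hreal ht hw)
      (fun ℓ hℓ => SemiclassicalPhase.quadInv_mem_realVectors hℓ) hx
  · exact SemiclassicalPhase.norm_fderiv_morseDisplacement_le hD (hd t ht) (hN t ht) (hB t ht)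
      (hJ t ht) hCN hCB hx
  · rintro t ht x hx θ rfl
    rw [SemiclassicalPhase.dotProduct_Dmat_mulVec hω ht.1,
      SemiclassicalPhase.phase_self hω ht.1]
    exact (SemiclassicalPhase.bilin_morseDisplacement hD (hd t ht) (hN t ht) (hJ t ht) hCN
      (SemiclassicalPhase.varphi_zero hρ hexp hgrad hzero)
      (SemiclassicalPhase.fderiv_varphi_zero hω hρ hexp hM' hTM ht hgrad)
      SemiclassicalPhase.quadForm_symm (SemiclassicalPhase.quadForm_quadInv hω ht.1) hx).symm
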